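/- Let $N\ge 1$ be an integer, $b\in\mathbb C$ with $|b|=1$, $\mathrm{Re}\,b>0$, $\mathrm{Im}\,b>0$, and $\lambda_1,\lambda_2\in\mathbb C^\times$. Put $\hbar=\frac{\pi i}{N}(1+b^2)$, $\tilde\hbar=\frac{\pi i}{N}(1+b^{-2})$, $\mathbf q=e^{\hbar}$, $\tilde{\mathbf q}=e^{\tilde\hbar}$, $q=e^{\hbar/2}$. **Weyl operators.** On functions $f(\mu,m)$, entire in $\mu$, with $m\in\mathbb Z/N\mathbb Z$, let $\mathbf uf(\mu,m)=f(\mu+ib,m-1)$, $\mathbf y f(\mu,m)=y(\mu,m)f(\mu,m)$ with $y=e^{\frac{2\pi i}{N}(-ib\mu-m)}$, and $\tilde{\mathbf u}f(\mu,m)=f(\mu+ib^{-1},m+1)$, $\tilde{\mathbf y}f=\tilde yf$ with $\tilde y=e^{\frac{2\pi i}{N}(-ib^{-1}\mu+m)}$. For $\alpha,\beta\in\mathbb Z$ put $e^{\alpha\mathbf U+\beta\mathbf Y}=\mathbf q^{-\alpha\beta}\mathbf u^\alpha\mathbf y^\beta$ and $e^{\alpha\tilde{\mathbf U}+\beta\tilde{\mathbf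 Y}}=\tilde{\mathbf q}^{-\alpha\beta}\tilde{\mathbf u}^\alpha\tilde{\mathbf y}^\beta$. These act in $\mathcal H=L^2(\mathbb R\times\mathbb Z/N\mathbb Z)$. Elements of $\mathcal H\otimes\mathcal H$ are written $f(\mu_2,m_2\mid\mu_1,m_1)$, and a subscript $2$ (resp. $1$) on an operator means that it acts on the first (resp. second) tensor factor. Let $\mathscr W\subset\mathcal H$ be the span of the functions $e^{-\alpha\mu^2+\beta\mu}P(\mu)c(m)$ with $\mathrm{Re}\,\alpha>0$, $\beta\in\mathbb C$, $P$ a polynomial and $c:\mathbb Z/N\mathbb Z\to\mathbb C$, and $\mathscr W_2=\mathscr W\otimes\mathscr W$. **The tensor product Casimir.** Let $K_a^{\pm1}=e^{\mp\mathbf U_a}$, $F_a=-\frac{iq}{\mathbf q-\mathbf q^{-1}}e^{\mathbf Y_a}$, $E_a=-\frac{iq^{-1}}{\mathbf q-\mathbf q^{-1}}\big[(\lambda_a+\lambda_a^{-1})e^{-\mathbf Y_a}+e^{\mathbf U_a-\mathbf Y_a}+e^{-\mathbf U_a-\mathbf Y_a}\big]$ for $a=1,2$, and $$Q_{21}=-(\mathbf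 q-\mathbf q^{-1})^2(E_2K_1+E_1)(F_2+K_2^{-1}F_1)-\mathbf q^{-1}K_2K_1-\mathbf qK_2^{-1}K_1^{-1}\qquad\text{on }\mathscr W_2 ,$$ the Casimir $-(\mathbf q-\mathbf q^{-1})^2EF-\mathbf q^{-1}K-\mathbf qK^{-1}$ in the tensor product representation. With $Q_a=\lambda_a+\lambda_a^{-1}$ let $$Q_1'=e^{\mathbf Y_1-\mathbf U_1}+e^{-\mathbf Y_1+\mathbf U_1}+e^{-\mathbf Y_1}Q_1+e^{-\mathbf U_1}Q_2+e^{-\mathbf U_1-\mathbf Y_1},$$ which acts only on the second tensor factor. In $\mathcal H\otimes\mathcal H$ the operator $e^{\alpha\mathbf U_1+\beta\mathbf Y_1}$ denotes the adjoint of $e^{\alpha\tilde{\mathbf U}_1+\beta\tilde{\mathbf Y}_1}|_{\mathscr W_2}$, and the domain of $Q_1'$ is the intersection of the domains of its five terms. $\tilde Q_{21}$ and $\tilde Q_1'$ are the formal adjoints on $\mathscr W_2$, obtained by replacing $(\mathbf u,\mathbf y,\mathbf q,\lambda_a)$ by $(\tilde{\mathbf u},\tilde{\mathbf y},\tilde{\mathbf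 q},\overline{\lambda_a})$. **The operators $\mathcal S_2$ and $t_{21}$.** Let $\mathcal S_2f(\mu_2,m_2\mid\mu_1,m_1)=f(\mu_2,m_2\mid\mu_1-\mu_2,m_1-m_2)$; let $\mathcal V_2$ be the unitary operator which on $\mathscr W_2$ is $$\mathcal V_2f(\mu_2,m_2\mid\mu_1,m_1)=\frac1{N^2}\sum_{n,m\in\mathbb Z/N\mathbb Z}\int_{\mathbb R} d\nu\int_{\mathbb R} d\mu\,e^{\frac{2\pi i}{N}(\mu_2\nu-m_2n)}(-1)^{n^2}e^{\frac{\pi i}{N}(\nu^2-n^2)}e^{-\frac{2\pi i}{N}(\mu\nu-mn)}f(\mu,m\mid\mu_1,m_1);$$ and let $t_{21}=\mathcal V_2\,\varphi(-y_1y_2^{-1},-\tilde y_1\tilde y_2^{-1})\,\mathcal V_2^{-1}$, where $\varphi(y,\tilde y)=\Big[\prod_{j\ge0}(1+\mathbf q^{2j+1}y)\Big/\prod_{j\ge0}(1+\tilde{\mathbf q}^{-2j-1}\tilde y)\Big]^{-1}$ is the quantum dilogarithm, acting by multiplication, and $y_a=y(\mu_a,m_a)$, $\tilde y_a=\tilde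 y(\mu_a,m_a)$. **Lemma.** The operators $\mathcal S_2$, $\mathcal V_2$ and multiplication by $\varphi(-y_1y_2^{-1},-\tilde y_1\tilde y_2^{-1})$ are well-defined unitary operators on $\mathcal H\otimes\mathcal H$ (hence so is $t_{21}$), each uniquely determined by its formula, and the unitary $t_{21}\mathcal S_2$ conjugates $Q_{21}$ into $Q_1'$: 1. for every $w\in\mathscr W_2$, the vector $\mathcal S_2^{-1}t_{21}^{-1}w$ lies in the domain of $Q_1'$, and $t_{21}\mathcal S_2\,Q_1'\,\mathcal S_2^{-1}t_{21}^{-1}w=Q_{21}w$; 2. $\overline{Q_{21}|_{\mathscr W_2}}\subseteq t_{21}\mathcal S_2\,(\tilde Q_1'|_{\mathscr W_2})^{*}\,\mathcal S_2^{-1}t_{21}^{-1}$ and $\overline{Q_1'|_{\mathscr W_2}}\subseteq \mathcal S_2^{-1}t_{21}^{-1}\,(\tilde Q_{21}|_{\mathscr W_2})^{*}\,t_{21}\mathcal S_2$, where the bar denotes the closure of the graph. -/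

import Mathlib

open MeasureTheory

noncomputable section

namespace QTorus

/-! ### Hilbert space -/

/-- The measure on `ℝ × ℤ/N`: Lebesgue measure times counting measure. -/
abbrev measure1 (N : ℕ) : Measure (ℝ × ZMod N) := (volume : Measure ℝ).prod Measure.count

/-- The measure on `(ℝ × ℤ/N) × (ℝ × ℤ/N)`.  Throughout, a point is `((μ₂, m₂), (μ₁, m₁))`: the
first tensor factor carries the label `2`, the second tensor factor the label `1`. -/
abbrev measure2 (N : ℕ) : Measure ((ℝ × ZMod N) × (ℝ × ZMod N)) :=
  (measure1 N).prod (measure1 N)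

/-- `ℋ ⊗ ℋ = L²((ℝ × ℤ/N) × (ℝ × ℤ/N))`, where `ℋ = L²(ℝ) ⊗ ℂ^N = L²(ℝ × ℤ/N)`. -/
abbrev H2 (N : ℕ) : Type := Lp ℂ 2 (measure2 N)

/-! ### Functions with complex arguments, on which the Weyl operators act -/

/-- Functions `f(z, m)` of a complex variable and a residue class. -/
abbrev Fun1 (N : ℕ) : Type := ℂ × ZMod N → ℂ

/-- Functions `f(z₂, m₂ | z₁, m₁)`. -/
abbrev Fun2 (N : ℕ) : Type := (ℂ × ZMod N) × (ℂ × ZMod N) → ℂ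

/-- Restriction of the continuous variables to the real line. -/
def restrict {N : ℕ} (f : Fun2 N) (x : (ℝ × ZMod N) × (ℝ × ZMod N)) : ℂ :=
  f (((x.1.1 : ℂ), x.1.2), ((x.2.1 : ℂ), x.2.2))

open Classical in
/-- The element of `ℋ ⊗ ℋ` given by a function whose restriction to real arguments is square
integrable (this is so for all functions it is applied to, see `memLp_of_mem_W2`,
`onFst_mem_W2` and `onSnd_mem_W2`). -/
def toH2 {N : ℕ} (f : Fun2 N) : H2 N :=
  if h : MemLp (restrict f) 2 (measure2 N) then h.toLp (restrict f) else 0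

/-- `𝒲 = 𝔴 ⊗ ℂ^N`: the span of the functions `e^{-α μ² + β μ} Pol(μ) c(m)`, `Re α > 0` (written
through their entire extensions). -/
def W1 (N : ℕ) : Submodule ℂ (Fun1 N) :=
  Submodule.span ℂ {f | ∃ (α β : ℂ) (P : Polynomial ℂ) (c : ZMod N → ℂ), 0 < α.re ∧
    f = fun x => Complex.exp (-α * x.1 ^ 2 + β * x.1) * P.eval x.1 * c x.2}

/-- `𝒲₂ = 𝒲 ⊗ 𝒲`. -/
def W2 (N : ℕ) : Submodule ℂ (Fun2 N) :=
  Submodule.span ℂ {f | ∃ g ∈ W1 N, ∃ h ∈ W1 N, f = fun x => g x.1 * h x.2}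

/-! ### The quantum torus and its representation -/

/-- `ħ = (π i / N)(1 + b²)` for `b`; `ħ̃` is obtained by putting `b⁻¹` for `b`. -/
def hbar (N : ℕ) (b : ℂ) : ℂ := Real.pi * Complex.I / N * (1 + b ^ 2)

/-- `𝐪 = e^ħ`. -/
def bq (N : ℕ) (b : ℂ) : ℂ := Complex.exp (hbar N b)

/-- `𝐪̃ = e^ħ̃`. -/
def bqt (N : ℕ) (b : ℂ) : ℂ := Complex.exp (hbar N b⁻¹)

/-- `q = e^{ħ/2}`. -/
def sq (N : ℕ) (b : ℂ) : ℂ := Complex.exp (hbar N b / 2)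

/-- `q̃ = e^{ħ̃/2}`. -/
def sqt (N : ℕ) (b : ℂ) : ℂ := Complex.exp (hbar N b⁻¹ / 2)

/-- `y = exp[(2πi/N)(-i b μ - m)]`. -/
def yv {N : ℕ} (b : ℂ) (x : ℂ × ZMod N) : ℂ :=
  Complex.exp (2 * Real.pi * Complex.I / N * (-Complex.I * b * x.1 - (x.2.val : ℂ)))

/-- `ỹ = exp[(2πi/N)(-i b⁻¹ μ + m)]`. -/
def yvt {N : ℕ} (b : ℂ) (x : ℂ × ZMod N) : ℂ :=
  Complex.exp (2 * Real.pi * Complex.I / N * (-Complex.I * b⁻¹ * x.1 + (x.2.val : ℂ)))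

/-- The power `𝐮^α`, where `𝐮 f(μ, m) = f(μ + i b, m - 1)`. -/
def uPow (N : ℕ) (b : ℂ) (α : ℤ) : Module.End ℂ (Fun1 N) where
  toFun f x := f (x.1 + α * (Complex.I * b), x.2 - α)
  map_add' _ _ := rfl
  map_smul' _ _ := rfl

/-- The power `𝐮̃^α`, where `𝐮̃ f(μ, m) = f(μ + i b⁻¹, m + 1)`. -/
def uPowT (N : ℕ) (b : ℂ) (α : ℤ) : Module.End ℂ (Fun1 N) where
  toFun f x := f (x.1 + α * (Complex.I * b⁻¹), x.2 + α)
  map_add' _ _ := rfl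
  map_smul' _ _ := rfl

/-- The power `𝐲^β`, where `𝐲` is multiplication by `y`. -/
def yPow (N : ℕ) (b : ℂ) (β : ℤ) : Module.End ℂ (Fun1 N) where
  toFun f x := yv b x ^ β * f x
  map_add' _ _ := by funext x; simp [mul_add]
  map_smul' _ _ := by funext x; simp [mul_left_comm]

/-- The power `𝐲̃^β`, where `𝐲̃` is multiplication by `ỹ`. -/
def yPowT (N : ℕ) (b : ℂ) (β : ℤ) : Module.End ℂ (Fun1 N) where
  toFun f x := yvt b x ^ β * f x
  map_add' _ _ := by funext x; simp [mul_add]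
  map_smul' _ _ := by funext x; simp [mul_left_comm]

/-- `𝐮_{α,β} = e^{α𝐔 + β𝐘} = 𝐪^{-αβ} 𝐮^α 𝐲^β`. -/
def bu (N : ℕ) (b : ℂ) (α β : ℤ) : Module.End ℂ (Fun1 N) :=
  bq N b ^ (-(α * β)) • (uPow N b α * yPow N b β)

/-- `𝐮̃_{α,β} = e^{α𝐔̃ + β𝐘̃} = 𝐪̃^{-αβ} 𝐮̃^α 𝐲̃^β`. -/
def but (N : ℕ) (b : ℂ) (α β : ℤ) : Module.End ℂ (Fun1 N) :=
  bqt N b ^ (-(α * β)) • (uPowT N b α * yPowT N b β)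

/-! ### The representations of the quantum group -/

/-- `K_λ^{±1}` is `opK N b (±1)`. -/
def opK (N : ℕ) (b : ℂ) (s : ℤ) : Module.End ℂ (Fun1 N) := bu N b (-s) 0

/-- `F_λ`. -/
def opF (N : ℕ) (b : ℂ) : Module.End ℂ (Fun1 N) :=
  (-(Complex.I * sq N b) / (bq N b - (bq N b)⁻¹)) • bu N b 0 1

/-- `E_λ`. -/
def opE (N : ℕ) (b l : ℂ) : Module.End ℂ (Fun1 N) :=
  (-(Complex.I * (sq N b)⁻¹) / (bq N b - (bq N b)⁻¹)) •
    ((l + l⁻¹) • bu N b 0 (-1) + bu N b 1 (-1) + bu N b (-1) (-1))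

/-- `K̃_λ^{±1}` is `opKT N b (±1)`. -/
def opKT (N : ℕ) (b : ℂ) (s : ℤ) : Module.End ℂ (Fun1 N) := but N b (-s) 0

/-- `F̃_λ`. -/
def opFT (N : ℕ) (b : ℂ) : Module.End ℂ (Fun1 N) :=
  (-(Complex.I * (sqt N b)⁻¹) / (bqt N b - (bqt N b)⁻¹)) • but N b 0 1

/-- `Ẽ_λ`, with the complex conjugate of `λ` as parameter. -/
def opET (N : ℕ) (b l : ℂ) : Module.End ℂ (Fun1 N) :=
  (-(Complex.I * sqt N b) / (bqt N b - (bqt N b)⁻¹)) •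
    ((starRingEnd ℂ l + (starRingEnd ℂ l)⁻¹) • but N b 0 (-1) + but N b 1 (-1)
      + but N b (-1) (-1))

/-- The value `λ + λ⁻¹` of the Casimir `Q_λ` on `ℋ`. -/
def casimirValue (l : ℂ) : ℂ := l + l⁻¹

/-- `A ⊗ 1`. -/
def onFst {N : ℕ} (A : Module.End ℂ (Fun1 N)) : Module.End ℂ (Fun2 N) where
  toFun f x := A (fun z => f (z, x.2)) x.1
  map_add' f g := by
    funext x
    exact congrFun (A.map_add (fun z => f (z, x.2)) (fun z => g (z, x.2))) x.1
  map_smul' c f := by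
    funext x
    exact congrFun (A.map_smul c (fun z => f (z, x.2))) x.1

/-- `1 ⊗ A`. -/
def onSnd {N : ℕ} (A : Module.End ℂ (Fun1 N)) : Module.End ℂ (Fun2 N) where
  toFun f x := A (fun z => f (x.1, z)) x.2
  map_add' f g := by
    funext x
    exact congrFun (A.map_add (fun z => f (x.1, z)) (fun z => g (x.1, z))) x.2
  map_smul' c f := by
    funext x
    exact congrFun (A.map_smul c (fun z => f (x.1, z))) x.2

/-- `(ΔK^{±1})₂₁ = K₂^{±1} ⊗ K₁^{±1}`. -/
def deltaK (N : ℕ) (b : ℂ) (s : ℤ) : Module.End ℂ (Fun2 N) :=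
  onFst (opK N b s) * onSnd (opK N b s)

/-- `(ΔE)₂₁ = E₂ ⊗ K₁ + 1 ⊗ E₁`. -/
def deltaE (N : ℕ) (b l₁ l₂ : ℂ) : Module.End ℂ (Fun2 N) :=
  onFst (opE N b l₂) * onSnd (opK N b 1) + onSnd (opE N b l₁)

/-- `(ΔF)₂₁ = F₂ ⊗ 1 + K₂⁻¹ ⊗ F₁`. -/
def deltaF (N : ℕ) (b : ℂ) : Module.End ℂ (Fun2 N) :=
  onFst (opF N b) + onFst (opK N b (-1)) * onSnd (opF N b)

/-- The Casimir `Q = -(𝐪 - 𝐪⁻¹)² E F - 𝐪⁻¹ K - 𝐪 K⁻¹` in the tensor product representation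
`(π_{λ₂} ⊗ π_{λ₁}) ∘ Δ`. -/
def Q21 (N : ℕ) (b l₁ l₂ : ℂ) : Module.End ℂ (Fun2 N) :=
  -((bq N b - (bq N b)⁻¹) ^ 2 • (deltaE N b l₁ l₂ * deltaF N b))
    - (bq N b)⁻¹ • deltaK N b 1 - bq N b • deltaK N b (-1)

/-- `(ΔK̃^{±1})₂₁`. -/
def deltaKT (N : ℕ) (b : ℂ) (s : ℤ) : Module.End ℂ (Fun2 N) :=
  onFst (opKT N b s) * onSnd (opKT N b s)

/-- `(ΔẼ)₂₁`. -/
def deltaET (N : ℕ) (b l₁ l₂ : ℂ) : Module.End ℂ (Fun2 N) :=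
  onFst (opET N b l₂) * onSnd (opKT N b 1) + onSnd (opET N b l₁)

/-- `(ΔF̃)₂₁`. -/
def deltaFT (N : ℕ) (b : ℂ) : Module.End ℂ (Fun2 N) :=
  onFst (opFT N b) + onFst (opKT N b (-1)) * onSnd (opFT N b)

/-- The tilded Casimir `Q̃₂₁`, the formal adjoint of `Q₂₁`. -/
def Q21T (N : ℕ) (b l₁ l₂ : ℂ) : Module.End ℂ (Fun2 N) :=
  -((bqt N b - (bqt N b)⁻¹) ^ 2 • (deltaET N b l₁ l₂ * deltaFT N b))
    - (bqt N b)⁻¹ • deltaKT N b 1 - bqt N b • deltaKT N b (-1)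

/-- `Q'₁ = e^{𝐘₁-𝐔₁} + e^{-𝐘₁+𝐔₁} + e^{-𝐘₁} Q₁ + e^{-𝐔₁} Q₂ + e^{-𝐔₁-𝐘₁}` as an operator on functions
of one pair `(μ₁, m₁)`; on functions of two pairs it acts as `onSnd (Q1' N b l₁ l₂)`. -/
def Q1' (N : ℕ) (b l₁ l₂ : ℂ) : Module.End ℂ (Fun1 N) :=
  bu N b (-1) 1 + bu N b 1 (-1) + casimirValue l₁ • bu N b 0 (-1)
    + casimirValue l₂ • bu N b (-1) 0 + bu N b (-1) (-1)

/-- The tilded partner `Q̃'₁`, the formal adjoint of `Q'₁`. -/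
def Q1'T (N : ℕ) (b l₁ l₂ : ℂ) : Module.End ℂ (Fun1 N) :=
  but N b (-1) 1 + but N b 1 (-1) + casimirValue (starRingEnd ℂ l₁) • but N b 0 (-1)
    + casimirValue (starRingEnd ℂ l₂) • but N b (-1) 0 + but N b (-1) (-1)

/-! ### The space `𝒲₂` consists of square integrable functions and is invariant -/

theorem memLp_poly_gauss (α β : ℂ) (hα : 0 < α.re) (P : Polynomial ℂ) :
    MemLp (fun x : ℝ => Complex.exp (-α * (x : ℂ) ^ 2 + β * x) * P.eval (x : ℂ)) 2 := by
  have hc : Continuous fun x : ℝ =>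
      Complex.exp (-α * (x : ℂ) ^ 2 + β * x) * P.eval (x : ℂ) := by
    have := P.continuous
    fun_prop
  induction P using Polynomial.induction_on' with
  | add p q hp hq =>
    have h := (hp (by have := p.continuous; fun_prop)).add
      (hq (by have := q.continuous; fun_prop))
    refine h.ae_eq (Filter.Eventually.of_forall fun x => ?_)
    simp [mul_add]
  | monomial n a =>
    rw [memLp_two_iff_integrable_sq_norm hc.aestronglyMeasurable]
    have hint : Integrable fun x : ℝ =>
        (Real.exp (2 * β.re ^ 2 / α.re) * ‖a‖ ^ 2) *
          (x ^ ((2 * n : ℕ) : ℝ) * Real.exp (-α.re * x ^ 2)) :=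
      (integrable_rpow_mul_exp_neg_mul_sq hα (by
        have : (0 : ℝ) ≤ ((2 * n : ℕ) : ℝ) := Nat.cast_nonneg _
        linarith)).const_mul _
    refine hint.mono' (hc.norm.pow 2).aestronglyMeasurable
      (Filter.Eventually.of_forall fun x => ?_)
    have hre : (-α * (x : ℂ) ^ 2 + β * x).re = -α.re * x ^ 2 + β.re * x := by
      have : (x : ℂ) ^ 2 = ((x ^ 2 : ℝ) : ℂ) := by push_cast; rfl
      rw [this, Complex.add_re, Complex.re_mul_ofReal, Complex.re_mul_ofReal, Complex.neg_re]
    rw [Real.norm_of_nonneg (by positivity), norm_mul, Complex.norm_exp, hre,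
      Polynomial.eval_monomial, norm_mul, norm_pow, Complex.norm_real, Real.rpow_natCast]
    have h1 : Real.exp (-α.re * x ^ 2 + β.re * x) ^ 2
        ≤ Real.exp (2 * β.re ^ 2 / α.re) * Real.exp (-α.re * x ^ 2) := by
      rw [← Real.exp_nat_mul, ← Real.exp_add]
      refine Real.exp_le_exp.mpr ?_
      have h2 : 0 ≤ (α.re * x - β.re) ^ 2 / α.re + β.re ^ 2 / α.re := by positivity
      have h3 : (α.re * x - β.re) ^ 2 / α.re + β.re ^ 2 / α.re
          = α.re * x ^ 2 - 2 * β.re * x + 2 * β.re ^ 2 / α.re := by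
        field_simp
        ring
      rw [h3] at h2
      push_cast
      linarith
    have h4 : ‖x‖ ^ (2 * n) = x ^ (2 * n) := by
      rw [pow_mul, pow_mul, Real.norm_eq_abs, sq_abs]
    calc (Real.exp (-α.re * x ^ 2 + β.re * x) * (‖a‖ * ‖x‖ ^ n)) ^ 2
        = Real.exp (-α.re * x ^ 2 + β.re * x) ^ 2 * (‖a‖ ^ 2 * ‖x‖ ^ (2 * n)) := by ring
      _ ≤ (Real.exp (2 * β.re ^ 2 / α.re) * Real.exp (-α.re * x ^ 2))
            * (‖a‖ ^ 2 * ‖x‖ ^ (2 * n)) := by gcongr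
      _ = _ := by rw [h4]; ring

theorem memLp_mul_prod {X Y : Type*} [MeasurableSpace X] [MeasurableSpace Y] {μ : Measure X}
    {ν : Measure Y} [SFinite μ] [SFinite ν] {f : X → ℂ} {g : Y → ℂ} (hf : MemLp f 2 μ)
    (hg : MemLp g 2 ν) : MemLp (fun x : X × Y => f x.1 * g x.2) 2 (μ.prod ν) := by
  have hm : AEStronglyMeasurable (fun x : X × Y => f x.1 * g x.2) (μ.prod ν) :=
    hf.1.comp_fst.mul hg.1.comp_snd
  rw [memLp_two_iff_integrable_sq_norm hm]
  have := ((memLp_two_iff_integrable_sq_norm hf.1).1 hf).mul_prod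
    ((memLp_two_iff_integrable_sq_norm hg.1).1 hg)
  simpa [mul_pow] using this

theorem memLp_of_mem_W1 {N : ℕ} [NeZero N] {f : Fun1 N} (hf : f ∈ W1 N) :
    MemLp (fun x : ℝ × ZMod N => f ((x.1 : ℂ), x.2)) 2 (measure1 N) := by
  induction hf using Submodule.span_induction with
  | mem f h =>
    obtain ⟨α, β, P, c, hα, rfl⟩ := h
    exact memLp_mul_prod (memLp_poly_gauss α β hα P) (MemLp.of_discrete (f := c))
  | zero => exact MemLp.zero'
  | add f g _ _ hf hg => exact hf.add hg
  | smul a f _ hf => exact hf.const_smul a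

theorem memLp_of_mem_W2 {N : ℕ} [NeZero N] {f : Fun2 N} (hf : f ∈ W2 N) :
    MemLp (restrict f) 2 (measure2 N) := by
  induction hf using Submodule.span_induction with
  | mem f h =>
    obtain ⟨g, hg, k, hk, rfl⟩ := h
    exact memLp_mul_prod (memLp_of_mem_W1 hg) (memLp_of_mem_W1 hk)
  | zero => exact MemLp.zero'
  | add f g _ _ hf hg => exact hf.add hg
  | smul a f _ hf => exact hf.const_smul a

theorem shift_mem_W1 {N : ℕ} (s k c₀ : ℂ) (r : ZMod N) (d : ZMod N → ℂ) (A : Module.End ℂ (Fun1 N))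
    (hA : ∀ f x, A f x = c₀ * Complex.exp (k * x.1) * d x.2 * f (x.1 + s, x.2 + r))
    {f : Fun1 N} (hf : f ∈ W1 N) : A f ∈ W1 N := by
  induction hf using Submodule.span_induction with
  | mem f h =>
    obtain ⟨α, β, P, c, hα, rfl⟩ := h
    refine Submodule.subset_span ⟨α, β - 2 * α * s + k,
      Polynomial.C (c₀ * Complex.exp (-α * s ^ 2 + β * s)) * P.comp (Polynomial.X + Polynomial.C s),
      fun m => d m * c (m + r), hα, ?_⟩
    funext x
    rw [hA]
    have h : Complex.exp (k * x.1) * Complex.exp (-α * (x.1 + s) ^ 2 + β * (x.1 + s))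
        = Complex.exp (-α * x.1 ^ 2 + (β - 2 * α * s + k) * x.1)
          * Complex.exp (-α * s ^ 2 + β * s) := by
      rw [← Complex.exp_add, ← Complex.exp_add]
      congr 1
      ring
    simp only [Polynomial.eval_mul, Polynomial.eval_C, Polynomial.eval_comp, Polynomial.eval_add,
      Polynomial.eval_X]
    linear_combination (c₀ * d x.2 * P.eval (x.1 + s) * c (x.2 + r)) * h
  | zero => simp
  | add f g _ _ hf hg => rw [map_add]; exact add_mem hf hg
  | smul a f _ hf => rw [map_smul]; exact Submodule.smul_mem _ _ hf

theorem bu_mem_W1 {N : ℕ} (b : ℂ) (α β : ℤ) {f : Fun1 N} (hf : f ∈ W1 N) :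
    bu N b α β f ∈ W1 N := by
  refine shift_mem_W1 (α * (Complex.I * b))
    (β * (2 * Real.pi * Complex.I / N * (-Complex.I * b)))
    (bq N b ^ (-(α * β)) * Complex.exp (β * (2 * Real.pi * Complex.I / N *
      (-Complex.I * b * (α * (Complex.I * b)))))) (-α)
    (fun m => Complex.exp (β * (2 * Real.pi * Complex.I / N * (-((m - α).val : ℂ))))) _ ?_ hf
  intro f x
  simp only [bu, uPow, yPow, yv, LinearMap.smul_apply, Module.End.mul_apply, LinearMap.coe_mk,
    AddHom.coe_mk, Pi.smul_apply, smul_eq_mul, ← Complex.exp_int_mul]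
  rw [Int.cast_neg, ← sub_eq_add_neg]
  have h : Complex.exp (β * (2 * Real.pi * Complex.I / N *
      (-Complex.I * b * (x.1 + α * (Complex.I * b)) - ((x.2 - α).val : ℂ))))
      = Complex.exp (β * (2 * Real.pi * Complex.I / N *
      (-Complex.I * b * (α * (Complex.I * b))))) *
      Complex.exp (β * (2 * Real.pi * Complex.I / N * (-Complex.I * b)) * x.1) *
      Complex.exp (β * (2 * Real.pi * Complex.I / N * (-((x.2 - α).val : ℂ)))) := by
    rw [← Complex.exp_add, ← Complex.exp_add]
    congr 1
    ring
  rw [h]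
  ring

theorem but_mem_W1 {N : ℕ} (b : ℂ) (α β : ℤ) {f : Fun1 N} (hf : f ∈ W1 N) :
    but N b α β f ∈ W1 N := by
  refine shift_mem_W1 (α * (Complex.I * b⁻¹))
    (β * (2 * Real.pi * Complex.I / N * (-Complex.I * b⁻¹)))
    (bqt N b ^ (-(α * β)) * Complex.exp (β * (2 * Real.pi * Complex.I / N *
      (-Complex.I * b⁻¹ * (α * (Complex.I * b⁻¹)))))) α
    (fun m => Complex.exp (β * (2 * Real.pi * Complex.I / N * ((m + α).val : ℂ)))) _ ?_ hf
  intro f x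
  simp only [but, uPowT, yPowT, yvt, LinearMap.smul_apply, Module.End.mul_apply, LinearMap.coe_mk,
    AddHom.coe_mk, Pi.smul_apply, smul_eq_mul, ← Complex.exp_int_mul]
  have h : Complex.exp (β * (2 * Real.pi * Complex.I / N *
      (-Complex.I * b⁻¹ * (x.1 + α * (Complex.I * b⁻¹)) + ((x.2 + α).val : ℂ))))
      = Complex.exp (β * (2 * Real.pi * Complex.I / N *
      (-Complex.I * b⁻¹ * (α * (Complex.I * b⁻¹))))) *
      Complex.exp (β * (2 * Real.pi * Complex.I / N * (-Complex.I * b⁻¹)) * x.1) *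
      Complex.exp (β * (2 * Real.pi * Complex.I / N * ((x.2 + α).val : ℂ))) := by
    rw [← Complex.exp_add, ← Complex.exp_add]
    congr 1
    ring
  rw [h]
  ring

theorem onFst_mem_W2 {N : ℕ} (A : Module.End ℂ (Fun1 N)) (hA : ∀ f ∈ W1 N, A f ∈ W1 N)
    {f : Fun2 N} (hf : f ∈ W2 N) : onFst A f ∈ W2 N := by
  induction hf using Submodule.span_induction with
  | mem f h =>
    obtain ⟨g, hg, k, hk, rfl⟩ := h
    refine Submodule.subset_span ⟨A g, hA g hg, k, hk, ?_⟩
    funext x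
    have h : (fun z => g z * k x.2) = k x.2 • g := by funext z; simp [mul_comm]
    change A (fun z => g z * k x.2) x.1 = _
    rw [h, map_smul]
    simp [mul_comm]
  | zero => simp
  | add f g _ _ hf hg => rw [map_add]; exact add_mem hf hg
  | smul a f _ hf => rw [map_smul]; exact Submodule.smul_mem _ _ hf

theorem onSnd_mem_W2 {N : ℕ} (A : Module.End ℂ (Fun1 N)) (hA : ∀ f ∈ W1 N, A f ∈ W1 N)
    {f : Fun2 N} (hf : f ∈ W2 N) : onSnd A f ∈ W2 N := by
  induction hf using Submodule.span_induction with
  | mem f h =>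
    obtain ⟨g, hg, k, hk, rfl⟩ := h
    refine Submodule.subset_span ⟨g, hg, A k, hA k hk, ?_⟩
    funext x
    have h : (fun z => g x.1 * k z) = g x.1 • k := by funext z; simp
    change A (fun z => g x.1 * k z) x.2 = _
    rw [h, map_smul]
    simp
  | zero => simp
  | add f g _ _ hf hg => rw [map_add]; exact add_mem hf hg
  | smul a f _ hf => rw [map_smul]; exact Submodule.smul_mem _ _ hf

/-! ### Closed operators on `ℋ ⊗ ℋ` -/

/-- `G = B F`, where `B` is the adjoint of the operator `A` with domain `𝒲₂`: `F` lies in the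
domain of `B` iff the functional `w ↦ ⟨A w | F⟩` on `𝒲₂` is continuous. -/
def AdjointActs {N : ℕ} (A : Module.End ℂ (Fun2 N)) (F G : H2 N) : Prop :=
  ∀ w ∈ W2 N, inner ℂ (toH2 (A w)) F = inner ℂ (toH2 w) G

/-- `(F, G)` lies in the closure of the graph of the operator `A` with domain `𝒲₂`. -/
def ClosureActs {N : ℕ} (A : Module.End ℂ (Fun2 N)) (F G : H2 N) : Prop :=
  (F, G) ∈ closure {p : H2 N × H2 N | ∃ w ∈ W2 N, p = (toH2 w, toH2 (A w))}

/-- `G = e^{α𝐔₁ + β𝐘₁} F` for the closed (normal) operator `e^{α𝐔₁ + β𝐘₁}`, the adjoint of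
`e^{α𝐔̃₁ + β𝐘̃₁}`. -/
def ExpActs (N : ℕ) (b : ℂ) (α β : ℤ) (F G : H2 N) : Prop :=
  AdjointActs (onSnd (but N b α β)) F G

/-- `F` lies in the domain of the operator `Q'₁` on `ℋ ⊗ ℋ`, and `G = Q'₁ F`.  The domain of
the sum is the intersection of the domains of its five closed terms. -/
def Q1'Acts (N : ℕ) (b l₁ l₂ : ℂ) (F G : H2 N) : Prop :=
  ∃ G₁ G₂ G₃ G₄ G₅ : H2 N,
    ExpActs N b (-1) 1 F G₁ ∧ ExpActs N b 1 (-1) F G₂ ∧ ExpActs N b 0 (-1) F G₃ ∧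
    ExpActs N b (-1) 0 F G₄ ∧ ExpActs N b (-1) (-1) F G₅ ∧
    G = G₁ + G₂ + casimirValue l₁ • G₃ + casimirValue l₂ • G₄ + G₅

/-! ### The unitary operators -/

/-- The quantum dilogarithm `φ(y, ỹ) = [∏ (1 + 𝐪^{2j+1} y) / ∏ (1 + 𝐪̃^{-2j-1} ỹ)]⁻¹`. -/
def qdilog (N : ℕ) (b y yt : ℂ) : ℂ :=
  ((∏' j : ℕ, (1 + bq N b ^ (2 * j + 1) * y)) /
    (∏' j : ℕ, (1 + (bqt N b)⁻¹ ^ (2 * j + 1) * yt)))⁻¹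

/-- `𝒮₂ f(μ₂, m₂ | μ₁, m₁) = f(μ₂, m₂ | μ₁ - μ₂, m₁ - m₂)`. -/
def IsShift2 {N : ℕ} (S : H2 N ≃ₗᵢ[ℂ] H2 N) : Prop :=
  ∀ f : H2 N, S f =ᵐ[measure2 N] fun x => f (x.1, (x.2.1 - x.1.1, x.2.2 - x.1.2))

/-- `𝒱₂` is the unitary operator which on the dense space `𝒲₂` is given by
`N⁻² ∑_{n,m} ∫dν ∫dμ e^{(2πi/N)(μ₂ν - m₂n)} (-1)^{n²} e^{(πi/N)(ν² - n²)} e^{-(2πi/N)(μν - mn)}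
  f(μ, m | μ₁, m₁)`. -/
def IsWeil2 {N : ℕ} [NeZero N] (V : H2 N ≃ₗᵢ[ℂ] H2 N) : Prop :=
  ∀ w ∈ W2 N, V (toH2 w) =ᵐ[measure2 N] fun x =>
    1 / (N : ℂ) ^ 2 * ∑ n : ZMod N, ∑ m : ZMod N, ∫ ν : ℝ, ∫ μ : ℝ,
      Complex.exp (2 * Real.pi * Complex.I / N * (x.1.1 * ν - x.1.2.val * n.val))
        * (-1) ^ (n.val ^ 2)
        * Complex.exp (Real.pi * Complex.I / N * (ν ^ 2 - n.val ^ 2))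
        * Complex.exp (-(2 * Real.pi * Complex.I / N) * (μ * ν - m.val * n.val))
        * restrict w ((μ, m), x.2)

/-- Multiplication by `φ(-y₁ y₂⁻¹, -ỹ₁ ỹ₂⁻¹)`. -/
def IsDilogMul {N : ℕ} (b : ℂ) (D : H2 N ≃ₗᵢ[ℂ] H2 N) : Prop :=
  ∀ f : H2 N, D f =ᵐ[measure2 N] fun x =>
    qdilog N b (-(yv b ((x.2.1 : ℂ), x.2.2) * (yv b ((x.1.1 : ℂ), x.1.2))⁻¹))
      (-(yvt b ((x.2.1 : ℂ), x.2.2) * (yvt b ((x.1.1 : ℂ), x.1.2))⁻¹)) * f x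

/-- `t₂₁ = 𝒱₂ φ(-e^{𝐘₁-𝐘₂}, -e^{𝐘̃₁-𝐘̃₂}) 𝒱₂⁻¹ = φ(e^{𝐘₁-𝐘₂+𝐔₂}, e^{𝐘̃₁-𝐘̃₂+𝐔̃₂})`. -/
def IsT21 {N : ℕ} [NeZero N] (b : ℂ) (t : H2 N ≃ₗᵢ[ℂ] H2 N) : Prop :=
  ∃ V D : H2 N ≃ₗᵢ[ℂ] H2 N, IsWeil2 V ∧ IsDilogMul b D ∧ ∀ f, t f = V (D (V.symm f))

end QTorus

end

noncomputable section

namespace QTorus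

/-! ### Integrals of holomorphic functions along horizontal lines -/

/-! Put $U=t_{21}\mathcal S_2$. Everything about the Casimirs follows from one weak identity,
`inner_weyl2_conj`: for rapidly decreasing entire $h,w$ and each of the five terms $e^{a\mathbf
U_1+k\mathbf Y_1}$ of $Q_1'$, the pairing of $e^{a\tilde{\mathbf U}_1+k\tilde{\mathbf Y}_1}h$ with
$U^{-1}w$ equals the pairing of $h$ with $U^{-1}Tw$, where $T$ (`termOp`) is an explicit polynomial
in Weyl operators. Read term by term it says that $U^{-1}w$ lies in the domain of $Q_1'$. By
`casimirGen_eq_termOp` and `casimir_expansion` the five $T$, with their coefficients, add up to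
$Q_{21}$. Both sides are continuous in $(w,Tw)$, so the summed identity passes to closures of
graphs. The second inclusion is the same identity for the dual half of the modular double, read
backwards by complex conjugation.

Why the identity holds. The operators $\mathcal S_2$ and $\mathcal V_2$ are metaplectic: they act on
Weyl operators by linear symplectic substitutions, up to signs (`shear_weyl2`, `weilOp_weyl2`; the
latter is a rotation, a shear by a Gaussian chirp, and the inverse rotation). What remains is
multiplication by $\varphi^{-1}$, a function $\Phi$ of $x_1-x_2$ (`dilogInv`). In a pairing
$\int\Phi(x_1-x_2)\,\overline{(\cdot)}\,(\cdot)$ of entire functions, moving a Weyl operator to the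
other side leaves a complex translation of the whole integrand except $\Phi$ (`starFun_weyl2_mul`).
Cauchy's theorem moves the translation onto $\Phi$, whose argument is lowered $j=-a-k$ times by
$i\beta$ (`dilogPair_weyl2`). Each lowering costs one factor $1-\mathbf q^{-1}y$ by the difference
equation `dilogInv_shift`. For the five terms $j=0,0,1,1,2$ is never negative, so $T$ is a
polynomial and the argument of $\Phi$ stays in $\mathrm{Im}\le 0$.

The contour shifts need two facts about $\Phi$. It is holomorphic for
$\mathrm{Im}\,z<\mathrm{Re}\,b$, since there every zero of the denominator is a zero of the
numerator and all zeros are simple (`analyticAt_dilogInv`). It grows at most exponentially along the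
strips in the lower half-plane, because the two difference equations combine into one with the real
period $2\,\mathrm{Im}\,b$ (`exists_dilogInv_bound`). The test functions decrease faster than every
exponential in strips, a class which contains $\mathscr W_2$ and is preserved by shears, Weyl
operators, Fourier transform and chirp.

The unitaries exist because $|b|=1$ makes conjugation exchange numerator and denominator of $\Phi$
on the real line, because $\mathcal V_2$ is isometric on rapidly decreasing functions (Plancherel),
and because $\mathscr W_2$ is dense (`eq_zero_of_inner_W2_eq_zero`). -/

theorem integrable_exp_neg_mul_abs {a : ℝ} (ha : 0 < a) :
    Integrable fun x : ℝ => Real.exp (-(a * |x|)) := by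
  have h1 : IntegrableOn (fun x : ℝ => Real.exp (-(a * |x|))) (Set.Iic 0) := by
    refine (integrableOn_exp_mul_Iic ha 0).congr_fun (fun x hx => ?_) measurableSet_Iic
    simp only [abs_of_nonpos (Set.mem_Iic.1 hx)]
    ring_nf
  have h2 : IntegrableOn (fun x : ℝ => Real.exp (-(a * |x|))) (Set.Ioi 0) := by
    refine (exp_neg_integrableOn_Ioi 0 ha).congr_fun (fun x hx => ?_) measurableSet_Ioi
    simp only [abs_of_pos (Set.mem_Ioi.1 hx)]
    ring_nf
  have := h1.union h2
  rwa [Set.Iic_union_Ioi, integrableOn_univ] at this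

theorem integrable_exp_neg_abs : Integrable fun x : ℝ => Real.exp (-|x|) := by
  simpa using integrable_exp_neg_mul_abs one_pos

/-- The integral of a rapidly decreasing holomorphic function over a horizontal line does not
change when the line is moved. -/
theorem integral_eq_integral_add (f : ℂ → ℂ) (w : ℂ) (C : ℝ)
    (hd : DifferentiableOn ℂ f {z | z.im ∈ Set.uIcc 0 w.im})
    (hb : ∀ z : ℂ, z.im ∈ Set.uIcc 0 w.im → ‖f z‖ ≤ C * Real.exp (-|z.re|)) :
    ∫ x : ℝ, f x = ∫ x : ℝ, f (x + w) := by
  have hint : ∀ y ∈ Set.uIcc 0 w.im, Integrable fun x : ℝ => f (x + y * Complex.I) := by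
    intro y hy
    have hc : Continuous fun x : ℝ => f (x + y * Complex.I) :=
      hd.continuousOn.comp_continuous (by fun_prop) (fun x => by simpa using hy)
    refine (integrable_exp_neg_abs.const_mul C).mono' hc.aestronglyMeasurable
      (Filter.Eventually.of_forall fun x => ?_)
    simpa using hb (x + y * Complex.I) (by simpa using hy)
  have h0 : Integrable fun x : ℝ => f x := by simpa using hint 0 (by simp)
  have h1 := hint w.im (by simp)
  have hrect : ∀ T : ℝ, (∫ x : ℝ in (-T)..T, f x) - (∫ x : ℝ in (-T)..T, f (x + w.im * Complex.I))
      + Complex.I • (∫ y : ℝ in (0 : ℝ)..w.im, f (T + y * Complex.I))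
      - Complex.I • (∫ y : ℝ in (0 : ℝ)..w.im, f ((-T : ℝ) + y * Complex.I)) = 0 := by
    intro T
    have := Complex.integral_boundary_rect_eq_zero_of_differentiableOn f (-T : ℝ)
      (T + w.im * Complex.I) (hd.mono fun z hz => by
        have := (Complex.mem_reProdIm.1 hz).2
        simpa using this)
    simpa using this
  have hside : ∀ s : ℝ → ℝ, (∀ T, |s T| = |T|) → Filter.Tendsto
      (fun T : ℝ => Complex.I • ∫ y : ℝ in (0 : ℝ)..w.im, f ((s T : ℝ) + y * Complex.I))
      Filter.atTop (nhds 0) := by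
    intro s hs
    have hle : ∀ T : ℝ, ‖Complex.I • ∫ y : ℝ in (0 : ℝ)..w.im, f ((s T : ℝ) + y * Complex.I)‖
        ≤ C * Real.exp (-|T|) * |w.im - 0| := by
      intro T
      rw [norm_smul, Complex.norm_I, one_mul]
      refine intervalIntegral.norm_integral_le_of_norm_le_const fun y hy => ?_
      have := hb ((s T : ℝ) + y * Complex.I) (by simpa using Set.uIoc_subset_uIcc hy)
      simpa [hs T] using this
    refine squeeze_zero_norm hle ?_
    have h : Filter.Tendsto (fun T : ℝ => Real.exp (-|T|)) Filter.atTop (nhds 0) :=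
      Real.tendsto_exp_neg_atTop_nhds_zero.comp Filter.tendsto_abs_atTop_atTop
    simpa using (h.const_mul C).mul_const |w.im - 0|
  have hl0 := intervalIntegral_tendsto_integral h0 Filter.tendsto_neg_atTop_atBot Filter.tendsto_id
  have hl1 := intervalIntegral_tendsto_integral h1 Filter.tendsto_neg_atTop_atBot Filter.tendsto_id
  have hlim := ((hl0.sub hl1).add (hside id fun _ => rfl)).sub (hside (fun T => -T) abs_neg)
  have hz : (∫ x : ℝ, f x) - (∫ x : ℝ, f (x + w.im * Complex.I)) + 0 - 0 = 0 :=
    tendsto_nhds_unique hlim (tendsto_const_nhds.congr fun T => (by simpa using (hrect T).symm))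
  -- The rectangle argument handles only the imaginary part of `w`; the real part is a translation
  -- of the integration variable.
  have htr : ∫ x : ℝ, f (x + w) = ∫ x : ℝ, f (x + w.im * Complex.I) := by
    rw [← integral_add_right_eq_self (fun x : ℝ => f (x + w.im * Complex.I)) w.re]
    congr 1
    funext x
    congr 1
    conv_lhs => rw [← Complex.re_add_im w]
    push_cast
    ring
  rw [htr]
  linear_combination hz

/-- Cauchy's estimate for the derivative of a function on a normed space. -/
theorem norm_fderiv_le_of_forall_mem_ball {E : Type*} [NormedAddCommGroup E] [NormedSpace ℂ E]
    {f : E → ℂ} (hf : Differentiable ℂ f) {p : E} {C : ℝ}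
    (hC : ∀ z ∈ Metric.closedBall p 1, ‖f z‖ ≤ C) : ‖fderiv ℂ f p‖ ≤ C := by
  have hC0 : 0 ≤ C := (norm_nonneg _).trans (hC p (Metric.mem_closedBall_self zero_le_one))
  refine ContinuousLinearMap.opNorm_le_bound _ hC0 fun v => ?_
  rcases eq_or_ne v 0 with rfl | hv
  · simp
  have hv' : 0 < ‖v‖ := norm_pos_iff.2 hv
  have hline : ∀ t : ℂ, HasDerivAt (fun t : ℂ => p + t • v) v t := fun t => by
    simpa using ((hasDerivAt_id t).smul_const v).const_add p
  have hd : ∀ t : ℂ, HasDerivAt (fun t : ℂ => f (p + t • v)) (fderiv ℂ f (p + t • v) v) t :=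
    fun t => (hf _).hasFDerivAt.comp_hasDerivAt t (hline t)
  -- With radius `‖v‖⁻¹` the circle `p + t • v` lies on the unit sphere about `p`, and Cauchy's
  -- bound becomes `C * ‖v‖`.
  have h := Complex.norm_deriv_le_of_forall_mem_sphere_norm_le (c := 0) (R := ‖v‖⁻¹) (C := C)
    (f := fun t : ℂ => f (p + t • v)) (inv_pos.2 hv')
    (Differentiable.diffContOnCl fun t => (hd t).differentiableAt) fun t ht => hC _ (by
      rw [mem_sphere_zero_iff_norm] at ht
      simp [norm_smul, ht, hv'.ne'])
  rw [(hd 0).deriv, zero_smul, add_zero, div_inv_eq_mul] at h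
  exact h

/-- Holomorphic dependence of an integral on parameters. -/
theorem differentiable_integral_of_dominated {E : Type*} [NormedAddCommGroup E] [NormedSpace ℂ E]
    [FiniteDimensional ℂ E] (F : E → ℝ → ℂ) (hc : Continuous F.uncurry)
    (hd : ∀ t, Differentiable ℂ fun z => F z t)
    (hb : ∀ z₀ : E, ∃ g : ℝ → ℝ, Integrable g ∧ ∀ z ∈ Metric.ball z₀ 2, ∀ t, ‖F z t‖ ≤ g t) :
    Differentiable ℂ fun z => ∫ t, F z t := by
  intro z₀
  borelize E
  have := FiniteDimensional.proper ℂ E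
  obtain ⟨g, hg, hle⟩ := hb z₀
  have hcz : ∀ z, Continuous (F z) := fun z => hc.comp (Continuous.prodMk_right z)
  refine (hasFDerivAt_integral_of_dominated_of_fderiv_le (bound := g)
    (F' := fun z t => fderiv ℂ (fun z => F z t) z) (Metric.ball_mem_nhds z₀ one_pos)
    (Filter.Eventually.of_forall fun z => (hcz z).aestronglyMeasurable)
    (hg.mono' (hcz z₀).aestronglyMeasurable (Filter.Eventually.of_forall fun t =>
      hle z₀ (Metric.mem_ball_self two_pos) t)) ?_
    (Filter.Eventually.of_forall fun t z hz => ?_) hg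
    (Filter.Eventually.of_forall fun t z _ => (hd t z).hasFDerivAt)).differentiableAt
  · have : Continuous (Function.uncurry fun (t : ℝ) (z : E) => F z t) :=
      hc.comp continuous_swap
    exact ((measurable_fderiv_with_param ℂ this).comp
      (measurable_id.prodMk measurable_const)).aestronglyMeasurable
  -- The radius 2 in `hb` is used here: a point within 1 of `z₀` plus the unit ball of Cauchy's
  -- estimate.
  · refine norm_fderiv_le_of_forall_mem_ball (hd t) fun ζ hζ => hle ζ ?_ t
    rw [Metric.mem_ball] at hz ⊢
    rw [Metric.mem_closedBall] at hζ
    linarith [dist_triangle ζ z z₀]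

/-! ### Weyl operators for both halves of the modular double

The operators `e^{α𝐔 + β𝐘}` and their tilded partners are the members of one family, with
parameters `(β, ε) = (b, 1)` and `(β, ε) = (b⁻¹, -1)`. -/

/-- `exp[(2πi/N)(-i β μ - ε m)]`. -/
def yGen {N : ℕ} [NeZero N] (β : ℂ) (ε : ℤ) (x : ℂ × ZMod N) : ℂ :=
  Complex.exp (2 * Real.pi / N * β * x.1) * ZMod.stdAddChar (-((ε : ZMod N) * x.2))

theorem onFst_add {N : ℕ} (A B : Module.End ℂ (Fun1 N)) : onFst (A + B) = onFst A + onFst B := rfl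

theorem onSnd_add {N : ℕ} (A B : Module.End ℂ (Fun1 N)) : onSnd (A + B) = onSnd A + onSnd B := rfl

theorem onFst_smul {N : ℕ} (c : ℂ) (A : Module.End ℂ (Fun1 N)) : onFst (c • A) = c • onFst A := rfl

theorem onSnd_smul {N : ℕ} (c : ℂ) (A : Module.End ℂ (Fun1 N)) : onSnd (c • A) = c • onSnd A := rfl

section Weyl

variable {N : ℕ} [NeZero N]

theorem stdAddChar_eq_exp_val (m : ZMod N) :
    ZMod.stdAddChar m = Complex.exp (2 * Real.pi * Complex.I * m.val / N) := by
  have h := ZMod.stdAddChar_coe (N := N) (m.val : ℤ)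
  simpa using h

theorem stdAddChar_intCast_eq_exp (k : ℤ) :
    ZMod.stdAddChar (k : ZMod N) = Complex.exp (2 * Real.pi * Complex.I * k / N) :=
  ZMod.stdAddChar_coe k

theorem norm_stdAddChar (m : ZMod N) : ‖(ZMod.stdAddChar m : ℂ)‖ = 1 := by
  rw [ZMod.stdAddChar_apply]; exact Circle.norm_coe _

theorem conj_stdAddChar (m : ZMod N) :
    starRingEnd ℂ (ZMod.stdAddChar m) = ZMod.stdAddChar (-m) := by
  rw [AddChar.map_neg_eq_inv, Complex.inv_def, Complex.normSq_eq_norm_sq, norm_stdAddChar]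
  simp

theorem yv_eq (b : ℂ) (x : ℂ × ZMod N) : yv b x = yGen b 1 x := by
  rw [yv, yGen, Int.cast_one, one_mul, AddChar.map_neg_eq_inv, stdAddChar_eq_exp_val,
    ← Complex.exp_neg, ← Complex.exp_add]
  congr 1
  linear_combination (-(2 * Real.pi / N * b * x.1)) * Complex.I_sq

theorem yvt_eq (b : ℂ) (x : ℂ × ZMod N) : yvt b x = yGen b⁻¹ (-1) x := by
  rw [yvt, yGen, Int.cast_neg, Int.cast_one, neg_one_mul, neg_neg, stdAddChar_eq_exp_val,
    ← Complex.exp_add]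
  congr 1
  linear_combination (-(2 * Real.pi / N * b⁻¹ * x.1)) * Complex.I_sq

theorem yGen_ne_zero (β : ℂ) (ε : ℤ) (x : ℂ × ZMod N) : yGen β ε x ≠ 0 := by
  refine mul_ne_zero (Complex.exp_ne_zero _) fun h => ?_
  have := norm_stdAddChar (-((ε : ZMod N) * x.2))
  rw [h, norm_zero] at this
  exact zero_ne_one this

theorem bq_ne_zero (N : ℕ) (β : ℂ) : bq N β ≠ 0 := Complex.exp_ne_zero _

theorem bq_zpow (N : ℕ) (β : ℂ) (k : ℤ) :
    bq N β ^ k = Complex.exp (k * (Real.pi * Complex.I / N * (1 + β ^ 2))) := by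
  rw [bq, hbar, ← Complex.exp_int_mul]

/-- The translation by $ia\beta$ contributes $e^{2\pi i a\beta^2/N}$ and the residue shift, thanks
to $\varepsilon^2=1$, contributes $e^{2\pi i a/N}$; together they are $\mathbf q^{2a}$. -/
theorem yGen_shift (β : ℂ) {ε : ℤ} (hε : ε * ε = 1) (a : ℤ) (x : ℂ × ZMod N) :
    yGen β ε (x.1 + a * (Complex.I * β), x.2 - ((ε * a : ℤ) : ZMod N))
      = bq N β ^ (2 * a) * yGen β ε x := by
  have h1 : -((ε : ZMod N) * (x.2 - ((ε * a : ℤ) : ZMod N)))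
      = (a : ZMod N) + -((ε : ZMod N) * x.2) := by
    have : (ε : ZMod N) * (ε : ZMod N) = 1 := by exact_mod_cast congrArg (Int.cast (R := ZMod N)) hε
    push_cast
    linear_combination (a : ZMod N) * this
  rw [yGen, yGen, h1, AddChar.map_add_eq_mul, stdAddChar_intCast_eq_exp, bq_zpow]
  have h : Complex.exp (2 * Real.pi / N * β * (x.1 + a * (Complex.I * β)))
      * Complex.exp (2 * Real.pi * Complex.I * a / N)
      = Complex.exp ((2 * a : ℤ) * (Real.pi * Complex.I / N * (1 + β ^ 2)))
        * Complex.exp (2 * Real.pi / N * β * x.1) := by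
    rw [← Complex.exp_add, ← Complex.exp_add]
    congr 1
    push_cast
    ring
  linear_combination ZMod.stdAddChar (-((ε : ZMod N) * x.2)) * h

end Weyl

/-- `e^{α𝐔 + k𝐘}` for the parameters `(β, ε)`, with the multiplication operator on the left. -/
def weyl (N : ℕ) [NeZero N] (β : ℂ) (ε a k : ℤ) : Module.End ℂ (Fun1 N) where
  toFun f x := bq N β ^ (a * k) * yGen β ε x ^ k *
    f (x.1 + a * (Complex.I * β), x.2 - ((ε * a : ℤ) : ZMod N))
  map_add' _ _ := by funext x; simp [mul_add]
  map_smul' _ _ := by funext x; simp [mul_left_comm]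

/-- `e^{a₂𝐔₂ + k₂𝐘₂ + a₁𝐔₁ + k₁𝐘₁}` for the parameters `(β, ε)`. -/
def weyl2 (N : ℕ) [NeZero N] (β : ℂ) (ε a₂ k₂ a₁ k₁ : ℤ) : Module.End ℂ (Fun2 N) where
  toFun f x := bq N β ^ (a₂ * k₂ + a₁ * k₁) * (yGen β ε x.1 ^ k₂ * yGen β ε x.2 ^ k₁) *
    f ((x.1.1 + a₂ * (Complex.I * β), x.1.2 - ((ε * a₂ : ℤ) : ZMod N)),
      (x.2.1 + a₁ * (Complex.I * β), x.2.2 - ((ε * a₁ : ℤ) : ZMod N)))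
  map_add' _ _ := by funext x; simp [mul_add]
  map_smul' _ _ := by funext x; simp [mul_left_comm]

section Weyl

variable {N : ℕ} [NeZero N]

theorem weyl_apply (β : ℂ) (ε a k : ℤ) (f : Fun1 N) (x : ℂ × ZMod N) :
    weyl N β ε a k f x = bq N β ^ (a * k) * yGen β ε x ^ k *
      f (x.1 + a * (Complex.I * β), x.2 - ((ε * a : ℤ) : ZMod N)) := rfl

theorem weyl2_apply (β : ℂ) (ε a₂ k₂ a₁ k₁ : ℤ) (f : Fun2 N) (x : (ℂ × ZMod N) × (ℂ × ZMod N)) :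
    weyl2 N β ε a₂ k₂ a₁ k₁ f x =
      bq N β ^ (a₂ * k₂ + a₁ * k₁) * (yGen β ε x.1 ^ k₂ * yGen β ε x.2 ^ k₁) *
      f ((x.1.1 + a₂ * (Complex.I * β), x.1.2 - ((ε * a₂ : ℤ) : ZMod N)),
        (x.2.1 + a₁ * (Complex.I * β), x.2.2 - ((ε * a₁ : ℤ) : ZMod N))) := rfl

/-- Moving $\mathbf y^k$ to the left of $\mathbf u^a$ costs $\mathbf q^{2ak}$, which turns the
prefactor $\mathbf q^{-ak}$ into $\mathbf q^{ak}$. -/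
theorem bu_eq_weyl (b : ℂ) (a k : ℤ) : bu N b a k = weyl N b 1 a k := by
  refine LinearMap.ext fun f => funext fun x => ?_
  have h := yGen_shift b (ε := 1) (by norm_num) a x
  rw [one_mul] at h
  simp only [bu, uPow, yPow, weyl_apply, LinearMap.smul_apply, Module.End.mul_apply,
    LinearMap.coe_mk, AddHom.coe_mk, Pi.smul_apply, smul_eq_mul, one_mul, yv_eq]
  rw [h, mul_zpow, ← zpow_mul, ← mul_assoc, ← mul_assoc, ← zpow_add₀ (bq_ne_zero N b)]
  congr 3
  ring

theorem but_eq_weyl (b : ℂ) (a k : ℤ) : but N b a k = weyl N b⁻¹ (-1) a k := by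
  refine LinearMap.ext fun f => funext fun x => ?_
  have h := yGen_shift b⁻¹ (ε := -1) (by norm_num) a x
  have hm : x.2 - ((-1 * a : ℤ) : ZMod N) = x.2 + a := by push_cast; ring
  rw [hm] at h
  simp only [but, uPowT, yPowT, weyl_apply, LinearMap.smul_apply, Module.End.mul_apply,
    LinearMap.coe_mk, AddHom.coe_mk, Pi.smul_apply, smul_eq_mul, yvt_eq, hm]
  rw [h, mul_zpow, ← zpow_mul, ← mul_assoc, ← mul_assoc]
  change bq N b⁻¹ ^ _ * _ * _ * _ = _
  rw [← zpow_add₀ (bq_ne_zero N b⁻¹)]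
  congr 3
  ring

theorem onFst_weyl (β : ℂ) (ε a k : ℤ) : onFst (weyl N β ε a k) = weyl2 N β ε a k 0 0 := by
  refine LinearMap.ext fun f => funext fun x => ?_
  change weyl N β ε a k (fun z => f (z, x.2)) x.1 = _
  simp [weyl_apply, weyl2_apply]

theorem onSnd_weyl (β : ℂ) (ε a k : ℤ) : onSnd (weyl N β ε a k) = weyl2 N β ε 0 0 a k := by
  refine LinearMap.ext fun f => funext fun x => ?_
  change weyl N β ε a k (fun z => f (x.1, z)) x.2 = _
  simp [weyl_apply, weyl2_apply]

/-- With the symmetric normalisation the cocycle is the symplectic form on exponents. This is why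
linear symplectic substitutions are compatible with products, and all later operator algebra reduces
to this rule. -/
theorem weyl2_mul (β : ℂ) {ε : ℤ} (hε : ε * ε = 1) (a₂ k₂ a₁ k₁ a₂' k₂' a₁' k₁' : ℤ) :
    weyl2 N β ε a₂ k₂ a₁ k₁ * weyl2 N β ε a₂' k₂' a₁' k₁' =
      bq N β ^ (a₂ * k₂' - a₂' * k₂ + (a₁ * k₁' - a₁' * k₁)) •
        weyl2 N β ε (a₂ + a₂') (k₂ + k₂') (a₁ + a₁') (k₁ + k₁') := by
  refine LinearMap.ext fun f => funext fun x => ?_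
  have hq := bq_ne_zero N β
  have hy₂ := yGen_ne_zero β ε x.1
  have hy₁ := yGen_ne_zero β ε x.2
  have e2 : ∀ (u : ℂ) (a a' : ℤ),
      u + a * (Complex.I * β) + a' * (Complex.I * β)
        = u + ((a + a' : ℤ) : ℂ) * (Complex.I * β) := fun u a a' => by push_cast; ring
  have e3 : ∀ (m : ZMod N) (a a' : ℤ),
      m - ((ε * a : ℤ) : ZMod N) - ((ε * a' : ℤ) : ZMod N)
        = m - ((ε * (a + a') : ℤ) : ZMod N) := fun u a a' => by push_cast; ring
  rw [Module.End.mul_apply, weyl2_apply, weyl2_apply, LinearMap.smul_apply, Pi.smul_apply,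
    weyl2_apply, smul_eq_mul]
  simp only [yGen_shift β hε, e2, e3]
  rw [mul_zpow, mul_zpow, zpow_add₀ hy₂, zpow_add₀ hy₁, ← zpow_mul, ← zpow_mul]
  have hexp : bq N β ^ (a₂ * k₂ + a₁ * k₁) * bq N β ^ (a₂' * k₂' + a₁' * k₁')
      * bq N β ^ (2 * a₂ * k₂') * bq N β ^ (2 * a₁ * k₁')
      = bq N β ^ (a₂ * k₂' - a₂' * k₂ + (a₁ * k₁' - a₁' * k₁))
        * bq N β ^ ((a₂ + a₂') * (k₂ + k₂') + (a₁ + a₁') * (k₁ + k₁')) := by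
    simp only [← zpow_add₀ hq]
    congr 1
    ring
  linear_combination (yGen β ε x.1 ^ k₂ * yGen β ε x.1 ^ k₂' * yGen β ε x.2 ^ k₁
    * yGen β ε x.2 ^ k₁' * f ((x.1.1 + ((a₂ + a₂' : ℤ) : ℂ) * (Complex.I * β),
      x.1.2 - ((ε * (a₂ + a₂') : ℤ) : ZMod N)), (x.2.1 + ((a₁ + a₁' : ℤ) : ℂ) * (Complex.I * β),
      x.2.2 - ((ε * (a₁ + a₁') : ℤ) : ZMod N)))) * hexp

theorem weyl2_zero (β : ℂ) (ε : ℤ) : weyl2 N β ε 0 0 0 0 = 1 := by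
  refine LinearMap.ext fun f => funext fun x => ?_
  simp [weyl2_apply]

/-! ### The Casimir in the Weyl basis -/

/-- The prefactors of $E$ and $F$ multiply with $-(\mathbf q-\mathbf q^{-1})^2$ to 1, whatever `s`
is, so one identity serves $Q_{21}$ (`s` is $q$) and $\tilde Q_{21}$ (`s` is $\tilde q^{-1}$). The
terms $\mathbf q^{-1}K_2K_1$ and $\mathbf qK_2^{-1}K_1^{-1}$ cancel against two of the products in
$EF$. -/
theorem casimir_expansion (β : ℂ) {ε : ℤ} (hε : ε * ε = 1) (s c₁ c₂ : ℂ) (hs : s ≠ 0)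
    (hq : bq N β - (bq N β)⁻¹ ≠ 0) :
    -((bq N β - (bq N β)⁻¹) ^ 2 •
      ((((-(Complex.I * s⁻¹) / (bq N β - (bq N β)⁻¹)) •
        (c₂ • weyl2 N β ε 0 (-1) 0 0 + weyl2 N β ε 1 (-1) 0 0 + weyl2 N β ε (-1) (-1) 0 0))
          * weyl2 N β ε 0 0 (-1) 0
        + (-(Complex.I * s⁻¹) / (bq N β - (bq N β)⁻¹)) •
        (c₁ • weyl2 N β ε 0 0 0 (-1) + weyl2 N β ε 0 0 1 (-1) + weyl2 N β ε 0 0 (-1) (-1)))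
      * ((-(Complex.I * s) / (bq N β - (bq N β)⁻¹)) • weyl2 N β ε 0 1 0 0
        + weyl2 N β ε 1 0 0 0 *
          ((-(Complex.I * s) / (bq N β - (bq N β)⁻¹)) • weyl2 N β ε 0 0 0 1))))
      - (bq N β)⁻¹ • (weyl2 N β ε (-1) 0 0 0 * weyl2 N β ε 0 0 (-1) 0)
      - bq N β • (weyl2 N β ε 1 0 0 0 * weyl2 N β ε 0 0 1 0)
    = weyl2 N β ε 0 (-1) (-1) 1 + weyl2 N β ε 0 1 1 (-1)
      + c₁ • (weyl2 N β ε 0 1 0 (-1) + weyl2 N β ε 1 0 0 0)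
      + c₂ • (weyl2 N β ε 0 0 (-1) 0 + weyl2 N β ε 1 (-1) (-1) 1)
      + (weyl2 N β ε 0 1 (-1) (-1) + (bq N β + (bq N β)⁻¹) • weyl2 N β ε 1 0 (-1) 0
        + weyl2 N β ε 2 (-1) (-1) 1) := by
  have hq0 := bq_ne_zero N β
  generalize hκ : bq N β - (bq N β)⁻¹ = κ at hq ⊢
  have key : ∀ A B C D F : Module.End ℂ (Fun2 N),
      -(κ ^ 2 • ((((-(Complex.I * s⁻¹) / κ) • A) * B + (-(Complex.I * s⁻¹) / κ) • C)
        * ((-(Complex.I * s) / κ) • D + F * ((-(Complex.I * s) / κ) • weyl2 N β ε 0 0 0 1))))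
      = (A * B + C) * (D + F * weyl2 N β ε 0 0 0 1) := by
    intro A B C D F
    rw [smul_mul_assoc, mul_smul_comm, ← smul_add, ← smul_add, smul_mul_assoc, mul_smul_comm,
      smul_smul, smul_smul, ← neg_smul]
    have : -(κ ^ 2 * (-(Complex.I * s⁻¹) / κ * (-(Complex.I * s) / κ))) = 1 := by
      field_simp
      linear_combination -Complex.I_sq
    rw [mul_assoc, this, one_smul]
  rw [key]
  simp only [add_mul, mul_add, smul_mul_assoc, mul_smul_comm, weyl2_mul β hε, smul_smul]
  norm_num
  module

/-- The tensor product Casimir for the parameters `(β, ε)`, with values `c₁`, `c₂` of the Casimir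
on the factors. -/
def casimirGen (N : ℕ) [NeZero N] (β : ℂ) (ε : ℤ) (c₁ c₂ : ℂ) : Module.End ℂ (Fun2 N) :=
  weyl2 N β ε 0 (-1) (-1) 1 + weyl2 N β ε 0 1 1 (-1)
    + c₁ • (weyl2 N β ε 0 1 0 (-1) + weyl2 N β ε 1 0 0 0)
    + c₂ • (weyl2 N β ε 0 0 (-1) 0 + weyl2 N β ε 1 (-1) (-1) 1)
    + (weyl2 N β ε 0 1 (-1) (-1) + (bq N β + (bq N β)⁻¹) • weyl2 N β ε 1 0 (-1) 0
      + weyl2 N β ε 2 (-1) (-1) 1)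

theorem Q21_eq (b l₁ l₂ : ℂ) (hq : bq N b - (bq N b)⁻¹ ≠ 0) :
    Q21 N b l₁ l₂ = casimirGen N b 1 (casimirValue l₁) (casimirValue l₂) := by
  rw [casimirGen, ← casimir_expansion b (by norm_num) (sq N b) _ _ (Complex.exp_ne_zero _) hq]
  simp only [Q21, deltaE, deltaF, deltaK, opE, opF, opK, bu_eq_weyl, onFst_add, onSnd_add,
    onFst_smul, onSnd_smul, onFst_weyl, onSnd_weyl, casimirValue, neg_neg]

theorem Q21T_eq (b l₁ l₂ : ℂ) (hq : bq N b⁻¹ - (bq N b⁻¹)⁻¹ ≠ 0) :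
    Q21T N b l₁ l₂ = casimirGen N b⁻¹ (-1) (casimirValue (starRingEnd ℂ l₁))
      (casimirValue (starRingEnd ℂ l₂)) := by
  rw [casimirGen, ← casimir_expansion b⁻¹ (by norm_num) (sqt N b)⁻¹ _ _
    (inv_ne_zero (Complex.exp_ne_zero _)) hq]
  simp only [Q21T, deltaET, deltaFT, deltaKT, opET, opFT, opKT, but_eq_weyl, onFst_add, onSnd_add,
    onFst_smul, onSnd_smul, onFst_weyl, onSnd_weyl, casimirValue, neg_neg, inv_inv]
  rfl

end Weyl

/-! ### Rapidly decreasing entire functions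

The space of entire functions of `(z₂, z₁)` that decrease in horizontal strips faster than every
exponential contains `𝒲₂`; unlike `𝒲₂` it is invariant under all the operators considered. -/

section Rapid

variable {N : ℕ}

/-- `f` is entire in the continuous variables. -/
def IsEntire2 (f : Fun2 N) : Prop :=
  ∀ m₂ m₁ : ZMod N, Differentiable ℂ fun p : ℂ × ℂ => f ((p.1, m₂), (p.2, m₁))

/-- Entire functions with faster than exponential decrease in horizontal strips. -/
structure IsRapid (f : Fun2 N) : Prop where
  entire : IsEntire2 f
  decay : ∀ R : ℝ, ∃ C : ℝ, ∀ x : (ℂ × ZMod N) × (ℂ × ZMod N), |x.1.1.im| ≤ R → |x.2.1.im| ≤ R →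
    ‖f x‖ ≤ C * Real.exp (-(R * (|x.1.1.re| + |x.2.1.re|)))

/-- Entire functions with at most exponential growth in horizontal strips. -/
structure IsExpBdd (f : Fun2 N) : Prop where
  entire : IsEntire2 f
  growth : ∀ R : ℝ, ∃ C K : ℝ, ∀ x : (ℂ × ZMod N) × (ℂ × ZMod N), |x.1.1.im| ≤ R →
    |x.2.1.im| ≤ R → ‖f x‖ ≤ C * Real.exp (K * (|x.1.1.re| + |x.2.1.re|))

/-- `IsRapid` ties the rate to the width of the strip; the larger of the two serves for both, so
they can be prescribed independently. -/
theorem IsRapid.bound {f : Fun2 N} (hf : IsRapid f) (R S : ℝ) :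
    ∃ C : ℝ, 0 ≤ C ∧ ∀ x : (ℂ × ZMod N) × (ℂ × ZMod N), |x.1.1.im| ≤ S → |x.2.1.im| ≤ S →
      ‖f x‖ ≤ C * Real.exp (-(R * (|x.1.1.re| + |x.2.1.re|))) := by
  obtain ⟨C, hC⟩ := hf.decay (max R S)
  refine ⟨|C|, abs_nonneg C, fun x h₂ h₁ => ?_⟩
  refine (hC x (h₂.trans (le_max_right _ _)) (h₁.trans (le_max_right _ _))).trans ?_
  have : R * (|x.1.1.re| + |x.2.1.re|) ≤ max R S * (|x.1.1.re| + |x.2.1.re|) := by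
    gcongr
    exact le_max_left _ _
  gcongr
  exact le_abs_self C

theorem IsExpBdd.bound {f : Fun2 N} (hf : IsExpBdd f) (R : ℝ) :
    ∃ C K : ℝ, 0 ≤ C ∧ ∀ x : (ℂ × ZMod N) × (ℂ × ZMod N), |x.1.1.im| ≤ R →
    |x.2.1.im| ≤ R → ‖f x‖ ≤ C * Real.exp (K * (|x.1.1.re| + |x.2.1.re|)) := by
  obtain ⟨C, K, hC⟩ := hf.growth R
  refine ⟨|C|, K, abs_nonneg C, fun x h₂ h₁ => (hC x h₂ h₁).trans ?_⟩
  gcongr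
  exact le_abs_self C

theorem IsRapid.isExpBdd {f : Fun2 N} (hf : IsRapid f) : IsExpBdd f :=
  ⟨hf.entire, fun R => by
    obtain ⟨C, hC⟩ := hf.decay R
    exact ⟨C, -R, fun x h₂ h₁ => by simpa [neg_mul] using hC x h₂ h₁⟩⟩

theorem IsExpBdd.mul_isRapid {g f : Fun2 N} (hg : IsExpBdd g) (hf : IsRapid f) :
    IsRapid fun x => g x * f x := by
  refine ⟨fun m₂ m₁ => (hg.entire m₂ m₁).mul (hf.entire m₂ m₁), fun R => ?_⟩
  obtain ⟨C, K, hC0, hC⟩ := hg.bound R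
  obtain ⟨C', hC'0, hC'⟩ := hf.bound (R + K) R
  refine ⟨C * C', fun x h₂ h₁ => ?_⟩
  rw [norm_mul]
  calc ‖g x‖ * ‖f x‖ ≤ (C * Real.exp (K * (|x.1.1.re| + |x.2.1.re|)))
        * (C' * Real.exp (-((R + K) * (|x.1.1.re| + |x.2.1.re|)))) :=
        mul_le_mul (hC x h₂ h₁) (hC' x h₂ h₁) (norm_nonneg _) (by positivity)
    _ = C * C' * (Real.exp (K * (|x.1.1.re| + |x.2.1.re|))
        * Real.exp (-((R + K) * (|x.1.1.re| + |x.2.1.re|)))) := by ring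
    _ = _ := by rw [← Real.exp_add]; ring_nf

theorem IsRapid.mul {f g : Fun2 N} (hf : IsRapid f) (hg : IsRapid g) :
    IsRapid fun x => f x * g x :=
  hf.isExpBdd.mul_isRapid hg

theorem IsRapid.add {f g : Fun2 N} (hf : IsRapid f) (hg : IsRapid g) : IsRapid (f + g) := by
  refine ⟨fun m₂ m₁ => (hf.entire m₂ m₁).add (hg.entire m₂ m₁), fun R => ?_⟩
  obtain ⟨C, hC⟩ := hf.decay R
  obtain ⟨C', hC'⟩ := hg.decay R
  refine ⟨C + C', fun x h₂ h₁ => (norm_add_le _ _).trans ?_⟩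
  rw [add_mul]
  exact add_le_add (hC x h₂ h₁) (hC' x h₂ h₁)

theorem IsRapid.smul {f : Fun2 N} (hf : IsRapid f) (c : ℂ) : IsRapid (c • f) := by
  refine ⟨fun m₂ m₁ => (hf.entire m₂ m₁).const_smul c, fun R => ?_⟩
  obtain ⟨C, hC⟩ := hf.decay R
  refine ⟨‖c‖ * C, fun x h₂ h₁ => ?_⟩
  rw [Pi.smul_apply, norm_smul, mul_assoc]
  exact mul_le_mul_of_nonneg_left (hC x h₂ h₁) (norm_nonneg c)

theorem isRapid_zero : IsRapid (0 : Fun2 N) :=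
  ⟨fun _ _ => differentiable_const (0 : ℂ), fun _ => ⟨0, fun x _ _ => by simp⟩⟩

variable (N) in
/-- The space of rapidly decreasing entire functions. -/
def Rapid : Submodule ℂ (Fun2 N) where
  carrier := {f | IsRapid f}
  add_mem' hf hg := IsRapid.add hf hg
  zero_mem' := isRapid_zero
  smul_mem' c _ hf := IsRapid.smul hf c

theorem IsRapid.comp_shift {f : Fun2 N} (hf : IsRapid f) (s₂ s₁ : ℂ) (r₂ r₁ : ZMod N) :
    IsRapid fun x => f ((x.1.1 + s₂, x.1.2 + r₂), (x.2.1 + s₁, x.2.2 + r₁)) := by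
  refine ⟨fun m₂ m₁ => ?_, fun R => ?_⟩
  · exact (hf.entire (m₂ + r₂) (m₁ + r₁)).comp
      (show Differentiable ℂ fun p : ℂ × ℂ => ((p.1 + s₂, p.2 + s₁) : ℂ × ℂ) by fun_prop)
  · obtain ⟨C, hC0, hC⟩ := hf.bound |R| (R + |s₂.im| + |s₁.im|)
    refine ⟨C * Real.exp (|R| * (|s₂.re| + |s₁.re|)), fun x h₂ h₁ => ?_⟩
    have e₂ := abs_add_le x.1.1.im s₂.im
    have e₁ := abs_add_le x.2.1.im s₁.im
    refine (hC ((x.1.1 + s₂, x.1.2 + r₂), (x.2.1 + s₁, x.2.2 + r₁)) ?_ ?_).trans ?_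
    · simp only [Complex.add_im]; linarith [abs_nonneg s₁.im]
    · simp only [Complex.add_im]; linarith [abs_nonneg s₂.im]
    · rw [mul_assoc, ← Real.exp_add]
      refine mul_le_mul_of_nonneg_left (Real.exp_le_exp.2 ?_) hC0
      simp only [Complex.add_re]
      have f₂ := abs_sub_abs_le_abs_sub x.1.1.re (-s₂.re)
      have f₁ := abs_sub_abs_le_abs_sub x.2.1.re (-s₁.re)
      rw [sub_neg_eq_add, abs_neg] at f₂ f₁
      have hRR : R * (|x.1.1.re| + |x.2.1.re|) ≤ |R| * (|x.1.1.re| + |x.2.1.re|) := by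
        gcongr; exact le_abs_self R
      have : |R| * (|x.1.1.re| + |x.2.1.re|) ≤ |R| * (|x.1.1.re + s₂.re| + |x.2.1.re + s₁.re|
          + (|s₂.re| + |s₁.re|)) :=
        mul_le_mul_of_nonneg_left (by linarith) (abs_nonneg R)
      linarith

/-- The substitution `(z₂, z₁) ↦ (z₂, z₁ - z₂)`. -/
def shear (f : Fun2 N) : Fun2 N := fun x => f (x.1, (x.2.1 - x.1.1, x.2.2 - x.1.2))

theorem IsRapid.shear {f : Fun2 N} (hf : IsRapid f) : IsRapid (shear f) := by
  refine ⟨fun m₂ m₁ => ?_, fun R => ?_⟩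
  · exact (hf.entire m₂ (m₁ - m₂)).comp
      (show Differentiable ℂ fun p : ℂ × ℂ => ((p.1, p.2 - p.1) : ℂ × ℂ) by fun_prop)
  · obtain ⟨C, hC0, hC⟩ := hf.bound (2 * |R|) (2 * |R|)
    refine ⟨C, fun x h₂ h₁ => ?_⟩
    have e := abs_sub x.2.1.im x.1.1.im
    have hR := le_abs_self R
    refine (hC (x.1, (x.2.1 - x.1.1, x.2.2 - x.1.2)) ?_ ?_).trans ?_
    · simp only; linarith [abs_nonneg R]
    · simp only [Complex.sub_im]; linarith
    · refine mul_le_mul_of_nonneg_left (Real.exp_le_exp.2 ?_) hC0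
      simp only [Complex.sub_re]
      have h := abs_sub_abs_le_abs_sub x.2.1.re x.1.1.re
      have hRR : R * (|x.1.1.re| + |x.2.1.re|) ≤ |R| * (|x.1.1.re| + |x.2.1.re|) := by
        gcongr
      have : |R| * (|x.1.1.re| + |x.2.1.re|) ≤
          |R| * (2 * (|x.1.1.re| + |x.2.1.re - x.1.1.re|)) := by
        refine mul_le_mul_of_nonneg_left ?_ (abs_nonneg R)
        linarith [abs_nonneg (x.2.1.re - x.1.1.re)]
      linarith

/-- The entire function which is the complex conjugate of `f` on real arguments. -/
def starFun (f : Fun2 N) : Fun2 N := fun x =>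
  starRingEnd ℂ (f ((starRingEnd ℂ x.1.1, x.1.2), (starRingEnd ℂ x.2.1, x.2.2)))

theorem differentiable_star_star {f : ℂ × ℂ → ℂ} (hf : Differentiable ℂ f) :
    Differentiable ℂ fun p : ℂ × ℂ => starRingEnd ℂ (f (star p)) := by
  intro p
  simpa [Function.comp_def] using! (hf (star p)).star_star

theorem IsRapid.starFun {f : Fun2 N} (hf : IsRapid f) : IsRapid (starFun f) := by
  refine ⟨fun m₂ m₁ => differentiable_star_star (hf.entire m₂ m₁), fun R => ?_⟩
  obtain ⟨C, hC⟩ := hf.decay R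
  refine ⟨C, fun x h₂ h₁ => ?_⟩
  have := hC ((starRingEnd ℂ x.1.1, x.1.2), (starRingEnd ℂ x.2.1, x.2.2)) (by simpa using h₂)
    (by simpa using h₁)
  simpa [QTorus.starFun] using this

end Rapid

/-! ### Integrals of exponentially decreasing functions on `(ℝ × ℤ/N)²` -/

/-- Continuous functions with exponential decrease. -/
structure IsDec {N : ℕ} (h : (ℝ × ZMod N) × (ℝ × ZMod N) → ℂ) : Prop where
  cont : ∀ m₂ m₁ : ZMod N, Continuous fun p : ℝ × ℝ => h ((p.1, m₂), (p.2, m₁))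
  decay : ∃ C : ℝ, ∀ x, ‖h x‖ ≤ C * (Real.exp (-|x.1.1|) * Real.exp (-|x.2.1|))

section Dec

variable {N : ℕ} [NeZero N] {h : (ℝ × ZMod N) × (ℝ × ZMod N) → ℂ}

theorem IsDec.measurable (hh : IsDec h) : Measurable h := by
  have e : h = (fun q : (ℝ × ℝ) × (ZMod N × ZMod N) => h ((q.1.1, q.2.1), (q.1.2, q.2.2))) ∘
      fun x => ((x.1.1, x.2.1), (x.1.2, x.2.2)) := rfl
  rw [e]
  refine Measurable.comp (measurable_from_prod_countable_left fun m => ?_) (by fun_prop)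
  exact (hh.cont m.1 m.2).measurable

theorem memLp_exp_neg_abs : MemLp (fun x : ℝ => (Real.exp (-|x|) : ℂ)) 2 := by
  rw [memLp_two_iff_integrable_sq_norm (by fun_prop)]
  have h := integrable_exp_neg_mul_abs two_pos
  refine h.congr (Filter.Eventually.of_forall fun x => ?_)
  simp only [Complex.norm_real, Real.norm_eq_abs, Real.abs_exp, ← Real.exp_nat_mul]
  congr 1
  push_cast
  ring

theorem IsDec.memLp (hh : IsDec h) : MemLp h 2 (measure2 N) := by
  obtain ⟨C, hC⟩ := hh.decay
  have h1 : MemLp (fun x : ℝ × ZMod N => (Real.exp (-|x.1|) : ℂ) * 1) 2 (measure1 N) :=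
    memLp_mul_prod memLp_exp_neg_abs (MemLp.of_discrete (f := fun _ : ZMod N => (1 : ℂ)))
  have h2 := (memLp_mul_prod h1 h1).const_mul (C : ℂ)
  refine h2.mono hh.measurable.aestronglyMeasurable (Filter.Eventually.of_forall fun x => ?_)
  refine (hC x).trans ?_
  simp only [mul_one, norm_mul, Complex.norm_real, Real.norm_eq_abs, Real.abs_exp]
  gcongr
  exact le_abs_self C

theorem IsDec.integrable (hh : IsDec h) : Integrable h (measure2 N) := by
  obtain ⟨C, hC⟩ := hh.decay
  have h1 : Integrable (fun x : ℝ × ZMod N => Real.exp (-|x.1|) * 1) (measure1 N) :=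
    integrable_exp_neg_abs.mul_prod (Integrable.of_finite (f := fun _ : ZMod N => (1 : ℝ)))
  refine ((h1.mul_prod h1).const_mul C).mono' hh.measurable.aestronglyMeasurable
    (Filter.Eventually.of_forall fun x => ?_)
  simpa using hC x

theorem IsDec.integrable_slice (hh : IsDec h) (m₂ m₁ : ZMod N) :
    Integrable (fun p : ℝ × ℝ => h ((p.1, m₂), (p.2, m₁)))
      ((volume : Measure ℝ).prod (volume : Measure ℝ)) := by
  obtain ⟨C, hC⟩ := hh.decay
  exact ((integrable_exp_neg_abs.mul_prod integrable_exp_neg_abs).const_mul C).mono'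
    (hh.cont m₂ m₁).aestronglyMeasurable (Filter.Eventually.of_forall fun x => hC _)

theorem integral_measure1 {g : ℝ × ZMod N → ℂ} (hg : Integrable g (measure1 N)) :
    ∫ x, g x ∂(measure1 N) = ∑ m, ∫ x : ℝ, g (x, m) := by
  rw [integral_prod_symm g hg, integral_count]

theorem IsDec.integrable_snd (hh : IsDec h) (u : ℝ × ZMod N) :
    Integrable (fun v => h (u, v)) (measure1 N) := by
  obtain ⟨C, hC⟩ := hh.decay
  have h1 : Integrable (fun x : ℝ × ZMod N => Real.exp (-|x.1|) * 1) (measure1 N) :=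
    integrable_exp_neg_abs.mul_prod (Integrable.of_finite (f := fun _ : ZMod N => (1 : ℝ)))
  refine (h1.const_mul (C * Real.exp (-|u.1|))).mono'
    (hh.measurable.comp measurable_prodMk_left).aestronglyMeasurable
    (Filter.Eventually.of_forall fun x => ?_)
  simpa [mul_assoc] using hC (u, x)

theorem IsDec.integral_eq (hh : IsDec h) :
    ∫ x, h x ∂(measure2 N) = ∑ m₂, ∑ m₁, ∫ x₂ : ℝ, ∫ x₁ : ℝ, h ((x₂, m₂), (x₁, m₁)) := by
  rw [integral_prod h hh.integrable, integral_measure1 hh.integrable.integral_prod_left]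
  refine Finset.sum_congr rfl fun m₂ _ => ?_
  simp only [integral_measure1 (hh.integrable_snd _)]
  exact integral_finsetSum _ fun m₁ _ => (hh.integrable_slice m₂ m₁).integral_prod_left

theorem IsDec.integral_eq_swap (hh : IsDec h) :
    ∫ x, h x ∂(measure2 N) = ∑ m₂, ∑ m₁, ∫ x₁ : ℝ, ∫ x₂ : ℝ, h ((x₂, m₂), (x₁, m₁)) := by
  rw [hh.integral_eq]
  refine Finset.sum_congr rfl fun m₂ _ => Finset.sum_congr rfl fun m₁ _ => ?_
  exact integral_integral_swap (f := fun x₂ x₁ => h ((x₂, m₂), (x₁, m₁)))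
    (hh.integrable_slice m₂ m₁)

theorem IsRapid.isDec {f : Fun2 N} (hf : IsRapid f) : IsDec (restrict f) := by
  obtain ⟨C, hC0, hC⟩ := hf.bound 1 0
  refine ⟨fun m₂ m₁ => (hf.entire m₂ m₁).continuous.comp (g := fun p : ℂ × ℂ => f ((p.1, m₂),
    (p.2, m₁))) (f := fun p : ℝ × ℝ => ((p.1 : ℂ), (p.2 : ℂ))) (by fun_prop), C, fun x => ?_⟩
  refine (hC (((x.1.1 : ℂ), x.1.2), ((x.2.1 : ℂ), x.2.2)) (by simp) (by simp)).trans ?_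
  rw [← Real.exp_add]
  simp only [Complex.ofReal_re]
  ring_nf
  rfl

theorem IsRapid.memLp {f : Fun2 N} (hf : IsRapid f) : MemLp (restrict f) 2 (measure2 N) :=
  hf.isDec.memLp

theorem coeFn_toH2 {f : Fun2 N} (hf : IsRapid f) : toH2 f =ᵐ[measure2 N] restrict f := by
  rw [toH2, dif_pos hf.memLp]
  exact hf.memLp.coeFn_toLp

theorem toH2_add {f g : Fun2 N} (hf : IsRapid f) (hg : IsRapid g) :
    toH2 (f + g) = toH2 f + toH2 g := by
  rw [toH2, dif_pos (hf.add hg).memLp, toH2, dif_pos hf.memLp, toH2, dif_pos hg.memLp]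
  exact MemLp.toLp_add _ _

theorem toH2_smul {f : Fun2 N} (hf : IsRapid f) (c : ℂ) : toH2 (c • f) = c • toH2 f := by
  rw [toH2, dif_pos (hf.smul c).memLp, toH2, dif_pos hf.memLp]
  exact MemLp.toLp_const_smul _ _

variable (N) in
/-- The inclusion of the rapidly decreasing functions into the Hilbert space. -/
def rapidToH2 : Rapid N →ₗ[ℂ] H2 N where
  toFun f := toH2 f.1
  map_add' f g := toH2_add f.2 g.2
  map_smul' c f := toH2_smul f.2 c

theorem inner_toH2 {f g : Fun2 N} (hf : IsRapid f) (hg : IsRapid g) :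
    inner ℂ (toH2 f) (toH2 g) =
      ∫ x, starRingEnd ℂ (restrict f x) * restrict g x ∂(measure2 N) := by
  rw [L2.inner_def]
  refine integral_congr_ae ?_
  filter_upwards [coeFn_toH2 hf, coeFn_toH2 hg] with x h1 h2
  rw [h1, h2, RCLike.inner_apply, mul_comm]

end Dec

/-! ### Examples of rapidly decreasing functions -/

section Examples

variable {N : ℕ}

theorem exists_norm_eval_le (P : Polynomial ℂ) (R : ℝ) :
    ∃ C : ℝ, 0 ≤ C ∧ ∀ z : ℂ, |z.im| ≤ R → ‖P.eval z‖ ≤ C * Real.exp |z.re| := by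
  induction P using Polynomial.induction_on' with
  | add p q hp hq =>
    obtain ⟨C, hC0, hC⟩ := hp
    obtain ⟨C', hC'0, hC'⟩ := hq
    refine ⟨C + C', by positivity, fun z hz => ?_⟩
    rw [Polynomial.eval_add, add_mul]
    exact (norm_add_le _ _).trans (add_le_add (hC z hz) (hC' z hz))
  | monomial n a =>
    refine ⟨‖a‖ * (n.factorial * Real.exp R), by positivity, fun z hz => ?_⟩
    rw [Polynomial.eval_monomial, norm_mul, norm_pow, mul_assoc, mul_assoc, ← Real.exp_add]
    have h1 := Real.pow_div_factorial_le_exp ‖z‖ (norm_nonneg z) n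
    rw [div_le_iff₀ (by positivity)] at h1
    have h2 : Real.exp ‖z‖ ≤ Real.exp (R + |z.re|) :=
      Real.exp_le_exp.2 (by linarith [Complex.norm_le_abs_re_add_abs_im z])
    have h3 : Real.exp ‖z‖ * n.factorial ≤ Real.exp (R + |z.re|) * n.factorial := by gcongr
    gcongr
    linarith

/-- In a strip the real part of the exponent is $-\mathrm{Re}\,\alpha\,(\mathrm{Re}\,z)^2$ up to a
term linear in $|\mathrm{Re}\,z|$ and a constant, and the quadratic term absorbs any linear one. -/
theorem exists_norm_gauss_le (α β : ℂ) (hα : 0 < α.re) (P : Polynomial ℂ) (R : ℝ) :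
    ∃ C : ℝ, ∀ z : ℂ, |z.im| ≤ R →
      ‖Complex.exp (-α * z ^ 2 + β * z) * P.eval z‖ ≤ C * Real.exp (-(R * |z.re|)) := by
  obtain ⟨C, hC0, hC⟩ := exists_norm_eval_le P R
  -- `K` collects all coefficients of `|z.re|`: the cross term of `z ^ 2`, the linear term, the
  -- target rate `R`, and 1 for the polynomial.
  let K : ℝ := 2 * |α.im| * R + |β.re| + R + 1
  refine ⟨Real.exp (α.re * R ^ 2 + |β.im| * R + K ^ 2 / (4 * α.re)) * C, fun z hz => ?_⟩
  have hre : (-α * z ^ 2 + β * z).re = -α.re * (z.re ^ 2 - z.im ^ 2) + 2 * α.im * (z.re * z.im)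
      + β.re * z.re - β.im * z.im := by
    simp [pow_two]; ring
  have hR : 0 ≤ R := (abs_nonneg _).trans hz
  have e1 : z.im ^ 2 ≤ R ^ 2 := by rw [← sq_abs]; gcongr
  have e2 : α.im * (z.re * z.im) ≤ |α.im| * (|z.re| * R) := by
    refine (le_abs_self _).trans ?_
    rw [abs_mul, abs_mul]; gcongr
  have e3 : β.re * z.re ≤ |β.re| * |z.re| := by rw [← abs_mul]; exact le_abs_self _
  have e4 : -(β.im * z.im) ≤ |β.im| * R := by
    refine (neg_le_abs _).trans ?_
    rw [abs_mul]; gcongr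
  have e5 : K * |z.re| ≤ α.re * z.re ^ 2 + K ^ 2 / (4 * α.re) := by
    have : 0 ≤ (2 * α.re * |z.re| - K) ^ 2 / (4 * α.re) := by positivity
    have h : (2 * α.re * |z.re| - K) ^ 2 / (4 * α.re)
        = α.re * |z.re| ^ 2 - K * |z.re| + K ^ 2 / (4 * α.re) := by
      field_simp; ring
    rw [h, sq_abs] at this
    linarith
  have e6 : α.re * z.im ^ 2 ≤ α.re * R ^ 2 := by gcongr
  rw [norm_mul, Complex.norm_exp, hre]
  calc _ ≤ Real.exp (-α.re * (z.re ^ 2 - z.im ^ 2) + 2 * α.im * (z.re * z.im)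
      + β.re * z.re - β.im * z.im) * (C * Real.exp |z.re|) := by gcongr; exact hC z hz
    _ = C * Real.exp (-α.re * (z.re ^ 2 - z.im ^ 2) + 2 * α.im * (z.re * z.im)
      + β.re * z.re - β.im * z.im + |z.re|) := by rw [Real.exp_add]; ring
    _ ≤ C * Real.exp (α.re * R ^ 2 + |β.im| * R + K ^ 2 / (4 * α.re) + -(R * |z.re|)) := by
      refine mul_le_mul_of_nonneg_left (Real.exp_le_exp.2 ?_) hC0
      simp only [K] at e5 ⊢
      linarith
    _ = _ := by rw [Real.exp_add]; ring

/-- The one-variable analogue of `IsRapid`. -/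
structure IsRapid1 (f : Fun1 N) : Prop where
  entire : ∀ m : ZMod N, Differentiable ℂ fun z : ℂ => f (z, m)
  decay : ∀ R : ℝ, ∃ C : ℝ, ∀ x : ℂ × ZMod N, |x.1.im| ≤ R →
    ‖f x‖ ≤ C * Real.exp (-(R * |x.1.re|))

theorem isRapid1_of_mem_W1 [NeZero N] {f : Fun1 N} (hf : f ∈ W1 N) : IsRapid1 f := by
  induction hf using Submodule.span_induction with
  | mem f h =>
    obtain ⟨α, β, P, c, hα, rfl⟩ := h
    refine ⟨fun m => ?_, fun R => ?_⟩
    · have := P.differentiable (𝕜 := ℂ)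
      dsimp only
      fun_prop
    · obtain ⟨C, hC⟩ := exists_norm_gauss_le α β hα P R
      refine ⟨C * ∑ m, ‖c m‖, fun x hx => ?_⟩
      have h1 := hC x.1 hx
      have h2 : ‖c x.2‖ ≤ ∑ m, ‖c m‖ :=
        Finset.single_le_sum (f := fun m => ‖c m‖) (fun _ _ => norm_nonneg _) (Finset.mem_univ x.2)
      rw [norm_mul]
      calc _ ≤ (C * Real.exp (-(R * |x.1.re|))) * ∑ m, ‖c m‖ :=
            mul_le_mul h1 h2 (norm_nonneg _) ((norm_nonneg _).trans h1)
        _ = _ := by ring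
  | zero => exact ⟨fun _ => differentiable_const (0 : ℂ), fun _ => ⟨0, fun x _ => by simp⟩⟩
  | add f g _ _ hf hg =>
    refine ⟨fun m => (hf.entire m).add (hg.entire m), fun R => ?_⟩
    obtain ⟨C, hC⟩ := hf.decay R
    obtain ⟨C', hC'⟩ := hg.decay R
    refine ⟨C + C', fun x hx => (norm_add_le _ _).trans ?_⟩
    rw [add_mul]
    exact add_le_add (hC x hx) (hC' x hx)
  | smul a f _ hf =>
    refine ⟨fun m => (hf.entire m).const_smul a, fun R => ?_⟩
    obtain ⟨C, hC⟩ := hf.decay R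
    refine ⟨‖a‖ * C, fun x hx => ?_⟩
    rw [Pi.smul_apply, norm_smul, mul_assoc]
    exact mul_le_mul_of_nonneg_left (hC x hx) (norm_nonneg a)

theorem IsRapid1.tensor {g h : Fun1 N} (hg : IsRapid1 g) (hh : IsRapid1 h) :
    IsRapid fun x : (ℂ × ZMod N) × (ℂ × ZMod N) => g x.1 * h x.2 := by
  refine ⟨fun m₂ m₁ => ((hg.entire m₂).comp differentiable_fst).mul
    ((hh.entire m₁).comp differentiable_snd), fun R => ?_⟩
  obtain ⟨C, hC⟩ := hg.decay R
  obtain ⟨C', hC'⟩ := hh.decay R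
  refine ⟨C * C', fun x h₂ h₁ => ?_⟩
  rw [norm_mul]
  calc _ ≤ (C * Real.exp (-(R * |x.1.1.re|))) * (C' * Real.exp (-(R * |x.2.1.re|))) :=
        mul_le_mul (hC _ h₂) (hC' _ h₁) (norm_nonneg _) ((norm_nonneg _).trans (hC _ h₂))
    _ = C * C' * (Real.exp (-(R * |x.1.1.re|)) * Real.exp (-(R * |x.2.1.re|))) := by ring
    _ = _ := by rw [← Real.exp_add]; ring_nf

theorem isRapid_of_mem_W2 [NeZero N] {f : Fun2 N} (hf : f ∈ W2 N) : IsRapid f := by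
  induction hf using Submodule.span_induction with
  | mem f h =>
    obtain ⟨g, hg, k, hk, rfl⟩ := h
    exact (isRapid1_of_mem_W1 hg).tensor (isRapid1_of_mem_W1 hk)
  | zero => exact isRapid_zero
  | add f g _ _ hf hg => exact hf.add hg
  | smul a f _ hf => exact hf.smul a

theorem isExpBdd_yGen [NeZero N] (β : ℂ) (ε k₂ k₁ : ℤ) :
    IsExpBdd fun x : (ℂ × ZMod N) × (ℂ × ZMod N) => yGen β ε x.1 ^ k₂ * yGen β ε x.2 ^ k₁ := by
  have hy : ∀ (k : ℤ) (x : ℂ × ZMod N), yGen β ε x ^ k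
      = Complex.exp (k * (2 * Real.pi / N * β * x.1))
        * ZMod.stdAddChar (-((ε : ZMod N) * x.2)) ^ k := fun k x => by
    rw [yGen, mul_zpow, Complex.exp_int_mul]
  refine ⟨fun m₂ m₁ => ?_, fun R => ?_⟩
  · simp only [hy]
    fun_prop
  · let A : ℤ → ℝ := fun k => ‖(k * (2 * Real.pi / N * β) : ℂ)‖
    have hb : ∀ (k : ℤ) (x : ℂ × ZMod N), |x.1.im| ≤ R →
        ‖yGen β ε x ^ k‖ ≤ Real.exp (A k * R) * Real.exp (A k * |x.1.re|) := by
      intro k x hx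
      rw [hy, norm_mul, norm_zpow, norm_stdAddChar, one_zpow, mul_one, ← Real.exp_add]
      refine (Complex.norm_exp_le_exp_norm _).trans (Real.exp_le_exp.2 ?_)
      rw [← mul_assoc, norm_mul, ← mul_add]
      refine mul_le_mul_of_nonneg_left ?_ (norm_nonneg _)
      linarith [Complex.norm_le_abs_re_add_abs_im x.1]
    refine ⟨Real.exp (A k₂ * R) * Real.exp (A k₁ * R), A k₂ + A k₁, fun x h₂ h₁ => ?_⟩
    have hA : ∀ k, 0 ≤ A k := fun k => norm_nonneg _
    rw [norm_mul]
    calc _ ≤ (Real.exp (A k₂ * R) * Real.exp (A k₂ * |x.1.1.re|)) *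
          (Real.exp (A k₁ * R) * Real.exp (A k₁ * |x.2.1.re|)) :=
          mul_le_mul (hb _ _ h₂) (hb _ _ h₁) (norm_nonneg _) (by positivity)
      _ = Real.exp (A k₂ * R) * Real.exp (A k₁ * R) *
          Real.exp (A k₂ * |x.1.1.re| + A k₁ * |x.2.1.re|) := by rw [Real.exp_add]; ring
      _ ≤ _ := by
        gcongr
        nlinarith [hA k₂, hA k₁, abs_nonneg x.1.1.re, abs_nonneg x.2.1.re,
          mul_nonneg (hA k₂) (abs_nonneg x.2.1.re), mul_nonneg (hA k₁) (abs_nonneg x.1.1.re)]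

theorem IsRapid.weyl2 [NeZero N] {f : Fun2 N} (hf : IsRapid f) (β : ℂ) (ε a₂ k₂ a₁ k₁ : ℤ) :
    IsRapid (weyl2 N β ε a₂ k₂ a₁ k₁ f) := by
  have h := ((isExpBdd_yGen β ε k₂ k₁).mul_isRapid (hf.comp_shift (a₂ * (Complex.I * β))
    (a₁ * (Complex.I * β)) (-((ε * a₂ : ℤ) : ZMod N)) (-((ε * a₁ : ℤ) : ZMod N)))).smul
    (bq N β ^ (a₂ * k₂ + a₁ * k₁))
  refine (congrArg IsRapid (funext fun x => ?_)).mp h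
  simp only [weyl2_apply, Pi.smul_apply, smul_eq_mul, ← sub_eq_add_neg]
  ring

end Examples

/-! ### The Fourier transform in the first tensor factor -/

section Fourier

variable {N : ℕ} [NeZero N]

theorem IsRapid.differentiable_fst {f : Fun2 N} (hf : IsRapid f) (m : ZMod N) (x₁ : ℂ × ZMod N) :
    Differentiable ℂ fun z : ℂ => f ((z, m), x₁) :=
  (hf.entire m x₁.2).comp (show Differentiable ℂ fun z : ℂ => ((z, x₁.1) : ℂ × ℂ) by fun_prop)

theorem IsRapid.differentiable_snd {f : Fun2 N} (hf : IsRapid f) (x₂ : ℂ × ZMod N) (m : ZMod N) :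
    Differentiable ℂ fun z : ℂ => f (x₂, (z, m)) :=
  (hf.entire x₂.2 m).comp (show Differentiable ℂ fun z : ℂ => ((x₂.1, z) : ℂ × ℂ) by fun_prop)

theorem IsRapid.bound_fst {f : Fun2 N} (hf : IsRapid f) (S : ℝ) (x₁ : ℂ × ZMod N) :
    ∃ C : ℝ, 0 ≤ C ∧ ∀ x : ℂ × ZMod N, |x.1.im| ≤ S → ‖f (x, x₁)‖ ≤ C * Real.exp (-|x.1.re|) := by
  obtain ⟨C, hC0, hC⟩ := hf.bound 1 (max S |x₁.1.im|)
  refine ⟨C, hC0, fun x hx => (hC (x, x₁) (hx.trans (le_max_left _ _)) (le_max_right _ _)).trans ?_⟩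
  gcongr
  simp

theorem IsRapid.integral_fst_add {f : Fun2 N} (hf : IsRapid f) (w : ℂ) (m : ZMod N)
    (x₁ : ℂ × ZMod N) :
    ∫ μ : ℝ, f (((μ : ℂ), m), x₁) = ∫ μ : ℝ, f ((μ + w, m), x₁) := by
  obtain ⟨C, -, hC⟩ := hf.bound_fst |w.im| x₁
  refine integral_eq_integral_add (fun z => f ((z, m), x₁)) w C
    (hf.differentiable_fst m x₁).differentiableOn fun z hz => hC (z, m) ?_
  simpa using Set.abs_sub_left_of_mem_uIcc hz

theorem IsRapid.integrable_fst {f : Fun2 N} (hf : IsRapid f) (m : ZMod N) (x₁ : ℂ × ZMod N) :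
    Integrable fun μ : ℝ => f (((μ : ℂ), m), x₁) := by
  obtain ⟨C, -, hC⟩ := hf.bound_fst 0 x₁
  refine (integrable_exp_neg_abs.const_mul C).mono'
    ((hf.differentiable_fst m x₁).continuous.comp Complex.continuous_ofReal).aestronglyMeasurable
    (Filter.Eventually.of_forall fun μ => ?_)
  simpa using hC ((μ : ℂ), m) (by simp)

theorem isExpBdd_exp_fst (c : ℂ) :
    IsExpBdd fun x : (ℂ × ZMod N) × (ℂ × ZMod N) => Complex.exp (c * x.1.1) := by
  refine ⟨fun m₂ m₁ => by dsimp only; fun_prop, fun R => ⟨Real.exp (‖c‖ * R), ‖c‖,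
    fun x h₂ h₁ => ?_⟩⟩
  rw [← Real.exp_add]
  refine (Complex.norm_exp_le_exp_norm _).trans (Real.exp_le_exp.2 ?_)
  rw [norm_mul, ← mul_add]
  refine mul_le_mul_of_nonneg_left ?_ (norm_nonneg c)
  linarith [Complex.norm_le_abs_re_add_abs_im x.1.1, abs_nonneg x.2.1.re]

theorem isExpBdd_disc (c : ZMod N → ℂ) :
    IsExpBdd fun x : (ℂ × ZMod N) × (ℂ × ZMod N) => c x.1.2 := by
  refine ⟨fun m₂ m₁ => differentiable_const (c m₂), fun R => ⟨∑ m, ‖c m‖, 0, fun x _ _ => ?_⟩⟩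
  rw [zero_mul, Real.exp_zero, mul_one]
  exact Finset.single_le_sum (f := fun m => ‖c m‖) (fun _ _ => norm_nonneg _)
    (Finset.mem_univ x.1.2)

theorem norm_kernel (μ : ℝ) (w ν : ℂ) :
    ‖Complex.exp (-(2 * Real.pi * Complex.I / N) * ((μ + w) * ν))‖
      = Real.exp (2 * Real.pi / N * (μ * ν.im + (w * ν).im)) := by
  rw [Complex.norm_exp]
  congr 1
  have h : -(2 * Real.pi * Complex.I / N) * ((μ + w) * ν)
      = ((2 * Real.pi / N : ℝ) : ℂ) * (-Complex.I * ((μ + w) * ν)) := by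
    push_cast; ring
  rw [h, Complex.re_ofReal_mul, add_mul]
  simp

variable (N) in
theorem two_pi_div_pos : 0 < 2 * Real.pi / (N : ℝ) := by
  have : (0 : ℝ) < N := Nat.cast_pos.2 (NeZero.pos N)
  positivity

/-- The Fourier transform over `ℝ` of the component `m` of `f`. -/
def fourierSlice (m : ZMod N) (f : Fun2 N) : Fun2 N := fun x =>
  ∫ μ : ℝ, Complex.exp (-(2 * Real.pi * Complex.I / N) * (μ * x.1.1)) * f (((μ : ℂ), m), x.2)

/-- The freedom to choose the line of integration yields both the decay of the transform and its
intertwining of complex translations with multiplications. -/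
theorem fourierSlice_shift {f : Fun2 N} (hf : IsRapid f) (m : ZMod N) (w : ℂ)
    (x : (ℂ × ZMod N) × (ℂ × ZMod N)) :
    fourierSlice m f x = ∫ μ : ℝ, Complex.exp (-(2 * Real.pi * Complex.I / N) *
      ((μ + w) * x.1.1)) * f ((μ + w, m), x.2) := by
  have h := ((isExpBdd_exp_fst (-(2 * Real.pi * Complex.I / N) * x.1.1)).mul_isRapid
    hf).integral_fst_add w m x.2
  simp only [mul_left_comm, mul_comm] at h
  simpa only [fourierSlice, mul_assoc, mul_left_comm, mul_comm] using h

theorem IsRapid.fourierSlice {f : Fun2 N} (hf : IsRapid f) (m : ZMod N) :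
    IsRapid (fourierSlice m f) := by
  have hκ := two_pi_div_pos N
  set κ : ℝ := 2 * Real.pi / N with hκd
  refine ⟨fun m₂ m₁ => ?_, fun R => ?_⟩
  · refine differentiable_integral_of_dominated (E := ℂ × ℂ) (fun p μ =>
      Complex.exp (-(2 * Real.pi * Complex.I / N) * (μ * p.1)) * f (((μ : ℂ), m), (p.2, m₁)))
      ?_ (fun μ => ?_) fun p₀ => ?_
    · refine Continuous.mul (by fun_prop) ?_
      exact (hf.entire m m₁).continuous.comp (g := fun p : ℂ × ℂ => f ((p.1, m), (p.2, m₁)))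
        (f := fun q : (ℂ × ℂ) × ℝ => ((q.2 : ℂ), q.1.2)) (by fun_prop)
    · refine Differentiable.mul (by fun_prop) ?_
      exact (hf.differentiable_snd ((μ : ℂ), m) m₁).comp _root_.differentiable_snd
    · obtain ⟨C, hC0, hC⟩ := hf.bound (κ * (‖p₀‖ + 2) + 1) (‖p₀‖ + 2)
      refine ⟨fun μ => C * Real.exp (-|μ|), integrable_exp_neg_abs.const_mul C, fun p hp μ => ?_⟩
      have hp' : ‖p‖ ≤ ‖p₀‖ + 2 := by
        rw [mem_ball_iff_norm] at hp
        linarith [norm_le_norm_add_norm_sub' p p₀]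
      have h1 : |p.1.im| ≤ ‖p₀‖ + 2 :=
        (Complex.abs_im_le_norm _).trans ((norm_fst_le p).trans hp')
      have h2 : |p.2.im| ≤ ‖p₀‖ + 2 :=
        (Complex.abs_im_le_norm _).trans ((norm_snd_le p).trans hp')
      have hf' := hC (((μ : ℂ), m), (p.2, m₁)) (by simp; positivity) h2
      have hk := norm_kernel (N := N) μ 0 p.1
      rw [add_zero, zero_mul, Complex.zero_im, add_zero, ← hκd] at hk
      rw [norm_mul, hk]
      refine (mul_le_mul_of_nonneg_left hf' (Real.exp_nonneg _)).trans ?_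
      rw [mul_left_comm, ← Real.exp_add]
      refine mul_le_mul_of_nonneg_left (Real.exp_le_exp.2 ?_) hC0
      simp only [Complex.ofReal_re]
      have h3 : κ * (μ * p.1.im) ≤ κ * (|μ| * (‖p₀‖ + 2)) := by
        refine mul_le_mul_of_nonneg_left ((le_abs_self _).trans ?_) hκ.le
        rw [abs_mul]
        exact mul_le_mul_of_nonneg_left h1 (abs_nonneg μ)
      have h4 : 0 ≤ (κ * (‖p₀‖ + 2) + 1) * |p.2.re| := by positivity
      linarith
  · rcases lt_or_ge R 0 with hR | hR
    · exact ⟨0, fun x h₂ _ => absurd ((abs_nonneg _).trans h₂) (not_le.2 hR)⟩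
    -- The line of integration is moved by `R / κ` in the direction opposite to the sign `τ` of
    -- `x.1.1.re`, which makes the kernel contribute `exp (-(R * |x.1.1.re|))`. In the rate, `κ * R`
    -- pays for the growth of the kernel in `μ`, 1 for integrability, and `R` is the decay wanted in
    -- the other variable.
    obtain ⟨C, hC0, hC⟩ := hf.bound (R + κ * R + 1) (R / κ + R)
    refine ⟨C * ∫ μ : ℝ, Real.exp (-|μ|), fun x h₂ h₁ => ?_⟩
    obtain ⟨τ, hτ, hτx⟩ : ∃ τ : ℝ, |τ| = 1 ∧ τ * x.1.1.re = |x.1.1.re| := by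
      rcases le_total 0 x.1.1.re with h | h
      · exact ⟨1, abs_one, by rw [one_mul, abs_of_nonneg h]⟩
      · exact ⟨-1, by simp, by rw [neg_one_mul, abs_of_nonpos h]⟩
    rw [fourierSlice_shift hf m (((-(τ * (R / κ)) : ℝ) : ℂ) * Complex.I)]
    have hI : Integrable fun μ : ℝ => C * Real.exp (-(R * (|x.1.1.re| + |x.2.1.re|)))
        * Real.exp (-|μ|) := integrable_exp_neg_abs.const_mul _
    refine (norm_integral_le_of_norm_le hI (Filter.Eventually.of_forall fun μ => ?_)).trans ?_
    · have hf' := hC ((μ + ((-(τ * (R / κ)) : ℝ) : ℂ) * Complex.I, m), x.2)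
        (by
          simp only [Complex.add_im, Complex.ofReal_im, Complex.im_ofReal_mul, Complex.I_im,
            zero_add, mul_one, abs_neg, abs_mul, hτ, one_mul]
          rw [abs_of_nonneg (by positivity)]
          linarith)
        (by simp only; linarith [div_nonneg hR hκ.le])
      rw [norm_mul, norm_kernel, ← hκd]
      refine (mul_le_mul_of_nonneg_left hf' (Real.exp_nonneg _)).trans ?_
      rw [mul_left_comm, ← Real.exp_add, mul_assoc C, ← Real.exp_add]
      refine mul_le_mul_of_nonneg_left (Real.exp_le_exp.2 ?_) hC0
      have e1 : (((-(τ * (R / κ)) : ℝ) : ℂ) * Complex.I * x.1.1).im = -(|x.1.1.re| * (R / κ)) := by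
        rw [mul_assoc, Complex.im_ofReal_mul, ← hτx]
        simp
        ring
      have e2 : (μ + ((-(τ * (R / κ)) : ℝ) : ℂ) * Complex.I).re = μ := by
        rw [Complex.add_re, Complex.ofReal_re, Complex.re_ofReal_mul]
        simp
      simp only [e1, e2]
      have e3 : κ * (μ * x.1.1.im) ≤ κ * (|μ| * R) := by
        refine mul_le_mul_of_nonneg_left ((le_abs_self _).trans ?_) hκ.le
        rw [abs_mul]
        exact mul_le_mul_of_nonneg_left h₂ (abs_nonneg μ)
      have e4 : κ * (|x.1.1.re| * (R / κ)) = R * |x.1.1.re| := by field_simp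
      have e5 : 0 ≤ κ * R * |x.2.1.re| := by positivity
      have e6 : 0 ≤ R * |μ| := by positivity
      nlinarith [abs_nonneg x.2.1.re]
    · rw [integral_const_mul]
      refine le_of_eq ?_
      ring

/-- The unitary Fourier transform on `ℝ × ℤ/N` in the first tensor factor. -/
def fourier2 (f : Fun2 N) : Fun2 N := fun x =>
  1 / (N : ℂ) * ∑ m : ZMod N, ZMod.stdAddChar (m * x.1.2) * fourierSlice m f x

/-- Reflection in the first tensor factor. -/
def reflect (f : Fun2 N) : Fun2 N := fun x => f ((-x.1.1, -x.1.2), x.2)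

theorem isRapid_sum {ι : Type*} (s : Finset ι) (F : ι → Fun2 N) (hF : ∀ i ∈ s, IsRapid (F i)) :
    IsRapid fun x => ∑ i ∈ s, F i x := by
  have : (∑ i ∈ s, F i) ∈ Rapid N := Submodule.sum_mem _ hF
  rwa [show (fun x => ∑ i ∈ s, F i x) = ∑ i ∈ s, F i by
    funext x; rw [Finset.sum_apply]]

theorem IsRapid.fourier2 {f : Fun2 N} (hf : IsRapid f) : IsRapid (fourier2 f) :=
  (isRapid_sum Finset.univ (fun m x => ZMod.stdAddChar (m * x.1.2) * QTorus.fourierSlice m f x)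
    fun m _ => (isExpBdd_disc fun n => ZMod.stdAddChar (m * n)).mul_isRapid
      (hf.fourierSlice m)).smul (1 / (N : ℂ))

theorem IsRapid.reflect {f : Fun2 N} (hf : IsRapid f) : IsRapid (reflect f) := by
  refine ⟨fun m₂ m₁ => ?_, fun R => ?_⟩
  · exact (hf.entire (-m₂) m₁).comp
      (show Differentiable ℂ fun p : ℂ × ℂ => ((-p.1, p.2) : ℂ × ℂ) by fun_prop)
  · obtain ⟨C, hC⟩ := hf.decay R
    refine ⟨C, fun x h₂ h₁ => ?_⟩
    simpa [QTorus.reflect] using hC ((-x.1.1, -x.1.2), x.2) (by simpa using h₂) h₁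

theorem fourier2_reflect (f : Fun2 N) : fourier2 (reflect f) = reflect (fourier2 f) := by
  funext x
  simp only [fourier2, reflect]
  congr 1
  refine Fintype.sum_equiv (Equiv.neg (ZMod N)) _ _ fun m => ?_
  simp only [Equiv.neg_apply, neg_mul_neg, fourierSlice]
  congr 1
  rw [← integral_neg_eq_self]
  congr 1
  funext μ
  simp only [reflect]
  push_cast
  rw [neg_neg]
  congr 2
  ring

/-- Identity theorem, the reals accumulating at 0. It extends Fourier inversion from real arguments
to the entire functions. -/
theorem differentiable_eq_of_eq_real {f g : ℂ → ℂ} (hf : Differentiable ℂ f)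
    (hg : Differentiable ℂ g) (h : ∀ x : ℝ, f x = g x) : f = g := by
  have hf' : AnalyticOnNhd ℂ f Set.univ := fun z _ => hf.analyticAt z
  have hg' : AnalyticOnNhd ℂ g Set.univ := fun z _ => hg.analyticAt z
  refine hf'.eq_of_frequently_eq hg' (z₀ := 0) ?_
  have ht : Filter.Tendsto (fun x : ℝ => (x : ℂ)) (nhdsWithin 0 {0}ᶜ) (nhdsWithin 0 {0}ᶜ) := by
    refine tendsto_nhdsWithin_iff.2 ⟨?_, ?_⟩
    · exact (Complex.continuous_ofReal.tendsto' 0 0 (by simp)).mono_left nhdsWithin_le_nhds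
    · filter_upwards [self_mem_nhdsWithin] with x hx
      simpa using hx
  exact ht.frequently (Filter.Eventually.frequently (Filter.Eventually.of_forall h))

/-- Fourier inversion on the line after the rescaling $\nu=N\xi$, whose Jacobian is the factor `N`.
The residue `n` is irrelevant because `fourierSlice m f` does not depend on the residue in the first
factor. -/
theorem integral_fourierSlice {f : Fun2 N} (hf : IsRapid f) (m n : ZMod N) (u : ℝ)
    (x₁ : ℂ × ZMod N) :
    ∫ ν : ℝ, Complex.exp (-(2 * Real.pi * Complex.I / N) * (ν * (-u : ℂ)))
      * fourierSlice m f (((ν : ℂ), n), x₁) = N * f (((u : ℂ), m), x₁) := by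
  have hN : (0 : ℝ) < N := Nat.cast_pos.2 (NeZero.pos N)
  have hNC : (N : ℂ) ≠ 0 := Nat.cast_ne_zero.2 (NeZero.ne N)
  let φ : ℝ → ℂ := fun μ => f (((μ : ℂ), m), x₁)
  have hφc : Continuous φ := (hf.differentiable_fst m x₁).continuous.comp Complex.continuous_ofReal
  have hF : ∀ ξ : ℝ, FourierTransform.fourier φ ξ
      = fourierSlice m f ((((ξ * N : ℝ) : ℂ), n), x₁) := by
    intro ξ
    rw [Real.fourier_real_eq_integral_exp_smul]
    simp only [fourierSlice, smul_eq_mul, φ]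
    congr 1
    funext μ
    congr 2
    push_cast
    field_simp
  have hFi : Integrable (FourierTransform.fourier φ) := by
    rw [funext hF]
    exact ((hf.fourierSlice m).integrable_fst n x₁).comp_mul_right' hN.ne'
  have h := congrFun (hφc.fourierInv_fourier_eq (hf.integrable_fst m x₁) hFi) u
  rw [Real.fourierInv_eq_fourier_neg, Real.fourier_real_eq_integral_exp_smul] at h
  simp only [hF, smul_eq_mul] at h
  change _ = f (((u : ℂ), m), x₁) at h
  rw [← h]
  have hs := Measure.integral_comp_mul_right (fun ν : ℝ =>
    Complex.exp (-(2 * Real.pi * Complex.I / N) * (ν * (-u : ℂ)))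
      * fourierSlice m f (((ν : ℂ), n), x₁)) (N : ℝ)
  have hs' : (N : ℂ) * ∫ ξ : ℝ, Complex.exp (-(2 * Real.pi * Complex.I / N) *
      (((ξ * N : ℝ) : ℂ) * (-u : ℂ))) * fourierSlice m f ((((ξ * N : ℝ) : ℂ), n), x₁)
      = ∫ ν : ℝ, Complex.exp (-(2 * Real.pi * Complex.I / N) * (ν * (-u : ℂ)))
      * fourierSlice m f (((ν : ℂ), n), x₁) := by
    rw [hs, abs_of_pos (inv_pos.2 hN), Complex.real_smul]
    push_cast
    rw [mul_inv_cancel_left₀ hNC]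
  rw [← hs']
  congr 2
  funext ξ
  congr 2
  push_cast
  field_simp

/-- The two prefactors $1/N$ cancel against the $N$ from inversion on the line and the $N$ from
orthogonality of the characters of $\mathbb Z/N$. -/
theorem reflect_fourier2_fourier2 {f : Fun2 N} (hf : IsRapid f) :
    reflect (fourier2 (fourier2 f)) = f := by
  have hNC : (N : ℂ) ≠ 0 := Nat.cast_ne_zero.2 (NeZero.ne N)
  funext x
  obtain ⟨⟨z, k⟩, x₁⟩ := x
  refine congrFun (differentiable_eq_of_eq_real
    (f := fun z => reflect (fourier2 (fourier2 f)) ((z, k), x₁)) (g := fun z => f ((z, k), x₁))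
    (hf.fourier2.fourier2.reflect.differentiable_fst k x₁) (hf.differentiable_fst k x₁)
    fun u => ?_) z
  have h1 : ∀ n : ZMod N, fourierSlice n (fourier2 f) ((-(u : ℂ), -k), x₁)
      = ∑ m : ZMod N, ZMod.stdAddChar (m * n) * f (((u : ℂ), m), x₁) := by
    intro n
    have hi : ∀ m : ZMod N, Integrable fun ν : ℝ => Complex.exp (-(2 * Real.pi * Complex.I / N) *
        (ν * (-u : ℂ))) * fourierSlice m f (((ν : ℂ), n), x₁) := by
      intro m
      have := ((isExpBdd_exp_fst (-(2 * Real.pi * Complex.I / N) * (-u : ℂ))).mul_isRapid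
        (hf.fourierSlice m)).integrable_fst n x₁
      refine this.congr (Filter.Eventually.of_forall fun ν => ?_)
      simp only
      congr 2
      ring
    calc fourierSlice n (fourier2 f) ((-(u : ℂ), -k), x₁)
        = ∫ ν : ℝ, ∑ m : ZMod N, (1 / (N : ℂ) * ZMod.stdAddChar (m * n)) *
          (Complex.exp (-(2 * Real.pi * Complex.I / N) * (ν * (-u : ℂ))) *
            fourierSlice m f (((ν : ℂ), n), x₁)) := by
          rw [fourierSlice]
          congr 1
          funext ν
          simp only [fourier2, Finset.mul_sum]
          refine Finset.sum_congr rfl fun m _ => ?_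
          ring
      _ = ∑ m : ZMod N, (1 / (N : ℂ) * ZMod.stdAddChar (m * n)) * (N * f (((u : ℂ), m), x₁)) := by
          rw [integral_finsetSum _ fun m _ => (hi m).const_mul _]
          refine Finset.sum_congr rfl fun m _ => ?_
          rw [integral_const_mul, integral_fourierSlice hf]
      _ = _ := by
          refine Finset.sum_congr rfl fun m _ => ?_
          field_simp
  change 1 / (N : ℂ) * ∑ n : ZMod N, ZMod.stdAddChar (n * -k) *
    fourierSlice n (fourier2 f) ((-(u : ℂ), -k), x₁) = _
  simp only [h1, Finset.mul_sum]
  rw [Finset.sum_comm]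
  have h2 : ∀ m : ZMod N, ∑ n : ZMod N, 1 / (N : ℂ) * (ZMod.stdAddChar (n * -k) *
      (ZMod.stdAddChar (m * n) * f (((u : ℂ), m), x₁)))
      = if m = k then f (((u : ℂ), m), x₁) else 0 := by
    intro m
    have h3 := AddChar.sum_mulShift (R := ZMod N) (R' := ℂ) (m - k)
      (ZMod.isPrimitive_stdAddChar N)
    have h4 : ∑ n : ZMod N, 1 / (N : ℂ) * (ZMod.stdAddChar (n * -k) *
      (ZMod.stdAddChar (m * n) * f (((u : ℂ), m), x₁)))
      = (∑ n : ZMod N, (ZMod.stdAddChar (n * (m - k)) : ℂ)) * (1 / (N : ℂ) *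
        f (((u : ℂ), m), x₁)) := by
      rw [Finset.sum_mul]
      refine Finset.sum_congr rfl fun n _ => ?_
      rw [show n * (m - k) = n * -k + m * n by ring, AddChar.map_add_eq_mul]
      ring
    rw [h4, h3]
    simp only [sub_eq_zero, ZMod.card]
    split_ifs with h
    · field_simp
    · simp
  rw [Finset.sum_congr rfl fun m _ => h2 m]
  simp

theorem fourier2_reflect_fourier2 {f : Fun2 N} (hf : IsRapid f) :
    fourier2 (reflect (fourier2 f)) = f := by
  rw [fourier2_reflect, reflect_fourier2_fourier2 hf]

end Fourier

/-! ### Plancherel formula for the partial Fourier transform -/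

section FourierUnitary

variable {N : ℕ} [NeZero N]

theorem restrict_starFun_mul (f g : Fun2 N) :
    restrict (fun x => starFun f x * g x)
      = fun x => starRingEnd ℂ (restrict f x) * restrict g x := by
  funext x
  simp [restrict, starFun]

theorem inner_toH2_eq_sum {f g : Fun2 N} (hf : IsRapid f) (hg : IsRapid g) :
    inner ℂ (toH2 f) (toH2 g) = ∑ m₁, ∑ m₂, ∫ x₁ : ℝ, ∫ x₂ : ℝ,
      starRingEnd ℂ (f (((x₂ : ℂ), m₂), ((x₁ : ℂ), m₁))) *
        g (((x₂ : ℂ), m₂), ((x₁ : ℂ), m₁)) := by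
  rw [inner_toH2 hf hg, ← restrict_starFun_mul, (hf.starFun.mul hg).isDec.integral_eq_swap,
    restrict_starFun_mul, Finset.sum_comm]
  rfl

/-- Fubini for the double integral against the bounded kernel. The residue `k` is arbitrary since
`fourierSlice` ignores it. -/
theorem integral_conj_fourierSlice_mul {f g : Fun2 N} (hf : IsRapid f) (hg : IsRapid g)
    (m n k : ZMod N) (x₁ : ℂ × ZMod N) :
    ∫ ν : ℝ, starRingEnd ℂ (fourierSlice m f (((ν : ℂ), n), x₁)) * g (((ν : ℂ), n), x₁)
      = ∫ μ : ℝ, starRingEnd ℂ (f (((μ : ℂ), m), x₁)) *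
        fourierSlice n g ((-(μ : ℂ), k), x₁) := by
  have hfi : Integrable fun μ : ℝ => starRingEnd ℂ (f (((μ : ℂ), m), x₁)) :=
    (Complex.conjCLE : ℂ →L[ℝ] ℂ).integrable_comp (hf.integrable_fst m x₁)
  have hgi := hg.integrable_fst n x₁
  have hint : Integrable (Function.uncurry fun (ν μ : ℝ) =>
      Complex.exp (2 * Real.pi * Complex.I / N * (μ * ν)) *
        (g (((ν : ℂ), n), x₁) * starRingEnd ℂ (f (((μ : ℂ), m), x₁))))
      ((volume : Measure ℝ).prod volume) := by
    refine (hgi.mul_prod hfi).bdd_mul (c := 1) (by fun_prop)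
      (Filter.Eventually.of_forall fun p => ?_)
    have : 2 * Real.pi * Complex.I / N * ((p.2 : ℂ) * p.1)
        = ((2 * Real.pi / N * (p.2 * p.1) : ℝ) : ℂ) * Complex.I := by push_cast; ring
    rw [this, Complex.norm_exp_ofReal_mul_I]
  have hL : ∀ ν : ℝ, starRingEnd ℂ (fourierSlice m f (((ν : ℂ), n), x₁)) * g (((ν : ℂ), n), x₁)
      = ∫ μ : ℝ, Complex.exp (2 * Real.pi * Complex.I / N * (μ * ν)) *
        (g (((ν : ℂ), n), x₁) * starRingEnd ℂ (f (((μ : ℂ), m), x₁))) := by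
    intro ν
    rw [fourierSlice, ← integral_conj, ← integral_mul_const]
    congr 1
    funext μ
    rw [map_mul, ← Complex.exp_conj]
    simp only [map_mul, map_neg, map_div₀, map_ofNat, Complex.conj_ofReal, Complex.conj_I,
      map_natCast]
    ring_nf
  have hR : ∀ μ : ℝ, starRingEnd ℂ (f (((μ : ℂ), m), x₁)) * fourierSlice n g ((-(μ : ℂ), k), x₁)
      = ∫ ν : ℝ, Complex.exp (2 * Real.pi * Complex.I / N * (μ * ν)) *
        (g (((ν : ℂ), n), x₁) * starRingEnd ℂ (f (((μ : ℂ), m), x₁))) := by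
    intro μ
    rw [fourierSlice, ← integral_const_mul]
    congr 1
    funext ν
    ring_nf
  simp only [hL, hR]
  exact integral_integral_swap hint

theorem integrable_conj_mul_fst {f g : Fun2 N} (hf : IsRapid f) (hg : IsRapid g) (m : ZMod N)
    (u : ℝ) (m₁ : ZMod N) :
    Integrable fun x : ℝ => starRingEnd ℂ (f (((x : ℂ), m), ((u : ℂ), m₁)))
      * g (((x : ℂ), m), ((u : ℂ), m₁)) := by
  refine ((hf.starFun.mul hg).integrable_fst m ((u : ℂ), m₁)).congr
    (Filter.Eventually.of_forall fun x => ?_)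
  simp [starFun]

theorem integrable_integral_conj_mul {f g : Fun2 N} (hf : IsRapid f) (hg : IsRapid g)
    (m₂ m₁ : ZMod N) :
    Integrable fun x₁ : ℝ => ∫ x₂ : ℝ, starRingEnd ℂ (f (((x₂ : ℂ), m₂), ((x₁ : ℂ), m₁)))
      * g (((x₂ : ℂ), m₂), ((x₁ : ℂ), m₁)) := by
  have h := ((hf.starFun.mul hg).isDec.integrable_slice m₂ m₁).integral_prod_right
  rw [restrict_starFun_mul] at h
  exact h

theorem inner_fourier2 {f g : Fun2 N} (hf : IsRapid f) (hg : IsRapid g) :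
    inner ℂ (toH2 (fourier2 f)) (toH2 g) = inner ℂ (toH2 f) (toH2 (reflect (fourier2 g))) := by
  have hFg := hg.fourier2.reflect
  rw [inner_toH2_eq_sum hf.fourier2 hg, inner_toH2_eq_sum hf hFg]
  refine Finset.sum_congr rfl fun m₁ _ => ?_
  rw [← integral_finsetSum _ fun m₂ _ => integrable_integral_conj_mul hf.fourier2 hg m₂ m₁,
    ← integral_finsetSum _ fun m₂ _ => integrable_integral_conj_mul hf hFg m₂ m₁]
  congr 1
  funext u
  have hL : ∀ n : ZMod N, ∫ ν : ℝ, starRingEnd ℂ (fourier2 f (((ν : ℂ), n), ((u : ℂ), m₁)))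
      * g (((ν : ℂ), n), ((u : ℂ), m₁))
      = ∑ m : ZMod N, 1 / (N : ℂ) * ZMod.stdAddChar (-(m * n)) *
        ∫ ν : ℝ, starRingEnd ℂ (fourierSlice m f (((ν : ℂ), n), ((u : ℂ), m₁)))
          * g (((ν : ℂ), n), ((u : ℂ), m₁)) := by
    intro n
    simp only [← integral_const_mul]
    rw [← integral_finsetSum _ fun m _ =>
      (integrable_conj_mul_fst (hf.fourierSlice m) hg n u m₁).const_mul _]
    congr 1
    funext ν
    simp only [fourier2, map_mul, map_sum, map_div₀, map_one, map_natCast, conj_stdAddChar,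
      Finset.mul_sum, Finset.sum_mul]
    refine Finset.sum_congr rfl fun m _ => ?_
    ring
  have hR : ∀ m : ZMod N, ∫ μ : ℝ, starRingEnd ℂ (f (((μ : ℂ), m), ((u : ℂ), m₁)))
      * reflect (fourier2 g) (((μ : ℂ), m), ((u : ℂ), m₁))
      = ∑ n : ZMod N, 1 / (N : ℂ) * ZMod.stdAddChar (-(m * n)) *
        ∫ μ : ℝ, starRingEnd ℂ (f (((μ : ℂ), m), ((u : ℂ), m₁)))
          * fourierSlice n g ((-(μ : ℂ), -m), ((u : ℂ), m₁)) := by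
    intro m
    simp only [← integral_const_mul]
    rw [← integral_finsetSum]
    swap
    · exact fun n _ => (integrable_conj_mul_fst hf (hg.fourierSlice n).reflect m u m₁).const_mul _
    congr 1
    funext ν
    simp only [fourier2, reflect, Finset.mul_sum]
    refine Finset.sum_congr rfl fun n _ => ?_
    rw [show n * -m = -(m * n) by ring]
    ring
  simp only [hL, hR]
  rw [Finset.sum_comm]
  refine Finset.sum_congr rfl fun m _ => Finset.sum_congr rfl fun n _ => ?_
  rw [integral_conj_fourierSlice_mul hf hg m n (-m)]

/-- The adjoint found in `inner_fourier2` is also the inverse. -/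
theorem norm_toH2_fourier2 {f : Fun2 N} (hf : IsRapid f) : ‖toH2 (fourier2 f)‖ = ‖toH2 f‖ := by
  have h := inner_fourier2 hf hf.fourier2
  rw [reflect_fourier2_fourier2 hf, inner_self_eq_norm_sq_to_K, inner_self_eq_norm_sq_to_K] at h
  have h' : ‖toH2 (fourier2 f)‖ ^ 2 = ‖toH2 f‖ ^ 2 := by exact_mod_cast h
  exact (sq_eq_sq₀ (norm_nonneg _) (norm_nonneg _)).1 h'

theorem norm_toH2_reflect_fourier2 {f : Fun2 N} (hf : IsRapid f) :
    ‖toH2 (reflect (fourier2 f))‖ = ‖toH2 f‖ := by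
  rw [← norm_toH2_fourier2 hf.fourier2.reflect, fourier2_reflect_fourier2 hf]

theorem norm_toH2_congr {f g : Fun2 N} (hf : IsRapid f) (hg : IsRapid g)
    (h : ∀ x, ‖restrict f x‖ = ‖restrict g x‖) : ‖toH2 f‖ = ‖toH2 g‖ := by
  rw [toH2, dif_pos hf.memLp, toH2, dif_pos hg.memLp, Lp.norm_toLp, Lp.norm_toLp,
    eLpNorm_congr_norm_ae (Filter.Eventually.of_forall h)]

/-! ### Fourier transform and Weyl operators -/

/-- The Fourier transform rotates the exponents: translations become multiplications and conversely.
The translation is undone by moving the line of integration by $-ia_2\beta$ and the summation index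
by $\varepsilon a_2$. The symmetric normalisation of `weyl2` leaves no scalar. -/
theorem fourier2_weyl2 {f : Fun2 N} (hf : IsRapid f) (β : ℂ) {ε : ℤ} (hε : ε * ε = 1)
    (a₂ k₂ a₁ k₁ : ℤ) :
    fourier2 (weyl2 N β ε a₂ k₂ a₁ k₁ f) = weyl2 N β ε k₂ (-a₂) a₁ k₁ (fourier2 f) := by
  have hq := bq_ne_zero N β
  funext x
  have hslice : ∀ m : ZMod N,
      fourierSlice (m + ((ε * a₂ : ℤ) : ZMod N)) (weyl2 N β ε a₂ k₂ a₁ k₁ f) x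
      = bq N β ^ (a₁ * k₁ - a₂ * k₂) * yGen β ε x.2 ^ k₁ * Complex.exp (-(2 * Real.pi / N * β *
        x.1.1) * a₂) * ZMod.stdAddChar (-((ε : ZMod N) * m * (k₂ : ZMod N))) *
        fourierSlice m f ((x.1.1 + k₂ * (Complex.I * β), x.1.2 - ((ε * k₂ : ℤ) : ZMod N)),
          (x.2.1 + a₁ * (Complex.I * β), x.2.2 - ((ε * a₁ : ℤ) : ZMod N))) := by
    intro m
    rw [fourierSlice_shift (hf.weyl2 β ε a₂ k₂ a₁ k₁) _ (((-a₂ : ℤ) : ℂ) * (Complex.I * β)),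
      fourierSlice, ← integral_const_mul]
    congr 1
    funext μ
    have hsh := yGen_shift (N := N) β hε (-a₂) ((μ : ℂ), m)
    rw [show m - ((ε * -a₂ : ℤ) : ZMod N) = m + ((ε * a₂ : ℤ) : ZMod N) by push_cast; ring] at hsh
    simp only at hsh
    rw [weyl2_apply]
    simp only
    rw [hsh, add_sub_cancel_right, add_assoc (μ : ℂ),
      show ((-a₂ : ℤ) : ℂ) * (Complex.I * β) + (a₂ : ℂ) * (Complex.I * β) = 0 by push_cast; ring,
      add_zero]
    have h1 : bq N β ^ (a₂ * k₂ + a₁ * k₁) * bq N β ^ (2 * -a₂ * k₂)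
        = bq N β ^ (a₁ * k₁ - a₂ * k₂) := by
      rw [← zpow_add₀ hq]; congr 1; ring
    have h2 : yGen β ε ((μ : ℂ), m) ^ k₂ = Complex.exp (k₂ * (2 * Real.pi / N * β * μ)) *
        ZMod.stdAddChar (-((ε : ZMod N) * m * (k₂ : ZMod N))) := by
      rw [yGen, mul_zpow, Complex.exp_int_mul, ← AddChar.map_zsmul_eq_zpow, zsmul_eq_mul]
      congr 2
      ring
    have h3 : Complex.exp (-(2 * Real.pi * Complex.I / N) * ((μ + ((-a₂ : ℤ) : ℂ) *
        (Complex.I * β)) * x.1.1)) * Complex.exp (k₂ * (2 * Real.pi / N * β * μ))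
        = Complex.exp (-(2 * Real.pi / N * β * x.1.1) * a₂) *
          Complex.exp (-(2 * Real.pi * Complex.I / N) * (μ * (x.1.1 + k₂ * (Complex.I * β)))) := by
      rw [← Complex.exp_add, ← Complex.exp_add]
      congr 1
      push_cast
      linear_combination (2 * Real.pi / N * (a₂ * β * x.1.1 + k₂ * μ * β)) * Complex.I_sq
    rw [mul_zpow, ← zpow_mul, h2, ← h1]
    linear_combination (bq N β ^ (a₂ * k₂ + a₁ * k₁) * bq N β ^ (2 * -a₂ * k₂) *
      yGen β ε x.2 ^ k₁ * ZMod.stdAddChar (-((ε : ZMod N) * m * (k₂ : ZMod N))) *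
      f (((μ : ℂ), m), (x.2.1 + a₁ * (Complex.I * β), x.2.2 - ((ε * a₁ : ℤ) : ZMod N)))) * h3
  rw [weyl2_apply]
  simp only [fourier2]
  rw [← Equiv.sum_comp (Equiv.addRight ((ε * a₂ : ℤ) : ZMod N))]
  simp only [Equiv.coe_addRight, hslice, Finset.mul_sum]
  refine Finset.sum_congr rfl fun m _ => ?_
  have hy : yGen β ε x.1 ^ (-a₂) = Complex.exp (-(2 * Real.pi / N * β * x.1.1) * a₂) *
      ZMod.stdAddChar ((ε : ZMod N) * (a₂ : ZMod N) * x.1.2) := by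
    rw [yGen, mul_zpow, ← Complex.exp_int_mul, ← AddChar.map_zsmul_eq_zpow, zsmul_eq_mul]
    congr 2
    · push_cast; ring
    · push_cast; ring
  have hχ : (ZMod.stdAddChar ((m + ((ε * a₂ : ℤ) : ZMod N)) * x.1.2) : ℂ) *
      ZMod.stdAddChar (-((ε : ZMod N) * m * (k₂ : ZMod N))) = ZMod.stdAddChar ((ε : ZMod N) * (a₂ : ZMod N) * x.1.2) *
      ZMod.stdAddChar (m * (x.1.2 - ((ε * k₂ : ℤ) : ZMod N))) := by
    rw [← AddChar.map_add_eq_mul, ← AddChar.map_add_eq_mul]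
    congr 1
    push_cast
    ring
  rw [hy, show k₂ * -a₂ + a₁ * k₁ = a₁ * k₁ - a₂ * k₂ by ring]
  linear_combination (1 / (N : ℂ) * bq N β ^ (a₁ * k₁ - a₂ * k₂) * yGen β ε x.2 ^ k₁ *
    Complex.exp (-(2 * Real.pi / N * β * x.1.1) * a₂) *
    fourierSlice m f ((x.1.1 + k₂ * (Complex.I * β), x.1.2 - ((ε * k₂ : ℤ) : ZMod N)),
      (x.2.1 + a₁ * (Complex.I * β), x.2.2 - ((ε * a₁ : ℤ) : ZMod N)))) * hχ

/-- The inverse transform performs the inverse rotation; deduced by applying `fourier2_weyl2` to the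
preimage. -/
theorem reflect_fourier2_weyl2 {f : Fun2 N} (hf : IsRapid f) (β : ℂ) {ε : ℤ} (hε : ε * ε = 1)
    (a₂ k₂ a₁ k₁ : ℤ) :
    reflect (fourier2 (weyl2 N β ε a₂ k₂ a₁ k₁ f))
      = weyl2 N β ε (-k₂) a₂ a₁ k₁ (reflect (fourier2 f)) := by
  have h := fourier2_weyl2 hf.fourier2.reflect β hε (-k₂) a₂ a₁ k₁
  rw [fourier2_reflect_fourier2 hf, neg_neg] at h
  rw [← h, reflect_fourier2_fourier2 (hf.fourier2.reflect.weyl2 _ _ _ _ _ _)]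

end FourierUnitary

/-! ### The Weil operator on rapidly decreasing functions -/

section Weil

variable {N : ℕ} [NeZero N]

/-- `(-1)^{n²} e^{-(πi/N) n²}`. -/
def discChirp (n : ZMod N) : ℂ :=
  (-1) ^ (n.val ^ 2) * Complex.exp (-(Real.pi * Complex.I / N) * n.val ^ 2)

/-- Independence of the representative. Replacing $r$ by $r+Nj$ changes the exponent $\pi i
r^2(N-1)/N$ by $\pi i(2rj(N-1)+N(N-1)j^2)$, a multiple of $2\pi i$ because $N(N-1)$ is even; the
sign $(-1)^{n^2}$ is there for this. -/
theorem discChirp_intCast (k : ℤ) :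
    discChirp (k : ZMod N)
      = Complex.exp (Real.pi * Complex.I * k ^ 2 - Real.pi * Complex.I / N * k ^ 2) := by
  have hNC : (N : ℂ) ≠ 0 := Nat.cast_ne_zero.2 (NeZero.ne N)
  obtain ⟨j, hj⟩ : ∃ j : ℤ, k = ((k : ZMod N).val : ℤ) + N * j := by
    rw [ZMod.val_intCast]
    exact ⟨k / N, (Int.emod_add_mul_ediv k N).symm⟩
  set r : ℕ := (k : ZMod N).val
  rw [discChirp, ← Complex.exp_pi_mul_I, ← Complex.exp_nat_mul, ← Complex.exp_add,
    Complex.exp_eq_exp_iff_exists_int]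
  obtain ⟨t, ht⟩ := Int.even_mul_pred_self (N : ℤ)
  refine ⟨-(j * r * (N - 1) + t * j ^ 2), ?_⟩
  have ht' : (N : ℂ) * (N - 1) = t + t := by exact_mod_cast congrArg (Int.cast (R := ℂ)) ht
  have hk : (k : ℂ) = r + N * j := by exact_mod_cast congrArg (Int.cast (R := ℂ)) hj
  change ((r ^ 2 : ℕ) : ℂ) * (Real.pi * Complex.I) + -(Real.pi * Complex.I / N) * r ^ 2 = _
  rw [hk]
  push_cast
  field_simp
  linear_combination (-(N * j ^ 2)) * ht'

theorem norm_discChirp (n : ZMod N) : ‖discChirp n‖ = 1 := by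
  have h : -(Real.pi * Complex.I / N) * (n.val : ℂ) ^ 2
      = ((-(Real.pi / N * n.val ^ 2) : ℝ) : ℂ) * Complex.I := by push_cast; ring
  rw [discChirp, norm_mul, h, Complex.norm_exp_ofReal_mul_I, norm_pow, norm_neg, norm_one, one_pow,
    one_mul]

/-- `(-1)^{n²} e^{(πi/N)(ν² - n²)}`. -/
def chirp (x : (ℂ × ZMod N) × (ℂ × ZMod N)) : ℂ :=
  discChirp x.1.2 * Complex.exp (Real.pi * Complex.I / N * x.1.1 ^ 2)

theorem chirp_ne_zero (x : (ℂ × ZMod N) × (ℂ × ZMod N)) : chirp x ≠ 0 :=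
  mul_ne_zero (norm_ne_zero_iff.1 (by rw [norm_discChirp]; exact one_ne_zero))
    (Complex.exp_ne_zero _)

theorem norm_restrict_chirp (x : (ℝ × ZMod N) × (ℝ × ZMod N)) : ‖restrict chirp x‖ = 1 := by
  have h : Real.pi * Complex.I / N * (x.1.1 : ℂ) ^ 2
      = ((Real.pi / N * x.1.1 ^ 2 : ℝ) : ℂ) * Complex.I := by push_cast; ring
  simp only [restrict, chirp]
  rw [norm_mul, h, Complex.norm_exp_ofReal_mul_I, norm_discChirp, one_mul]

/-- The modulus of $e^{irz^2}$ is $e^{-2r\,\mathrm{Re}z\,\mathrm{Im}z}$, so an imaginary Gaussian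
grows only exponentially in strips. -/
theorem isExpBdd_exp_sq (r : ℝ) (c : ZMod N → ℂ) :
    IsExpBdd fun x : (ℂ × ZMod N) × (ℂ × ZMod N) =>
      c x.1.2 * Complex.exp (r * Complex.I * x.1.1 ^ 2) := by
  refine ⟨fun m₂ m₁ => ?_, fun R => ⟨∑ m, ‖c m‖, 2 * |r| * R, fun x h₂ h₁ => ?_⟩⟩
  · exact (differentiable_const (c m₂)).mul (by dsimp only; fun_prop)
  have hR : 0 ≤ R := (abs_nonneg _).trans h₂
  have hre : ((r : ℂ) * Complex.I * x.1.1 ^ 2).re = -(2 * r * (x.1.1.re * x.1.1.im)) := by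
    rw [mul_assoc, Complex.re_ofReal_mul]
    simp [pow_two]
    ring
  rw [norm_mul, Complex.norm_exp, hre]
  refine mul_le_mul (Finset.single_le_sum (f := fun m => ‖c m‖) (fun _ _ => norm_nonneg _)
    (Finset.mem_univ x.1.2)) (Real.exp_le_exp.2 ?_) (Real.exp_nonneg _)
    (Finset.sum_nonneg fun _ _ => norm_nonneg _)
  refine (neg_le_abs _).trans ?_
  rw [abs_mul, abs_mul, abs_mul, abs_two]
  have h3 : |x.1.1.re| * |x.1.1.im| ≤ (|x.1.1.re| + |x.2.1.re|) * R :=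
    mul_le_mul (by linarith [abs_nonneg x.2.1.re]) h₂ (abs_nonneg _) (by positivity)
  calc 2 * |r| * (|x.1.1.re| * |x.1.1.im|) ≤ 2 * |r| * ((|x.1.1.re| + |x.2.1.re|) * R) := by
        gcongr
    _ = _ := by ring

theorem isExpBdd_chirp : IsExpBdd (chirp : Fun2 N) := by
  refine (congrArg IsExpBdd (funext fun x => ?_)).mp
    (isExpBdd_exp_sq (Real.pi / N) (discChirp : ZMod N → ℂ))
  rw [chirp]
  congr 2
  push_cast
  ring

theorem isExpBdd_chirp_inv : IsExpBdd (fun x => (chirp x)⁻¹ : Fun2 N) := by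
  refine (congrArg IsExpBdd (funext fun x => ?_)).mp
    (isExpBdd_exp_sq (-(Real.pi / N)) (fun n : ZMod N => (discChirp n)⁻¹))
  rw [chirp, mul_inv, ← Complex.exp_neg]
  congr 2
  push_cast
  ring

/-- The cross term of the square is a power of $y$ and the pure square a power of $\mathbf q$; the
sign is $(-1)^a$ because $a^2\equiv a$ modulo 2. The points `x₁`, `x₁'` are unrelated since the
chirp depends on the first factor only. -/
theorem chirp_shift (β : ℂ) {ε : ℤ} (hε : ε * ε = 1) (a : ℤ) (x : ℂ × ZMod N)
    (x₁ x₁' : ℂ × ZMod N) :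
    chirp ((x.1 + a * (Complex.I * β), x.2 - ((ε * a : ℤ) : ZMod N)), x₁')
      = (-1) ^ a * bq N β ^ (-(a * a)) * yGen β ε x ^ (-a) * chirp (x, x₁) := by
  obtain ⟨z, n⟩ := x
  obtain ⟨v, rfl⟩ : ∃ v : ℤ, n = (v : ZMod N) := ⟨n.val, by simp⟩
  have hsub : ((v : ZMod N) - ((ε * a : ℤ) : ZMod N)) = ((v - ε * a : ℤ) : ZMod N) := by push_cast; ring
  simp only [chirp]
  rw [hsub, discChirp_intCast, discChirp_intCast, yGen, mul_zpow, ← Complex.exp_int_mul,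
    ← AddChar.map_zsmul_eq_zpow, bq_zpow, zsmul_eq_mul,
    show ((-a : ℤ) : ZMod N) * -((ε : ZMod N) * (v : ZMod N)) = ((a * ε * v : ℤ) : ZMod N) by
      push_cast; ring, stdAddChar_intCast_eq_exp, ← Complex.exp_pi_mul_I, ← Complex.exp_int_mul]
  simp only [← Complex.exp_add]
  rw [Complex.exp_eq_exp_iff_exists_int]
  obtain ⟨t, ht⟩ := Int.even_mul_pred_self a
  refine ⟨t - ε * a * v, ?_⟩
  have ht' : (a : ℂ) * (a - 1) = t + t := by exact_mod_cast congrArg (Int.cast (R := ℂ)) ht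
  have hε' : (ε : ℂ) * ε = 1 := by exact_mod_cast congrArg (Int.cast (R := ℂ)) hε
  have hNC : (N : ℂ) ≠ 0 := Nat.cast_ne_zero.2 (NeZero.ne N)
  push_cast
  linear_combination (Real.pi * Complex.I) * ht' + (Real.pi * Complex.I * a ^ 2
    - Real.pi * Complex.I / N * a ^ 2) * hε' + (Real.pi * Complex.I / N * a ^ 2 * β ^ 2
    + 2 * Real.pi / N * a * β * z) * Complex.I_sq

theorem chirp_mul_weyl2 (β : ℂ) {ε : ℤ} (hε : ε * ε = 1) (a₂ k₂ a₁ k₁ : ℤ) (f : Fun2 N) :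
    (fun x => chirp x * weyl2 N β ε a₂ k₂ a₁ k₁ f x)
      = ((-1 : ℂ) ^ a₂) • weyl2 N β ε a₂ (k₂ + a₂) a₁ k₁ (fun x => chirp x * f x) := by
  funext x
  have hq := bq_ne_zero N β
  rw [Pi.smul_apply, weyl2_apply, weyl2_apply, chirp_shift β hε a₂ x.1 x.2, smul_eq_mul,
    zpow_add₀ (yGen_ne_zero β ε x.1), zpow_neg, zpow_neg,
    show a₂ * (k₂ + a₂) + a₁ * k₁ = a₂ * k₂ + a₁ * k₁ + a₂ * a₂ by ring,
    zpow_add₀ hq (a₂ * k₂ + a₁ * k₁)]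
  have h1 : bq N β ^ (a₂ * a₂) * (bq N β ^ (a₂ * a₂))⁻¹ = 1 := mul_inv_cancel₀ (zpow_ne_zero _ hq)
  have h2 : yGen β ε x.1 ^ a₂ * (yGen β ε x.1 ^ a₂)⁻¹ = 1 :=
    mul_inv_cancel₀ (zpow_ne_zero _ (yGen_ne_zero β ε x.1))
  have h3 : ((-1 : ℂ) ^ a₂) * (-1) ^ a₂ = 1 := by
    rw [← mul_zpow]; simp
  simp only [Prod.mk.eta]
  generalize f _ = F
  generalize (bq N β ^ (a₂ * a₂))⁻¹ = Q' at *
  generalize (yGen β ε x.1 ^ a₂)⁻¹ = Y' at *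
  generalize ((-1 : ℂ) ^ a₂) = s at *
  linear_combination (-(chirp x * bq N β ^ (a₂ * k₂ + a₁ * k₁) * yGen β ε x.1 ^ k₂ *
    yGen β ε x.2 ^ k₁ * F)) * ((s * s * (yGen β ε x.1 ^ a₂ * Y')) * h1 + s * s * h2 + h3)

/-- `𝒱₂` on functions. -/
def weilOp (f : Fun2 N) : Fun2 N := reflect (fourier2 fun x => chirp x * fourier2 f x)

/-- The inverse of `𝒱₂` on functions. -/
def weilInv (f : Fun2 N) : Fun2 N := reflect (fourier2 fun x => (chirp x)⁻¹ * fourier2 f x)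

theorem IsRapid.weilOp {f : Fun2 N} (hf : IsRapid f) : IsRapid (weilOp f) :=
  (isExpBdd_chirp.mul_isRapid hf.fourier2).fourier2.reflect

theorem IsRapid.weilInv {f : Fun2 N} (hf : IsRapid f) : IsRapid (weilInv f) :=
  (isExpBdd_chirp_inv.mul_isRapid hf.fourier2).fourier2.reflect

theorem weilInv_weilOp {f : Fun2 N} (hf : IsRapid f) : weilInv (weilOp f) = f := by
  rw [weilInv, weilOp, fourier2_reflect_fourier2 (isExpBdd_chirp.mul_isRapid hf.fourier2)]
  simp only [inv_mul_cancel_left₀ (chirp_ne_zero _)]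
  exact reflect_fourier2_fourier2 hf

theorem weilOp_weilInv {f : Fun2 N} (hf : IsRapid f) : weilOp (weilInv f) = f := by
  rw [weilInv, weilOp, fourier2_reflect_fourier2 (isExpBdd_chirp_inv.mul_isRapid hf.fourier2)]
  simp only [mul_inv_cancel_left₀ (chirp_ne_zero _)]
  exact reflect_fourier2_fourier2 hf

theorem fourierSlice_add {f g : Fun2 N} (hf : IsRapid f) (hg : IsRapid g) (m : ZMod N) :
    fourierSlice m (f + g) = fourierSlice m f + fourierSlice m g := by
  have hi : ∀ {h : Fun2 N}, IsRapid h → ∀ x : (ℂ × ZMod N) × (ℂ × ZMod N), Integrable fun μ : ℝ =>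
      Complex.exp (-(2 * Real.pi * Complex.I / N) * (μ * x.1.1)) * h (((μ : ℂ), m), x.2) := by
    intro h hh x
    refine (((isExpBdd_exp_fst (-(2 * Real.pi * Complex.I / N) * x.1.1)).mul_isRapid
      hh).integrable_fst m x.2).congr (Filter.Eventually.of_forall fun μ => ?_)
    simp only
    congr 2
    ring
  funext x
  simp only [fourierSlice, Pi.add_apply, mul_add]
  exact integral_add (hi hf x) (hi hg x)

theorem fourierSlice_smul (c : ℂ) (f : Fun2 N) (m : ZMod N) :
    fourierSlice m (c • f) = c • fourierSlice m f := by
  funext x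
  simp only [fourierSlice, Pi.smul_apply, smul_eq_mul, ← integral_const_mul]
  congr 1
  funext μ
  ring

theorem fourier2_add {f g : Fun2 N} (hf : IsRapid f) (hg : IsRapid g) :
    fourier2 (f + g) = fourier2 f + fourier2 g := by
  funext x
  simp only [fourier2, fourierSlice_add hf hg, Pi.add_apply, mul_add, Finset.sum_add_distrib]

theorem fourier2_smul (c : ℂ) (f : Fun2 N) : fourier2 (c • f) = c • fourier2 f := by
  funext x
  simp only [fourier2, fourierSlice_smul, Pi.smul_apply, smul_eq_mul, Finset.mul_sum]
  refine Finset.sum_congr rfl fun m _ => ?_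
  ring

theorem reflect_smul (c : ℂ) (f : Fun2 N) : reflect (c • f) = c • reflect f := rfl

theorem weilOp_add {f g : Fun2 N} (hf : IsRapid f) (hg : IsRapid g) :
    weilOp (f + g) = weilOp f + weilOp g := by
  have h : (fun x => chirp x * fourier2 (f + g) x)
      = (fun x => chirp x * fourier2 f x) + fun x => chirp x * fourier2 g x := by
    funext x
    simp [fourier2_add hf hg, mul_add]
  rw [weilOp, h, fourier2_add (isExpBdd_chirp.mul_isRapid hf.fourier2)
    (isExpBdd_chirp.mul_isRapid hg.fourier2)]
  rfl

theorem weilOp_smul (c : ℂ) (f : Fun2 N) : weilOp (c • f) = c • weilOp f := by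
  have h : (fun x => chirp x * fourier2 (c • f) x) = c • fun x => chirp x * fourier2 f x := by
    funext x
    simp [fourier2_smul, mul_left_comm]
  rw [weilOp, h, fourier2_smul]
  rfl

/-- Rotation, shear, inverse rotation: $(a,k)\mapsto(k,-a)\mapsto(k,k-a)\mapsto(a-k,k)$, the sign
coming from the chirp. In particular $-e^{\mathbf Y_1-\mathbf Y_2}$ becomes $e^{\mathbf Y_1-\mathbf
Y_2+\mathbf U_2}$, which is what $\mathcal V_2$ is for. -/
theorem weilOp_weyl2 {f : Fun2 N} (hf : IsRapid f) (β : ℂ) {ε : ℤ} (hε : ε * ε = 1)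
    (a₂ k₂ a₁ k₁ : ℤ) :
    weilOp (weyl2 N β ε a₂ k₂ a₁ k₁ f)
      = ((-1 : ℂ) ^ k₂) • weyl2 N β ε (a₂ - k₂) k₂ a₁ k₁ (weilOp f) := by
  rw [weilOp, fourier2_weyl2 hf β hε, chirp_mul_weyl2 β hε, fourier2_smul]
  rw [reflect_smul, reflect_fourier2_weyl2 (isExpBdd_chirp.mul_isRapid hf.fourier2) β hε]
  congr 3
  ring

theorem norm_toH2_weilOp {f : Fun2 N} (hf : IsRapid f) : ‖toH2 (weilOp f)‖ = ‖toH2 f‖ := by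
  have h := isExpBdd_chirp.mul_isRapid hf.fourier2
  rw [weilOp, norm_toH2_reflect_fourier2 h, ← norm_toH2_fourier2 hf]
  refine norm_toH2_congr h hf.fourier2 fun x => ?_
  have := norm_restrict_chirp x
  simp only [restrict] at this ⊢
  rw [norm_mul, this, one_mul]

variable (N) in
/-- `𝒱₂` as a bijection of the space of rapidly decreasing functions. -/
def weilEquiv : Rapid N ≃ₗ[ℂ] Rapid N where
  toFun f := ⟨weilOp f.1, IsRapid.weilOp f.2⟩
  map_add' f g := Subtype.ext (weilOp_add f.2 g.2)
  map_smul' c f := Subtype.ext (weilOp_smul c f.1)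
  invFun f := ⟨weilInv f.1, IsRapid.weilInv f.2⟩
  left_inv f := Subtype.ext (weilInv_weilOp f.2)
  right_inv f := Subtype.ext (weilOp_weilInv f.2)

theorem stdAddChar_mul_eq_exp (m n : ZMod N) :
    (ZMod.stdAddChar (m * n) : ℂ)
      = Complex.exp (2 * Real.pi * Complex.I / N * (m.val * n.val)) := by
  have h : m * n = ((m.val * n.val : ℤ) : ZMod N) := by push_cast; simp
  rw [h, stdAddChar_intCast_eq_exp]
  congr 1
  push_cast
  ring

theorem restrict_weilOp {f : Fun2 N} (hf : IsRapid f) (x : (ℝ × ZMod N) × (ℝ × ZMod N)) :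
    restrict (weilOp f) x = 1 / (N : ℂ) ^ 2 * ∑ n : ZMod N, ∑ m : ZMod N, ∫ ν : ℝ, ∫ μ : ℝ,
      Complex.exp (2 * Real.pi * Complex.I / N * (x.1.1 * ν - x.1.2.val * n.val))
        * (-1) ^ (n.val ^ 2)
        * Complex.exp (Real.pi * Complex.I / N * (ν ^ 2 - n.val ^ 2))
        * Complex.exp (-(2 * Real.pi * Complex.I / N) * (μ * ν - m.val * n.val))
        * restrict f ((μ, m), x.2) := by
  set x₁ : ℂ × ZMod N := ((x.2.1 : ℂ), x.2.2) with hx₁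
  have hμ : ∀ (n m : ZMod N) (ν : ℝ), ∫ μ : ℝ,
      Complex.exp (2 * Real.pi * Complex.I / N * (x.1.1 * ν - x.1.2.val * n.val))
        * (-1) ^ (n.val ^ 2)
        * Complex.exp (Real.pi * Complex.I / N * (ν ^ 2 - n.val ^ 2))
        * Complex.exp (-(2 * Real.pi * Complex.I / N) * (μ * ν - m.val * n.val))
        * restrict f ((μ, m), x.2)
      = ZMod.stdAddChar (n * -x.1.2) * ZMod.stdAddChar (m * n) *
        (Complex.exp (-(2 * Real.pi * Complex.I / N) * (ν * -(x.1.1 : ℂ))) *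
        (chirp (((ν : ℂ), n), x₁) * fourierSlice m f (((ν : ℂ), n), x₁))) := by
    intro n m ν
    rw [mul_neg, AddChar.map_neg_eq_inv, stdAddChar_mul_eq_exp, stdAddChar_mul_eq_exp,
      ← Complex.exp_neg]
    simp only [fourierSlice, ← integral_const_mul, chirp, discChirp, restrict]
    congr 1
    funext μ
    have e1 : Complex.exp (2 * Real.pi * Complex.I / N * (x.1.1 * ν - x.1.2.val * n.val))
        = Complex.exp (-(2 * Real.pi * Complex.I / N * (n.val * x.1.2.val))) *
          Complex.exp (-(2 * Real.pi * Complex.I / N) * (ν * -(x.1.1 : ℂ))) := by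
      rw [← Complex.exp_add]; congr 1; ring
    have e2 : Complex.exp (Real.pi * Complex.I / N * ((ν : ℂ) ^ 2 - n.val ^ 2))
        = Complex.exp (-(Real.pi * Complex.I / N) * n.val ^ 2) *
          Complex.exp (Real.pi * Complex.I / N * (ν : ℂ) ^ 2) := by
      rw [← Complex.exp_add]; congr 1; ring
    have e3 : Complex.exp (-(2 * Real.pi * Complex.I / N) * (μ * ν - m.val * n.val))
        = Complex.exp (2 * Real.pi * Complex.I / N * (m.val * n.val)) *
          Complex.exp (-(2 * Real.pi * Complex.I / N) * (μ * ν)) := by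
      rw [← Complex.exp_add]; congr 1; ring
    rw [e1, e2, e3]
    ring
  simp only [hμ]
  have hi : ∀ n m : ZMod N, Integrable fun ν : ℝ =>
      Complex.exp (-(2 * Real.pi * Complex.I / N) * (ν * -(x.1.1 : ℂ))) *
        (chirp (((ν : ℂ), n), x₁) * fourierSlice m f (((ν : ℂ), n), x₁)) := by
    intro n m
    refine (((isExpBdd_exp_fst (-(2 * Real.pi * Complex.I / N) * -(x.1.1 : ℂ))).mul_isRapid
      (isExpBdd_chirp.mul_isRapid (hf.fourierSlice m))).integrable_fst n x₁).congr
      (Filter.Eventually.of_forall fun ν => ?_)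
    simp only
    congr 2
    ring
  change 1 / (N : ℂ) * ∑ n : ZMod N, ZMod.stdAddChar (n * -x.1.2) * ∫ ν : ℝ,
    Complex.exp (-(2 * Real.pi * Complex.I / N) * (ν * -(x.1.1 : ℂ))) *
      (chirp (((ν : ℂ), n), x₁) * (1 / (N : ℂ) * ∑ m : ZMod N, ZMod.stdAddChar (m * n) *
        fourierSlice m f (((ν : ℂ), n), x₁))) = _
  rw [show 1 / (N : ℂ) ^ 2 = 1 / (N : ℂ) * (1 / N) by rw [pow_two, one_div_mul_one_div],
    mul_assoc (1 / (N : ℂ)) (1 / N)]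
  congr 1
  rw [Finset.mul_sum]
  refine Finset.sum_congr rfl fun n _ => ?_
  rw [Finset.mul_sum, ← integral_const_mul]
  simp only [← integral_const_mul]
  rw [← integral_finsetSum]
  swap
  · exact fun m _ => ((hi n m).const_mul _).const_mul _
  congr 1
  funext ν
  simp only [Finset.mul_sum]
  refine Finset.sum_congr rfl fun m _ => ?_
  ring

end Weil

/-! ### Density of `𝒲₂` -/

/-- The positive and negative parts of `r` are densities of finite measures with equal
characteristic functions, hence equal; at every point one of the two parts is zero. -/
theorem ae_eq_zero_of_integral_char_real {r : ℝ × ℝ → ℝ}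
    (hr : Integrable r ((volume : Measure ℝ).prod volume))
    (h : ∀ L : StrongDual ℝ (ℝ × ℝ),
      ∫ v, Complex.exp (L v * Complex.I) * (r v : ℂ) ∂((volume : Measure ℝ).prod volume) = 0) :
    r =ᵐ[(volume : Measure ℝ).prod volume] 0 := by
  set vol := (volume : Measure ℝ).prod (volume : Measure ℝ)
  have hp : IsFiniteMeasure (vol.withDensity fun v => ENNReal.ofReal (r v)) :=
    isFiniteMeasure_withDensity_ofReal hr.2
  have hn : IsFiniteMeasure (vol.withDensity fun v => ENNReal.ofReal (-r v)) :=
    isFiniteMeasure_withDensity_ofReal hr.neg.2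
  have hmp : AEMeasurable (fun v => ENNReal.ofReal (r v)) vol := hr.1.aemeasurable.ennreal_ofReal
  have hmn : AEMeasurable (fun v => ENNReal.ofReal (-r v)) vol :=
    hr.neg.1.aemeasurable.ennreal_ofReal
  have hL : ∀ L : StrongDual ℝ (ℝ × ℝ), ∀ v, ‖Complex.exp (L v * Complex.I)‖ = 1 := fun L v =>
    Complex.norm_exp_ofReal_mul_I _
  have hi : ∀ (L : StrongDual ℝ (ℝ × ℝ)) {s : ℝ × ℝ → ℝ}, Integrable s vol →
      Integrable (fun v => (ENNReal.ofReal (s v)).toReal • Complex.exp (L v * Complex.I)) vol := by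
    intro L s hs
    have hs' : Integrable (fun v => ((max (s v) 0 : ℝ) : ℂ)) vol := hs.pos_part.ofReal
    have := hs'.bdd_mul (c := 1) (f := fun v => Complex.exp (L v * Complex.I)) (by fun_prop)
      (Filter.Eventually.of_forall fun v => (hL L v).le)
    refine this.congr (Filter.Eventually.of_forall fun v => ?_)
    simp only [ENNReal.toReal_ofReal', Complex.real_smul, mul_comm]
  have heq : vol.withDensity (fun v => ENNReal.ofReal (r v))
      = vol.withDensity fun v => ENNReal.ofReal (-r v) := by
    refine Measure.ext_of_charFunDual (funext fun L => ?_)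
    rw [charFunDual_apply, charFunDual_apply,
      integral_withDensity_eq_integral_toReal_smul₀ hmp
        (Filter.Eventually.of_forall fun _ => ENNReal.ofReal_lt_top),
      integral_withDensity_eq_integral_toReal_smul₀ hmn
        (Filter.Eventually.of_forall fun _ => ENNReal.ofReal_lt_top), ← sub_eq_zero,
      ← integral_sub (hi L hr) (hi L (s := fun v => -r v) hr.neg), ← h L]
    congr 1
    funext v
    rw [ENNReal.toReal_ofReal', ENNReal.toReal_ofReal', Complex.real_smul, Complex.real_smul,
      ← sub_mul, ← Complex.ofReal_sub, mul_comm]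
    congr 2
    rcases le_total 0 (r v) with h0 | h0
    · rw [max_eq_left h0, max_eq_right (by linarith), sub_zero]
    · rw [max_eq_right h0, max_eq_left (by linarith), zero_sub, neg_neg]
  have hae := (withDensity_eq_iff_of_sigmaFinite hmp hmn).1 heq
  filter_upwards [hae] with v hv
  rcases le_total 0 (r v) with h0 | h0
  · rw [ENNReal.ofReal_of_nonpos (by linarith : -r v ≤ 0), ENNReal.ofReal_eq_zero] at hv
    exact le_antisymm hv h0
  · rw [ENNReal.ofReal_of_nonpos h0, eq_comm, ENNReal.ofReal_eq_zero] at hv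
    exact le_antisymm h0 (by simpa using hv)

/-- Conjugating the hypothesis at `-L` gives it for the conjugate of `k`, hence for the real and
imaginary parts. -/
theorem ae_eq_zero_of_integral_char {k : ℝ × ℝ → ℂ}
    (hk : Integrable k ((volume : Measure ℝ).prod volume))
    (h : ∀ L : StrongDual ℝ (ℝ × ℝ),
      ∫ v, Complex.exp (L v * Complex.I) * k v ∂((volume : Measure ℝ).prod volume) = 0) :
    k =ᵐ[(volume : Measure ℝ).prod volume] 0 := by
  set vol := (volume : Measure ℝ).prod (volume : Measure ℝ)
  have hkc : Integrable (fun v => starRingEnd ℂ (k v)) vol :=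
    (Complex.conjCLE : ℂ →L[ℝ] ℂ).integrable_comp hk
  have hc : ∀ L : StrongDual ℝ (ℝ × ℝ),
      ∫ v, Complex.exp (L v * Complex.I) * starRingEnd ℂ (k v) ∂vol = 0 := by
    intro L
    have h1 := congrArg (starRingEnd ℂ) (h (-L))
    rw [← integral_conj, map_zero] at h1
    rw [← h1]
    congr 1
    funext v
    rw [map_mul, ← Complex.exp_conj]
    simp
  have hi : ∀ (L : StrongDual ℝ (ℝ × ℝ)) {s : ℝ × ℝ → ℂ}, Integrable s vol →
      Integrable (fun v => Complex.exp (L v * Complex.I) * s v) vol := fun L s hs =>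
    hs.bdd_mul (c := 1) (by fun_prop)
      (Filter.Eventually.of_forall fun v => (Complex.norm_exp_ofReal_mul_I _).le)
  have hre : (fun v => (k v).re) =ᵐ[vol] 0 := by
    refine ae_eq_zero_of_integral_char_real hk.re fun L => ?_
    have h2 : ∫ v, (Complex.exp (L v * Complex.I) * k v
        + Complex.exp (L v * Complex.I) * starRingEnd ℂ (k v)) * (1 / 2) ∂vol = 0 := by
      rw [integral_mul_const, integral_add (hi L hk) (hi L hkc), h L, hc L]
      simp
    rw [← h2]
    congr 1
    funext v
    rw [← mul_add, Complex.add_conj]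
    push_cast
    ring
  have him : (fun v => (k v).im) =ᵐ[vol] 0 := by
    refine ae_eq_zero_of_integral_char_real hk.im fun L => ?_
    have h2 : ∫ v, (Complex.exp (L v * Complex.I) * k v
        - Complex.exp (L v * Complex.I) * starRingEnd ℂ (k v)) * (1 / (2 * Complex.I)) ∂vol = 0 := by
      rw [integral_mul_const, integral_sub (hi L hk) (hi L hkc), h L, hc L]
      simp
    rw [← h2]
    congr 1
    funext v
    rw [← mul_sub, Complex.sub_conj]
    field_simp [Complex.I_ne_zero]
    push_cast
    ring
  filter_upwards [hre, him] with v h1 h2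
  exact Complex.ext h1 h2

section Density

variable {N : ℕ} [NeZero N]

/-- The component `(m₂, m₁)` of `(ℝ × ℤ/N)²`. -/
def component (m₂ m₁ : ZMod N) : Set ((ℝ × ZMod N) × (ℝ × ZMod N)) :=
  (Set.univ ×ˢ {m₂}) ×ˢ (Set.univ ×ˢ {m₁})

theorem mem_component {m₂ m₁ : ZMod N} {x : (ℝ × ZMod N) × (ℝ × ZMod N)} :
    x ∈ component m₂ m₁ ↔ x.1.2 = m₂ ∧ x.2.2 = m₁ := by
  simp [component]

theorem measurableSet_component (m₂ m₁ : ZMod N) : MeasurableSet (component m₂ m₁) :=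
  (MeasurableSet.univ.prod (measurableSet_singleton _)).prod
    (MeasurableSet.univ.prod (measurableSet_singleton _))

theorem restrict_measure2_component (m₂ m₁ : ZMod N) :
    (measure2 N).restrict (component m₂ m₁)
      = ((volume : Measure ℝ).prod volume).map fun p => ((p.1, m₂), (p.2, m₁)) := by
  have h : ∀ m : ZMod N, (measure1 N).restrict (Set.univ ×ˢ {m})
      = (volume : Measure ℝ).map fun x => (x, m) := by
    intro m
    rw [measure1, ← Measure.prod_restrict, Measure.restrict_univ, Measure.restrict_singleton,
      Measure.count_singleton, one_smul, Measure.prod_dirac]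
  rw [component, measure2, ← Measure.prod_restrict, h, h, Measure.map_prod_map _ _ (by fun_prop)
    (by fun_prop)]
  rfl

theorem mem_W1_gauss (a : ℝ) (m₀ : ZMod N) :
    (fun x : ℂ × ZMod N => Complex.exp (-1 * x.1 ^ 2 + (-(a * Complex.I)) * x.1)
      * (1 : Polynomial ℂ).eval x.1 * (if x.2 = m₀ then 1 else 0)) ∈ W1 N :=
  Submodule.subset_span ⟨1, -(a * Complex.I), 1, fun m => if m = m₀ then 1 else 0, by simp, rfl⟩

/-- Testing on one component against Gaussians with phases $e^{-\mu^2-ia\mu}$ shows that the Fourier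
transform of the Gaussian times `F` vanishes there; the Gaussian has no zeros. -/
theorem eq_zero_of_inner_W2_eq_zero (F : H2 N) (h : ∀ w ∈ W2 N, inner ℂ (toH2 w) F = 0) :
    F = 0 := by
  have hFm : StronglyMeasurable (F : (ℝ × ZMod N) × (ℝ × ZMod N) → ℂ) := Lp.stronglyMeasurable F
  have key : ∀ m₂ m₁ : ZMod N, ∀ᵐ x ∂(measure2 N), x ∈ component m₂ m₁ → F x = 0 := by
    intro m₂ m₁
    rw [← ae_restrict_iff' (measurableSet_component m₂ m₁), restrict_measure2_component,
      ae_map_iff (by fun_prop) (hFm.measurableSet_eq_fun stronglyMeasurable_const)]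
    have hw : ∀ a₂ a₁ : ℝ, (fun x : (ℂ × ZMod N) × (ℂ × ZMod N) =>
        (Complex.exp (-1 * x.1.1 ^ 2 + (-(a₂ * Complex.I)) * x.1.1) * (1 : Polynomial ℂ).eval x.1.1
          * (if x.1.2 = m₂ then 1 else 0)) *
        (Complex.exp (-1 * x.2.1 ^ 2 + (-(a₁ * Complex.I)) * x.2.1) * (1 : Polynomial ℂ).eval x.2.1
          * (if x.2.2 = m₁ then 1 else 0))) ∈ W2 N := fun a₂ a₁ =>
      Submodule.subset_span ⟨_, mem_W1_gauss a₂ m₂, _, mem_W1_gauss a₁ m₁, rfl⟩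
    set w : ℝ → ℝ → Fun2 N := fun a₂ a₁ x =>
        (Complex.exp (-1 * x.1.1 ^ 2 + (-(a₂ * Complex.I)) * x.1.1) * (1 : Polynomial ℂ).eval x.1.1
          * (if x.1.2 = m₂ then 1 else 0)) *
        (Complex.exp (-1 * x.2.1 ^ 2 + (-(a₁ * Complex.I)) * x.2.1) * (1 : Polynomial ℂ).eval x.2.1
          * (if x.2.2 = m₁ then 1 else 0)) with hwdef
    have hint : ∀ a₂ a₁, Integrable (fun x => starRingEnd ℂ (restrict (w a₂ a₁) x) * F x)
        (measure2 N) := by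
      intro a₂ a₁
      have h1 := (isRapid_of_mem_W2 (hw a₂ a₁)).memLp
      exact h1.star.integrable_mul (Lp.memLp F)
    have hval : ∀ (a₂ a₁ : ℝ) (p : ℝ × ℝ),
        starRingEnd ℂ (restrict (w a₂ a₁) ((p.1, m₂), (p.2, m₁)))
        = Complex.exp ((a₂ * p.1 + a₁ * p.2 : ℝ) * Complex.I) *
          Complex.exp (-(p.1 ^ 2 + p.2 ^ 2 : ℝ)) := by
      intro a₂ a₁ p
      simp only [hwdef, restrict, if_true, Polynomial.eval_one, mul_one,
        ← Complex.exp_conj, ← Complex.exp_add]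
      congr 1
      simp
      ring
    let k : ℝ × ℝ → ℂ := fun p =>
      Complex.exp (-(p.1 ^ 2 + p.2 ^ 2 : ℝ)) * F ((p.1, m₂), (p.2, m₁))
    have hmap : ∀ a₂ a₁ : ℝ, Integrable (fun p : ℝ × ℝ => Complex.exp
        ((a₂ * p.1 + a₁ * p.2 : ℝ) * Complex.I) * k p) ((volume : Measure ℝ).prod volume) ∧
        ∫ p, Complex.exp ((a₂ * p.1 + a₁ * p.2 : ℝ) * Complex.I) * k p
          ∂((volume : Measure ℝ).prod volume) = 0 := by
      intro a₂ a₁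
      have e : (fun p : ℝ × ℝ => Complex.exp ((a₂ * p.1 + a₁ * p.2 : ℝ) * Complex.I) * k p)
          = (fun x => starRingEnd ℂ (restrict (w a₂ a₁) x) * F x) ∘
            fun p : ℝ × ℝ => ((p.1, m₂), (p.2, m₁)) := by
        funext p
        simp only [Function.comp, hval, k, mul_assoc]
      have hr := (hint a₂ a₁).restrict (s := component m₂ m₁)
      have h0 : ∫ x in component m₂ m₁, starRingEnd ℂ (restrict (w a₂ a₁) x) * F x ∂(measure2 N)
          = 0 := by
        rw [setIntegral_eq_integral_of_forall_compl_eq_zero, ← h _ (hw a₂ a₁), L2.inner_def]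
        · refine integral_congr_ae ?_
          filter_upwards [coeFn_toH2 (isRapid_of_mem_W2 (hw a₂ a₁))] with x hx
          rw [hx, RCLike.inner_apply, mul_comm]
        · intro x hx
          have : restrict (w a₂ a₁) x = 0 := by
            simp only [hwdef, restrict]
            by_cases h2 : x.1.2 = m₂
            · have h1 : x.2.2 ≠ m₁ := fun h1 => hx (mem_component.2 ⟨h2, h1⟩)
              simp [h1]
            · simp [h2]
          simp [this]
      rw [restrict_measure2_component] at hr h0
      rw [e]
      rw [integrable_map_measure hr.1 (by fun_prop)] at hr
      refine ⟨hr, ?_⟩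
      rw [integral_map (by fun_prop)] at h0
      · exact h0
      · rw [← restrict_measure2_component]
        exact ((hint a₂ a₁).restrict (s := component m₂ m₁)).1
    have hk : Integrable k ((volume : Measure ℝ).prod volume) := by
      simpa using (hmap 0 0).1
    have hk0 := ae_eq_zero_of_integral_char hk fun L => by
      rw [← (hmap (L (1, 0)) (L (0, 1))).2]
      congr 1
      funext v
      have : L v = L (1, 0) * v.1 + L (0, 1) * v.2 := by
        conv_lhs => rw [show v = v.1 • ((1, 0) : ℝ × ℝ) + v.2 • ((0, 1) : ℝ × ℝ) by ext <;> simp]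
        rw [map_add, map_smul, map_smul, smul_eq_mul, smul_eq_mul]
        ring
      rw [this]
    filter_upwards [hk0] with p hp
    exact (mul_eq_zero.1 hp).resolve_left (Complex.exp_ne_zero _)
  have hall : ∀ᵐ x ∂(measure2 N), ∀ m₂ m₁ : ZMod N, x ∈ component m₂ m₁ → F x = 0 :=
    ae_all_iff.2 fun m₂ => ae_all_iff.2 fun m₁ => key m₂ m₁
  refine Lp.eq_zero_iff_ae_eq_zero.2 ?_
  filter_upwards [hall] with x hx
  exact hx x.1.2 x.2.2 (mem_component.2 ⟨rfl, rfl⟩)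

variable (N) in
theorem dense_span_W2 :
    Dense (Submodule.span ℂ ((toH2 : Fun2 N → H2 N) '' (W2 N)) : Set (H2 N)) := by
  rw [Submodule.dense_iff_topologicalClosure_eq_top, Submodule.topologicalClosure_eq_top_iff,
    Submodule.eq_bot_iff]
  intro F hF
  refine eq_zero_of_inner_W2_eq_zero F fun w hw => ?_
  exact (Submodule.mem_orthogonal _ _).1 hF _ (Submodule.subset_span ⟨w, hw, rfl⟩)

variable (N) in
theorem denseRange_rapidToH2 : DenseRange (rapidToH2 N) := by
  refine (dense_span_W2 N).mono ?_
  have : Submodule.span ℂ ((toH2 : Fun2 N → H2 N) '' (W2 N)) ≤ LinearMap.range (rapidToH2 N) := by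
    rw [Submodule.span_le]
    rintro _ ⟨w, hw, rfl⟩
    exact ⟨⟨w, isRapid_of_mem_W2 hw⟩, rfl⟩
  exact this

/-! ### The unitary operators `𝒮₂` and `𝒱₂` -/

variable (N) in
/-- `𝒱₂`. -/
def weilUnitary : H2 N ≃ₗᵢ[ℂ] H2 N :=
  (weilEquiv N).extendOfIsometry (rapidToH2 N) (rapidToH2 N) (denseRange_rapidToH2 N)
    (denseRange_rapidToH2 N) fun f => norm_toH2_weilOp f.2

theorem weilUnitary_toH2 {f : Fun2 N} (hf : IsRapid f) :
    weilUnitary N (toH2 f) = toH2 (weilOp f) := by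
  have h := LinearEquiv.extendOfIsometry_eq (weilEquiv N) (rapidToH2 N) (rapidToH2 N)
    (denseRange_rapidToH2 N) (denseRange_rapidToH2 N) (fun f => norm_toH2_weilOp f.2) ⟨f, hf⟩
  exact h

theorem isWeil2_weilUnitary : IsWeil2 (weilUnitary N) := by
  intro w hw
  have hr := isRapid_of_mem_W2 hw
  rw [weilUnitary_toH2 hr]
  exact (coeFn_toH2 hr.weilOp).trans (Filter.Eventually.of_forall fun x => restrict_weilOp hr x)

theorem IsWeil2.eq_weilUnitary {V : H2 N ≃ₗᵢ[ℂ] H2 N} (hV : IsWeil2 V) : V = weilUnitary N := by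
  have h : (V.toContinuousLinearEquiv : H2 N →L[ℂ] H2 N)
      = ((weilUnitary N).toContinuousLinearEquiv : H2 N →L[ℂ] H2 N) := by
    refine ContinuousLinearMap.ext_on (dense_span_W2 N) ?_
    rintro _ ⟨w, hw, rfl⟩
    exact Lp.ext ((hV w hw).trans (isWeil2_weilUnitary w hw).symm)
  exact LinearIsometryEquiv.ext fun F => DFunLike.congr_fun h F

theorem measurePreserving_sub_snd : MeasurePreserving
    (fun x : (ℝ × ZMod N) × (ℝ × ZMod N) => (x.1, (x.2.1 - x.1.1, x.2.2 - x.1.2)))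
    (measure2 N) (measure2 N) := by
  convert measurePreserving_prod_neg_add (measure1 N) (measure1 N) using 2 with x
  refine Prod.ext rfl (Prod.ext ?_ ?_)
  · simp only [Prod.fst_add, Prod.fst_neg]; ring
  · simp only [Prod.snd_add, Prod.snd_neg]; ring

theorem measurePreserving_add_snd : MeasurePreserving
    (fun x : (ℝ × ZMod N) × (ℝ × ZMod N) => (x.1, (x.2.1 + x.1.1, x.2.2 + x.1.2)))
    (measure2 N) (measure2 N) := by
  convert measurePreserving_prod_add (measure1 N) (measure1 N) using 2 with x
  refine Prod.ext rfl (Prod.ext ?_ ?_)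
  · simp only [Prod.fst_add]; ring
  · simp only [Prod.snd_add]; ring

variable (N) in
/-- `𝒮₂`. -/
def shiftUnitary : H2 N ≃ₗᵢ[ℂ] H2 N where
  toLinearEquiv := LinearEquiv.ofLinearMap
    (Lp.compMeasurePreservingₗ ℂ _ measurePreserving_sub_snd)
    (Lp.compMeasurePreservingₗ ℂ _ measurePreserving_add_snd)
    (LinearMap.ext fun F => Lp.ext (by
      have h1 := Lp.coeFn_compMeasurePreserving
        (Lp.compMeasurePreserving _ measurePreserving_add_snd F) measurePreserving_sub_snd
      have h2 := measurePreserving_sub_snd.quasiMeasurePreserving.ae_eq_comp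
        (Lp.coeFn_compMeasurePreserving F (measurePreserving_add_snd (N := N)))
      refine h1.trans (h2.trans (Filter.Eventually.of_forall fun x => ?_))
      simp))
    (LinearMap.ext fun F => Lp.ext (by
      have h1 := Lp.coeFn_compMeasurePreserving
        (Lp.compMeasurePreserving _ measurePreserving_sub_snd F) measurePreserving_add_snd
      have h2 := measurePreserving_add_snd.quasiMeasurePreserving.ae_eq_comp
        (Lp.coeFn_compMeasurePreserving F (measurePreserving_sub_snd (N := N)))
      refine h1.trans (h2.trans (Filter.Eventually.of_forall fun x => ?_))
      simp))
  norm_map' F := Lp.norm_compMeasurePreserving F measurePreserving_sub_snd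

theorem isShift2_shiftUnitary : IsShift2 (shiftUnitary N) := fun F =>
  Lp.coeFn_compMeasurePreserving F measurePreserving_sub_snd

theorem IsShift2.apply_toH2 {S : H2 N ≃ₗᵢ[ℂ] H2 N} (hS : IsShift2 S) {f : Fun2 N}
    (hf : IsRapid f) : S (toH2 f) = toH2 (shear f) := by
  refine Lp.ext ((hS _).trans (Filter.EventuallyEq.trans ?_ (coeFn_toH2 hf.shear).symm))
  refine (measurePreserving_sub_snd.quasiMeasurePreserving.ae_eq_comp (coeFn_toH2 hf)).trans
    (Filter.Eventually.of_forall fun x => ?_)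
  simp [restrict, shear]

theorem existsUnique_isShift2 : ∃! S : H2 N ≃ₗᵢ[ℂ] H2 N, IsShift2 S :=
  ⟨shiftUnitary N, isShift2_shiftUnitary, fun _ hS => LinearIsometryEquiv.ext fun F =>
    Lp.ext ((hS F).trans (isShift2_shiftUnitary F).symm)⟩

theorem existsUnique_isWeil2 : ∃! V : H2 N ≃ₗᵢ[ℂ] H2 N, IsWeil2 V :=
  ⟨weilUnitary N, isWeil2_weilUnitary, fun _ hV => hV.eq_weilUnitary⟩

end Density

/-! ### The infinite products -/

/-- The product `∏ (1 + q^{2j+1} y)`. -/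
def qprod (q y : ℂ) : ℂ := ∏' j : ℕ, (1 + q ^ (2 * j + 1) * y)

section QProd

variable {q : ℂ}

theorem summable_norm_qprod (hq : ‖q‖ < 1) (y : ℂ) :
    Summable fun j : ℕ => ‖q ^ (2 * j + 1) * y‖ := by
  have h : ∀ j : ℕ, ‖q ^ (2 * j + 1) * y‖ = (‖q‖ ^ 2) ^ j * (‖q‖ * ‖y‖) := fun j => by
    rw [norm_mul, norm_pow, pow_succ, pow_mul]; ring
  simp only [h]
  refine (summable_geometric_of_lt_one (by positivity) ?_).mul_right _
  nlinarith [norm_nonneg q]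

theorem multipliable_qprod (hq : ‖q‖ < 1) (y : ℂ) :
    Multipliable fun j : ℕ => (1 + q ^ (2 * j + 1) * y) :=
  multipliable_one_add_of_summable (summable_norm_qprod hq y)

theorem qprod_eq_prod_mul (hq : ‖q‖ < 1) (y : ℂ) (J : ℕ) :
    qprod q y = (∏ j ∈ Finset.range J, (1 + q ^ (2 * j + 1) * y)) * qprod q (q ^ (2 * J) * y) := by
  have e : ∀ n : ℕ, (1 + q ^ (2 * (n + J) + 1) * y) = 1 + q ^ (2 * n + 1) * (q ^ (2 * J) * y) :=
    fun n => by ring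
  have hm : Multipliable fun n : ℕ => (1 + q ^ (2 * (n + J) + 1) * y) := by
    simp only [e]; exact multipliable_qprod hq _
  have h := hm.prod_mul_tprod_nat_mul' (f := fun j : ℕ => 1 + q ^ (2 * j + 1) * y)
  simp only [e] at h
  exact h.symm

theorem qprod_eq_mul (hq : ‖q‖ < 1) (y : ℂ) :
    qprod q y = (1 + q * y) * qprod q (q ^ 2 * y) := by
  simpa using qprod_eq_prod_mul hq y 1

theorem qprod_eq_zero_iff (hq : ‖q‖ < 1) (y : ℂ) :
    qprod q y = 0 ↔ ∃ j : ℕ, 1 + q ^ (2 * j + 1) * y = 0 := by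
  refine ⟨fun h => ?_, fun ⟨j, hj⟩ => ?_⟩
  · by_contra! hne
    exact tprod_one_add_ne_zero_of_summable hne (summable_norm_qprod hq y) h
  · rw [qprod_eq_prod_mul hq y (j + 1), Finset.prod_range_succ, hj, mul_zero, zero_mul]

theorem differentiable_qprod (hq : ‖q‖ < 1) : Differentiable ℂ (qprod q) := by
  intro y
  set K := Metric.ball (0 : ℂ) (‖y‖ + 1)
  have h := (summable_norm_qprod hq ((‖y‖ + 1 : ℝ) : ℂ)).hasProdLocallyUniformlyOn_nat_one_add
    (K := K) (f := fun j y => q ^ (2 * j + 1) * y) Metric.isOpen_ball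
    (.of_forall fun n x hx => ?_) (fun n => by fun_prop)
  · have hd := h.differentiableOn (.of_forall fun _ => by
      simpa [Finset.prod_fn] using DifferentiableOn.finsetProd (fun _ _ ↦ by fun_prop))
      Metric.isOpen_ball
    exact hd.differentiableAt (Metric.isOpen_ball.mem_nhds (by simp))
  · have hx' : ‖x‖ < ‖y‖ + 1 := by simpa [K] using hx
    rw [norm_mul, norm_mul, Complex.norm_real, Real.norm_of_nonneg (by positivity)]
    gcongr

/-- The factors vanish at the points $-q^{-(2j+1)}$, of pairwise different modulus, so at a zero
exactly one factor vanishes. It is split off, and the rest of the product is nonzero. -/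
theorem deriv_qprod_ne_zero (hq : ‖q‖ < 1) (hq0 : q ≠ 0) {y : ℂ} (hy : qprod q y = 0) :
    deriv (qprod q) y ≠ 0 := by
  obtain ⟨J, hJ⟩ := (qprod_eq_zero_iff hq y).1 hy
  have hne : ∀ j : ℕ, j ≠ J → 1 + q ^ (2 * j + 1) * y ≠ 0 := by
    intro j hj h
    have hy0 : y ≠ 0 := fun h0 => by simp [h0] at h
    have h1 : q ^ (2 * j + 1) = q ^ (2 * J + 1) := mul_right_cancel₀ hy0 (by linear_combination h - hJ)
    have h2 := congrArg norm h1
    rw [norm_pow, norm_pow] at h2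
    have := pow_right_injective₀ (norm_pos_iff.2 hq0) hq.ne h2
    omega
  have hfac : qprod q = fun y => (1 + q ^ (2 * J + 1) * y) *
      ((∏ j ∈ Finset.range J, (1 + q ^ (2 * j + 1) * y)) * qprod q (q ^ (2 * (J + 1)) * y)) := by
    funext y
    rw [qprod_eq_prod_mul hq y (J + 1), Finset.prod_range_succ]
    ring
  have hdB : DifferentiableAt ℂ (fun y => (∏ j ∈ Finset.range J, (1 + q ^ (2 * j + 1) * y)) *
      qprod q (q ^ (2 * (J + 1)) * y)) y := by
    have := differentiable_qprod hq
    refine DifferentiableAt.mul (DifferentiableAt.fun_finsetProd fun _ _ => by fun_prop) ?_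
    exact (this _).comp y (by fun_prop)
  have hdA : HasDerivAt (fun y => 1 + q ^ (2 * J + 1) * y) (q ^ (2 * J + 1)) y := by
    simpa using ((hasDerivAt_id y).const_mul (q ^ (2 * J + 1))).const_add 1
  rw [hfac, (hdA.fun_mul hdB.hasDerivAt).deriv, hJ, zero_mul, add_zero]
  refine mul_ne_zero (pow_ne_zero _ hq0) (mul_ne_zero ?_ ?_)
  · exact Finset.prod_ne_zero_iff.2 fun j hj => hne j (Finset.mem_range.1 hj).ne
  · rw [Ne, qprod_eq_zero_iff hq]
    rintro ⟨j, hj⟩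
    refine hne (j + (J + 1)) (by omega) ?_
    rw [← hj]; ring

theorem conj_qprod (hq : ‖q‖ < 1) (y : ℂ) :
    starRingEnd ℂ (qprod q y) = qprod (starRingEnd ℂ q) (starRingEnd ℂ y) := by
  rw [qprod, (multipliable_qprod hq y).map_tprod (starRingEnd ℂ) Complex.continuous_conj]
  simp [qprod]

end QProd

/-! ### Conjugation and duality of the parameters -/

section Parameters

variable {N : ℕ} [NeZero N]

/-- As $\bar\beta=\beta^{-1}$, conjugation sends $\hbar$ to $-\tilde\hbar$ and so exchanges the two
halves of the modular double. -/
theorem conj_bq {β : ℂ} (hβ : ‖β‖ = 1) : starRingEnd ℂ (bq N β) = (bq N β⁻¹)⁻¹ := by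
  rw [bq, bq, hbar, hbar, ← Complex.exp_conj, ← Complex.exp_neg, Complex.inv_eq_conj hβ]
  congr 1
  simp
  ring

theorem norm_bq_lt_one {b : ℂ} (hre : 0 < b.re) (him : 0 < b.im) : ‖bq N b‖ < 1 := by
  have hN : (0 : ℝ) < N := Nat.cast_pos.2 (NeZero.pos N)
  rw [bq, hbar, Complex.norm_exp, Real.exp_lt_one_iff]
  have : (Real.pi * Complex.I / N * (1 + b ^ 2) : ℂ).re = -(2 * (Real.pi / N * (b.re * b.im))) := by
    have : (Real.pi * Complex.I / N * (1 + b ^ 2) : ℂ)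
        = ((Real.pi / N : ℝ) : ℂ) * (Complex.I * (1 + b ^ 2)) := by push_cast; ring
    rw [this, Complex.re_ofReal_mul, Complex.I_mul_re]
    simp [_root_.pow_two]
    ring
  rw [this]
  have := Real.pi_pos
  rw [neg_lt_zero]
  positivity

theorem conj_yGen {β : ℂ} (hβ : ‖β‖ = 1) (ε : ℤ) (x : ℂ × ZMod N) :
    starRingEnd ℂ (yGen β ε x) = yGen β⁻¹ (-ε) (starRingEnd ℂ x.1, x.2) := by
  rw [yGen, yGen, map_mul, conj_stdAddChar, ← Complex.exp_conj, Complex.inv_eq_conj hβ]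
  congr 2
  · simp [Complex.conj_ofNat]
  · push_cast; ring

theorem yGen_sub (β : ℂ) (ε : ℤ) (x x' : ℂ × ZMod N) :
    yGen β ε (x.1 - x'.1, x.2 - x'.2) = yGen β ε x * (yGen β ε x')⁻¹ := by
  have h : yGen β ε (x.1 - x'.1, x.2 - x'.2) * yGen β ε x' = yGen β ε x := by
    simp only [yGen]
    rw [mul_mul_mul_comm, ← Complex.exp_add, ← AddChar.map_add_eq_mul]
    congr 2 <;> ring
  rw [← h, mul_assoc, mul_inv_cancel₀ (yGen_ne_zero β ε x'), mul_one]

/-- Under the shift of one half of the modular double the other half is invariant. -/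
theorem yGen_shift_dual {β : ℂ} (hβ : β ≠ 0) {ε : ℤ} (hε : ε * ε = 1) (a : ℤ) (x : ℂ × ZMod N) :
    yGen β⁻¹ (-ε) (x.1 + a * (Complex.I * β), x.2 - ((ε * a : ℤ) : ZMod N)) = yGen β⁻¹ (-ε) x := by
  have h1 : -(((-ε : ℤ) : ZMod N) * (x.2 - ((ε * a : ℤ) : ZMod N)))
      = ((-a : ℤ) : ZMod N) + -(((-ε : ℤ) : ZMod N) * x.2) := by
    have : (ε : ZMod N) * (ε : ZMod N) = 1 := by exact_mod_cast congrArg (Int.cast (R := ZMod N)) hε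
    push_cast
    linear_combination (-(a : ZMod N)) * this
  rw [yGen, yGen, h1, AddChar.map_add_eq_mul, stdAddChar_intCast_eq_exp, ← mul_assoc,
    ← Complex.exp_add]
  congr 2
  push_cast
  field_simp
  ring

theorem hasDerivAt_yGen (β : ℂ) (ε : ℤ) (m : ZMod N) (z : ℂ) :
    HasDerivAt (fun z => yGen β ε (z, m)) (2 * Real.pi / N * β * yGen β ε (z, m)) z := by
  have := ((hasDerivAt_id z).const_mul (2 * Real.pi / N * β : ℂ)).cexp.mul_const
    (ZMod.stdAddChar (-((ε : ZMod N) * m)) : ℂ)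
  refine this.congr_deriv ?_
  simp [yGen]
  ring

theorem differentiable_yGen (β : ℂ) (ε : ℤ) (m : ZMod N) :
    Differentiable ℂ fun z => yGen β ε (z, m) :=
  fun z => (hasDerivAt_yGen β ε m z).differentiableAt

end Parameters

/-! ### The analytic continuation of the inverse quantum dilogarithm -/

section Dilog

open Topology

variable {N : ℕ} [NeZero N]

/-- The numerator of the inverse quantum dilogarithm. -/
def dilogNum (b : ℂ) (x : ℂ × ZMod N) : ℂ := qprod (bq N b) (-(yGen b 1 x))

/-- The denominator of the inverse quantum dilogarithm. -/
def dilogDen (b : ℂ) (x : ℂ × ZMod N) : ℂ := qprod (bq N b⁻¹)⁻¹ (-(yGen b⁻¹ (-1) x))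

/-- The inverse quantum dilogarithm `φ(-y, -ỹ)⁻¹` with its removable singularities removed. -/
def dilogInv (b : ℂ) (x : ℂ × ZMod N) : ℂ :=
  toMeromorphicNFOn (fun z => dilogNum b (z, x.2) / dilogDen b (z, x.2)) Set.univ x.1

variable {b : ℂ}

theorem norm_bq_inv_lt_one (hb : ‖b‖ = 1) (hre : 0 < b.re) (him : 0 < b.im) :
    ‖(bq N b⁻¹)⁻¹‖ < 1 := by
  rw [← conj_bq hb, RCLike.norm_conj]
  exact norm_bq_lt_one hre him

theorem ne_zero_of_norm_one (hb : ‖b‖ = 1) : b ≠ 0 := fun h => by simp [h] at hb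

theorem differentiable_dilogNum (hre : 0 < b.re) (him : 0 < b.im) (m : ZMod N) :
    Differentiable ℂ fun z => dilogNum b (z, m) :=
  (differentiable_qprod (norm_bq_lt_one hre him)).comp (differentiable_yGen b 1 m).neg

theorem differentiable_dilogDen (hb : ‖b‖ = 1) (hre : 0 < b.re) (him : 0 < b.im) (m : ZMod N) :
    Differentiable ℂ fun z => dilogDen b (z, m) :=
  (differentiable_qprod (norm_bq_inv_lt_one hb hre him)).comp (differentiable_yGen b⁻¹ (-1) m).neg

theorem deriv_qprod_yGen_ne_zero {q β : ℂ} (hq : ‖q‖ < 1) (hq0 : q ≠ 0) (hβ : β ≠ 0) (ε : ℤ)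
    (m : ZMod N) {z : ℂ} (hz : qprod q (-(yGen β ε (z, m))) = 0) :
    deriv (fun z => qprod q (-(yGen β ε (z, m)))) z ≠ 0 := by
  have h := ((differentiable_qprod hq) (-(yGen β ε (z, m)))).hasDerivAt.comp z
    (hasDerivAt_yGen β ε m z).fun_neg
  have hN : (N : ℂ) ≠ 0 := NeZero.ne _
  have hπ : (Real.pi : ℂ) ≠ 0 := Complex.ofReal_ne_zero.2 Real.pi_ne_zero
  rw [show (fun z => qprod q (-(yGen β ε (z, m)))) = qprod q ∘ fun z => -(yGen β ε (z, m)) from rfl,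
    h.deriv]
  refine mul_ne_zero (deriv_qprod_ne_zero hq hq0 hz) (neg_ne_zero.2 ?_)
  exact mul_ne_zero (mul_ne_zero (by simp [hN, hπ]) hβ) (yGen_ne_zero _ _ _)

theorem deriv_dilogNum_ne_zero (hb : ‖b‖ = 1) (hre : 0 < b.re) (him : 0 < b.im) (m : ZMod N)
    {z : ℂ} (hz : dilogNum b (z, m) = 0) : deriv (fun z => dilogNum b (z, m)) z ≠ 0 :=
  deriv_qprod_yGen_ne_zero (norm_bq_lt_one hre him) (bq_ne_zero N b) (ne_zero_of_norm_one hb) 1 m hz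

theorem deriv_dilogDen_ne_zero (hb : ‖b‖ = 1) (hre : 0 < b.re) (him : 0 < b.im) (m : ZMod N)
    {z : ℂ} (hz : dilogDen b (z, m) = 0) : deriv (fun z => dilogDen b (z, m)) z ≠ 0 :=
  deriv_qprod_yGen_ne_zero (norm_bq_inv_lt_one hb hre him) (inv_ne_zero (bq_ne_zero N b⁻¹))
    (inv_ne_zero (ne_zero_of_norm_one hb)) (-1) m hz

theorem eventually_ne_zero_of_deriv_ne_zero {f : ℂ → ℂ} (hf : Differentiable ℂ f) (z : ℂ)
    (h : f z = 0 → deriv f z ≠ 0) : ∀ᶠ w in 𝓝[≠] z, f w ≠ 0 := by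
  by_cases hz : f z = 0
  · exact (hf z).hasDerivAt.eventually_ne (h hz)
  · exact ((hf z).continuousAt.eventually_ne hz).filter_mono nhdsWithin_le_nhds

theorem eventually_dilogNum_ne_zero (hb : ‖b‖ = 1) (hre : 0 < b.re) (him : 0 < b.im) (m : ZMod N)
    (z : ℂ) : ∀ᶠ w in 𝓝[≠] z, dilogNum b (w, m) ≠ 0 :=
  eventually_ne_zero_of_deriv_ne_zero (differentiable_dilogNum hre him m) z
    (deriv_dilogNum_ne_zero hb hre him m)

theorem eventually_dilogDen_ne_zero (hb : ‖b‖ = 1) (hre : 0 < b.re) (him : 0 < b.im) (m : ZMod N)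
    (z : ℂ) : ∀ᶠ w in 𝓝[≠] z, dilogDen b (w, m) ≠ 0 :=
  eventually_ne_zero_of_deriv_ne_zero (differentiable_dilogDen hb hre him m) z
    (deriv_dilogDen_ne_zero hb hre him m)

/-- Below the line `Im z = Re b` every zero of the denominator is a zero of the numerator. -/
theorem dilogNum_eq_zero_of_dilogDen_eq_zero (hb : ‖b‖ = 1) (hre : 0 < b.re) (him : 0 < b.im)
    {m : ZMod N} {z : ℂ} (hz : z.im < b.re) (h : dilogDen b (z, m) = 0) :
    dilogNum b (z, m) = 0 := by
  have hN : (N : ℂ) ≠ 0 := NeZero.ne _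
  have hπ : (Real.pi : ℂ) ≠ 0 := Complex.ofReal_ne_zero.2 Real.pi_ne_zero
  have hb0 := ne_zero_of_norm_one hb
  obtain ⟨J, hJ⟩ := (qprod_eq_zero_iff (norm_bq_inv_lt_one hb hre him) _).1 h
  have h1 : yGen b⁻¹ (-1) (z, m) = bq N b⁻¹ ^ (2 * J + 1) := by
    have := bq_ne_zero N b⁻¹
    have hc : (bq N b⁻¹)⁻¹ ^ (2 * J + 1) * bq N b⁻¹ ^ (2 * J + 1) = 1 := by
      rw [← mul_pow, inv_mul_cancel₀ this, one_pow]
    linear_combination (-bq N b⁻¹ ^ (2 * J + 1)) * hJ - yGen b⁻¹ (-1) (z, m) * hc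
  have h2 : Complex.exp (2 * Real.pi / N * b⁻¹ * z + 2 * Real.pi * Complex.I * m.val / N)
      = Complex.exp ((2 * J + 1 : ℕ) * (Real.pi * Complex.I / N * (1 + b⁻¹ ^ 2))) := by
    rw [Complex.exp_add, Complex.exp_nat_mul, ← stdAddChar_eq_exp_val]
    have : -(((-1 : ℤ) : ZMod N) * m) = m := by simp
    rw [yGen, this] at h1
    exact h1
  obtain ⟨k, hk⟩ := Complex.exp_eq_exp_iff_exists_int.1 h2
  set r : ℤ := k * N - m.val with hr
  have hbi : b⁻¹ = starRingEnd ℂ b := Complex.inv_eq_conj hb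
  have hsum : b + b⁻¹ = 2 * b.re := by rw [hbi, Complex.add_conj]; push_cast; ring
  -- Solving for the zeros of the denominator; $r\equiv-m$ modulo $N$, and
  -- $b+b^{-1}=2\,\mathrm{Re}\,b$ makes the height a multiple of $\mathrm{Re}\,b$.
  have hz' : z = Complex.I * (r * b + (2 * J + 1) * b.re) := by
    have e : (2 * Real.pi / N * b⁻¹) * (z - Complex.I * (r * b + (2 * J + 1) * ((b + b⁻¹) / 2)))
        = 0 := by
      rw [hr]
      push_cast at hk ⊢
      field_simp at hk ⊢
      linear_combination Real.pi * hk
    have e' := (mul_eq_zero.1 e).resolve_left (by simp [hN, hπ, hb0])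
    rw [hsum] at e'
    linear_combination e'
  have him' : z.im = (r + (2 * J + 1)) * b.re := by
    rw [hz']
    simp
    ring
  have hrJ : r + (2 * J + 1) ≤ 0 := by
    have : ((r + (2 * J + 1) : ℤ) : ℝ) * b.re < 1 * b.re := by
      push_cast; rw [one_mul, ← him']; exact hz
    have := lt_of_mul_lt_mul_right this hre.le
    have : r + (2 * J + 1) < 1 := by exact_mod_cast this
    omega
  -- The index of the vanishing factor solves $2i+1=-(2r+2J+1)$; it is a natural number because
  -- $r+2J+1\le0$.
  refine (qprod_eq_zero_iff (norm_bq_lt_one hre him) _).2 ⟨(-r - J - 1).toNat, ?_⟩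
  have hy : yGen b 1 (z, m) = bq N b ^ (2 * r + 2 * J + 1) := by
    have hm : -(((1 : ℤ) : ZMod N) * m) = ((r : ℤ) : ZMod N) := by
      rw [hr]; simp
    rw [yGen, hm, stdAddChar_intCast_eq_exp, bq_zpow, ← Complex.exp_add]
    congr 1
    have hs' : (b.re : ℂ) = (b + b⁻¹) / 2 := by rw [hsum]; ring
    rw [hz', hs']
    push_cast
    field_simp
    ring
  have hj : ((2 * (-r - J - 1).toNat + 1 : ℕ) : ℤ) = -(2 * r + 2 * J + 1) := by
    push_cast
    rw [Int.toNat_of_nonneg (by omega)]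
    ring
  rw [hy, ← zpow_natCast, hj, mul_neg, ← zpow_add₀ (bq_ne_zero N b), neg_add_cancel, zpow_zero]
  ring

theorem meromorphicOn_dilog (hb : ‖b‖ = 1) (hre : 0 < b.re) (him : 0 < b.im) (m : ZMod N) :
    MeromorphicOn (fun z => dilogNum b (z, m) / dilogDen b (z, m)) Set.univ := fun z _ =>
  ((differentiable_dilogNum hre him m).analyticAt z).meromorphicAt.div
    ((differentiable_dilogDen hb hre him m).analyticAt z).meromorphicAt

theorem dilogInv_eventuallyEq (hb : ‖b‖ = 1) (hre : 0 < b.re) (him : 0 < b.im) (m : ZMod N)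
    (z : ℂ) : ∀ᶠ w in 𝓝[≠] z, dilogInv b (w, m) = dilogNum b (w, m) / dilogDen b (w, m) :=
  (meromorphicOn_dilog hb hre him m).toMeromorphicNFOn_eq_self_on_nhdsNE (Set.mem_univ z)

theorem dilogInv_eq (hb : ‖b‖ = 1) (hre : 0 < b.re) (him : 0 < b.im) (x : ℂ × ZMod N)
    (hx : dilogDen b x ≠ 0) : dilogInv b x = dilogNum b x / dilogDen b x := by
  have ha : AnalyticAt ℂ (fun z => dilogNum b (z, x.2) / dilogDen b (z, x.2)) x.1 :=
    ((differentiable_dilogNum hre him x.2).analyticAt x.1).fun_div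
      ((differentiable_dilogDen hb hre him x.2).analyticAt x.1) hx
  rw [dilogInv, toMeromorphicNFOn_eq_toMeromorphicNFAt (meromorphicOn_dilog hb hre him x.2)
    (Set.mem_univ _), toMeromorphicNFAt_eq_self.2 ha.meromorphicNFAt]

/-- Where the denominator vanishes, numerator and denominator both have a simple zero, so the
quotient has order 0; a meromorphic function in normal form is analytic where its order is
nonnegative. -/
theorem analyticAt_dilogInv (hb : ‖b‖ = 1) (hre : 0 < b.re) (him : 0 < b.im) (m : ZMod N)
    {z : ℂ} (hz : z.im < b.re) : AnalyticAt ℂ (fun z => dilogInv b (z, m)) z := by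
  have hnum := (differentiable_dilogNum hre him m).analyticAt z
  have hden := (differentiable_dilogDen hb hre him m).analyticAt z
  have hNF := meromorphicNFOn_toMeromorphicNFOn
    (fun z => dilogNum b (z, m) / dilogDen b (z, m)) Set.univ (Set.mem_univ z)
  refine hNF.meromorphicOrderAt_nonneg_iff_analyticAt.1 ?_
  rw [meromorphicOrderAt_toMeromorphicNFOn (meromorphicOn_dilog hb hre him m) (Set.mem_univ z)]
  by_cases h0 : dilogDen b (z, m) = 0
  · have hn := dilogNum_eq_zero_of_dilogDen_eq_zero hb hre him hz h0
    have ho1 := hden.analyticOrderAt_eq_one_of_zero_deriv_ne_zero h0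
      (deriv_dilogDen_ne_zero hb hre him m h0)
    have ho2 := hnum.analyticOrderAt_eq_one_of_zero_deriv_ne_zero hn
      (deriv_dilogNum_ne_zero hb hre him m hn)
    rw [fun_meromorphicOrderAt_div hnum.meromorphicAt hden.meromorphicAt,
      hnum.meromorphicOrderAt_eq, hden.meromorphicOrderAt_eq, ho1, ho2]
    simp
  · exact (hnum.fun_div hden h0).meromorphicOrderAt_nonneg

theorem tendsto_add_const_nhdsNE (z w : ℂ) :
    Filter.Tendsto (fun u => u + w) (𝓝[≠] z) (𝓝[≠] (z + w)) := by
  refine tendsto_nhdsWithin_iff.2 ⟨?_, ?_⟩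
  · exact (Continuous.tendsto (by fun_prop) z).mono_left nhdsWithin_le_nhds
  · filter_upwards [self_mem_nhdsWithin] with u hu
    simpa using hu

theorem re_eq_of_dual (hb : ‖b‖ = 1) {β : ℂ} {ε : ℤ}
    (hβ : (β = b ∧ ε = 1) ∨ (β = b⁻¹ ∧ ε = -1)) : β.re = b.re := by
  rcases hβ with ⟨rfl, _⟩ | ⟨rfl, _⟩
  · rfl
  · rw [Complex.inv_eq_conj hb, Complex.conj_re]

/-- The difference equations of the quantum dilogarithm. -/
theorem dilogInv_shift (hb : ‖b‖ = 1) (hre : 0 < b.re) (him : 0 < b.im) {β : ℂ} {ε : ℤ}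
    (hβ : (β = b ∧ ε = 1) ∨ (β = b⁻¹ ∧ ε = -1)) (m : ZMod N) {z : ℂ} (hz : z.im < b.re) :
    dilogInv b (z - Complex.I * β, m + (ε : ZMod N))
      = (1 - (bq N β)⁻¹ * yGen β ε (z, m)) * dilogInv b (z, m) := by
  have hb0 := ne_zero_of_norm_one hb
  have hz' : (z + -(Complex.I * β)).im < b.re := by
    have := re_eq_of_dual hb hβ
    simp [this]
    linarith
  have hε : ε * ε = 1 := by rcases hβ with ⟨_, rfl⟩ | ⟨_, rfl⟩ <;> norm_num
  have c1 : ContinuousAt (fun z => dilogInv b (z - Complex.I * β, m + (ε : ZMod N))) z := by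
    have h := (analyticAt_dilogInv hb hre him (m + (ε : ZMod N)) hz').continuousAt
    rw [← sub_eq_add_neg] at h
    exact ContinuousAt.comp (f := fun z => z - Complex.I * β) h (by fun_prop)
  have c2 : ContinuousAt (fun z => (1 - (bq N β)⁻¹ * yGen β ε (z, m)) * dilogInv b (z, m)) z := by
    have h := (analyticAt_dilogInv hb hre him m hz).continuousAt
    have h' := (differentiable_yGen β ε m z).continuousAt
    fun_prop
  -- Both sides are continuous at `z`, so it is enough to compare quotients at nearby points off the
  -- removable singularities.
  refine ((c1.eventuallyEq_nhds_iff_eventuallyEq_nhdsNE c2).1 ?_).eq_of_nhds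
  filter_upwards [(tendsto_add_const_nhdsNE z (-(Complex.I * β))).eventually
    (dilogInv_eventuallyEq hb hre him (m + (ε : ZMod N)) _),
    dilogInv_eventuallyEq hb hre him m z, eventually_dilogDen_ne_zero hb hre him m z]
    with w h1 h2 h3
  rw [sub_eq_add_neg, h1, h2]
  have s1 := yGen_shift β hε (-1) (w, m)
  have hβ0 : β ≠ 0 := by rcases hβ with ⟨rfl, _⟩ | ⟨rfl, _⟩ <;> simp [hb0]
  have s2 := yGen_shift_dual hβ0 hε (-1) (w, m)
  have e1 : w + ((-1 : ℤ) : ℂ) * (Complex.I * β) = w + -(Complex.I * β) := by push_cast; ring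
  have e2 : m - ((ε * -1 : ℤ) : ZMod N) = m + (ε : ZMod N) := by push_cast; ring
  simp only [e1, e2] at s1 s2
  have hq0 := bq_ne_zero N b
  have hq0' := bq_ne_zero N b⁻¹
  -- For $\beta=b$ the numerator gains a factor and the denominator is invariant; for $\beta=b^{-1}$
  -- the denominator loses a factor and the numerator is invariant.
  rcases hβ with ⟨rfl, rfl⟩ | ⟨rfl, rfl⟩
  · have hnum : dilogNum β (w + -(Complex.I * β), m + ((1 : ℤ) : ZMod N))
        = (1 - (bq N β)⁻¹ * yGen β 1 (w, m)) * dilogNum β (w, m) := by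
      rw [dilogNum, s1, qprod_eq_mul (norm_bq_lt_one hre him), dilogNum]
      congr 1
      · rw [mul_neg_one, zpow_neg, zpow_two, mul_inv]
        field_simp
        ring
      · congr 1
        rw [mul_neg_one, zpow_neg, zpow_two]
        field_simp
    have hden : dilogDen β (w + -(Complex.I * β), m + ((1 : ℤ) : ZMod N)) = dilogDen β (w, m) := by
      rw [dilogDen, s2, dilogDen]
    rw [hnum, hden, mul_div_assoc]
  · have hnum : dilogNum b (w + -(Complex.I * b⁻¹), m + ((-1 : ℤ) : ZMod N)) = dilogNum b (w, m) := by
      rw [inv_inv, neg_neg] at s2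
      rw [dilogNum, s2, dilogNum]
    have hden : dilogDen b (w, m) = (1 - (bq N b⁻¹)⁻¹ * yGen b⁻¹ (-1) (w, m))
        * dilogDen b (w + -(Complex.I * b⁻¹), m + ((-1 : ℤ) : ZMod N)) := by
      rw [dilogDen, qprod_eq_mul (norm_bq_inv_lt_one hb hre him), dilogDen, s1]
      congr 1
      · ring
      · congr 1
        rw [mul_neg_one, zpow_neg, zpow_two, inv_pow, _root_.pow_two]
        ring
    rw [hnum]
    rw [hden] at h3 ⊢
    have h4 := left_ne_zero_of_mul h3
    rw [← mul_div_assoc, mul_div_mul_left _ _ h4]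

end Dilog

/-! ### Exponential growth of the inverse dilogarithm in horizontal strips -/

/-- Each step of length `ω` away from the central interval costs a factor `M`, and about `|x| / ω`
steps are needed. The permutation `σ` lets the discrete variable move along. -/
theorem exp_bound_of_step {ι : Type*} (g : ℝ → ι → ℝ) (σ : ι ≃ ι) {ω M X C : ℝ} (hω : 0 < ω)
    (hM : 1 ≤ M) (hX : 0 ≤ X) (hC : 0 ≤ C)
    (h0 : ∀ x i, |x| ≤ X + ω → g x i ≤ C)
    (hr : ∀ x i, X ≤ x → g (x + ω) (σ i) ≤ M * g x i)
    (hl : ∀ x i, x ≤ -X → g x i ≤ M * g (x + ω) (σ i)) :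
    ∃ A B : ℝ, 0 ≤ A ∧ 0 ≤ B ∧ ∀ x i, g x i ≤ A * Real.exp (B * |x|) := by
  have key : ∀ n : ℕ, ∀ x i, |x| ≤ X + (n + 1) * ω → g x i ≤ C * M ^ n := by
    intro n
    induction n with
    | zero => intro x i hx; simpa using h0 x i (by simpa using hx)
    | succ n ih =>
      intro x i hx
      push_cast at hx
      have hn : (0 : ℝ) ≤ n * ω := by positivity
      have hMn : C * (M * M ^ n) = M * (C * M ^ n) := by ring
      by_cases h1 : |x| ≤ X + (n + 1) * ω
      · refine (ih x i h1).trans ?_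
        gcongr
        omega
      · rw [not_le] at h1
        rw [pow_succ', hMn]
        rcases le_total 0 x with hx0 | hx0
        · rw [abs_of_nonneg hx0] at hx h1
          have h2 := hr (x - ω) (σ.symm i) (by linarith)
          rw [sub_add_cancel, Equiv.apply_symm_apply] at h2
          refine h2.trans (mul_le_mul_of_nonneg_left (ih _ _ ?_) (by linarith))
          rw [abs_of_nonneg (by linarith)]
          linarith
        · rw [abs_of_nonpos hx0] at hx h1
          refine (hl x i (by linarith)).trans (mul_le_mul_of_nonneg_left (ih _ _ ?_) (by linarith))
          rw [abs_of_nonpos (by linarith)]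
          linarith
  refine ⟨C * M, Real.log M / ω, by positivity, div_nonneg (Real.log_nonneg hM) hω.le,
    fun x i => ?_⟩
  have hM0 : 0 < M := by linarith
  have hx : |x| ≤ X + ((⌈|x| / ω⌉₊ : ℝ) + 1) * ω := by
    have := (div_le_iff₀ hω).1 (Nat.le_ceil (|x| / ω))
    linarith
  refine (key _ x i hx).trans ?_
  rw [mul_assoc]
  refine mul_le_mul_of_nonneg_left ?_ hC
  have hceil := (Nat.ceil_lt_add_one (div_nonneg (abs_nonneg x) hω.le)).le
  calc M ^ ⌈|x| / ω⌉₊ = Real.exp (⌈|x| / ω⌉₊ * Real.log M) := by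
        rw [Real.exp_nat_mul, Real.exp_log hM0]
    _ ≤ Real.exp ((|x| / ω + 1) * Real.log M) := by
        refine Real.exp_le_exp.2 (mul_le_mul_of_nonneg_right hceil (Real.log_nonneg hM))
    _ = M * Real.exp (Real.log M / ω * |x|) := by
        rw [add_mul, one_mul, Real.exp_add, Real.exp_log hM0, mul_comm]
        congr 2
        ring

/-- For large `t` one has `d * t / 2 ≤ ‖1 - v‖`, while `‖1 - u‖` is at most of order `t`, so the
ratio `P / R` stays bounded. This is the step towards $+\infty$. -/
theorem le_mul_of_norm_one_sub_right {u v : ℂ} {P R a d t M : ℝ} (hu : ‖u‖ ≤ a * t)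
    (hv : d * t ≤ ‖v‖) (h2 : 2 ≤ d * t) (ht : 1 ≤ t) (hP : 0 ≤ P) (hR : 0 ≤ R)
    (e : ‖1 - u‖ * R = ‖1 - v‖ * P) (hM : 2 * (1 + a) ≤ M * d) : P ≤ M * R := by
  have hv' : d * t / 2 ≤ ‖1 - v‖ := by
    have := norm_sub_norm_le v 1
    rw [norm_one, norm_sub_rev] at this
    linarith
  have hu' : ‖1 - u‖ ≤ 1 + a * t := by
    have := norm_sub_le 1 u
    rw [norm_one] at this
    linarith
  have hk : 2 * (1 + a) * t ≤ M * d * t := by gcongr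
  refine le_of_mul_le_mul_left ?_ (show 0 < d * t / 2 by linarith)
  calc d * t / 2 * P ≤ ‖1 - v‖ * P := by gcongr
    _ = ‖1 - u‖ * R := e.symm
    _ ≤ M * (d * t / 2) * R := by gcongr; linarith
    _ = d * t / 2 * (M * R) := by ring

/-- The step towards $-\infty$, where `u` is small and `‖1 - u‖` stays away from 0. -/
theorem le_mul_of_norm_one_sub_left {u v : ℂ} {P R a M : ℝ} (hu : ‖u‖ ≤ 1 / 2)
    (hv : ‖v‖ ≤ a) (hP : 0 ≤ P) (hR : 0 ≤ R)
    (e : ‖1 - u‖ * R = ‖1 - v‖ * P) (hM : 2 * (1 + a) ≤ M) : R ≤ M * P := by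
  have hu' : 1 / 2 ≤ ‖1 - u‖ := by
    have := norm_sub_norm_le 1 u
    rw [norm_one] at this
    linarith
  have hv' : ‖1 - v‖ ≤ 1 + a := by
    have := norm_sub_le 1 v
    rw [norm_one] at this
    linarith
  have : 1 / 2 * R ≤ (1 + a) * P := by
    calc 1 / 2 * R ≤ ‖1 - u‖ * R := by gcongr
      _ = ‖1 - v‖ * P := e
      _ ≤ _ := by gcongr
  have : 2 * (1 + a) * P ≤ M * P := by gcongr
  linarith

section Growth

variable {N : ℕ} [NeZero N] {b : ℂ}

theorem norm_yGen (β : ℂ) (ε : ℤ) (x : ℂ × ZMod N) :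
    ‖yGen β ε x‖ = Real.exp (2 * Real.pi / N * (β.re * x.1.re - β.im * x.1.im)) := by
  rw [yGen, norm_mul, norm_stdAddChar, mul_one, Complex.norm_exp]
  congr 1
  have : (2 * Real.pi / N * β * x.1 : ℂ) = ((2 * Real.pi / N : ℝ) : ℂ) * (β * x.1) := by
    push_cast; ring
  rw [this, Complex.re_ofReal_mul, Complex.mul_re]

/-- A difference equation with a real period. -/
theorem dilogInv_real_shift (hb : ‖b‖ = 1) (hre : 0 < b.re) (him : 0 < b.im) (m : ZMod N) {z : ℂ}
    (hz : z.im < b.re) :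
    (1 - (bq N b)⁻¹ * yGen b 1 (z, m)) * dilogInv b (z, m)
      = (1 - (bq N b⁻¹)⁻¹ * yGen b⁻¹ (-1) (z + (2 * b.im : ℝ), m + 2))
        * dilogInv b (z + (2 * b.im : ℝ), m + 2) := by
  -- Since $ib^{-1}-ib=2\,\mathrm{Im}\,b$, lowering $z$ by $ib$ and lowering $z+2\,\mathrm{Im}\,b$
  -- by $ib^{-1}$ lead to the same point, with residues $m+1=(m+2)-1$.
  rw [← dilogInv_shift hb hre him (Or.inl ⟨rfl, rfl⟩) m hz,
    ← dilogInv_shift hb hre him (Or.inr ⟨rfl, rfl⟩) (m + 2) (by simpa using hz)]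
  congr 2
  · rw [Complex.inv_eq_conj hb]
    apply Complex.ext <;> simp
    ring
  · push_cast; ring

theorem exists_dilogInv_bound (hb : ‖b‖ = 1) (hre : 0 < b.re) (him : 0 < b.im) (H : ℝ) :
    ∃ A B : ℝ, 0 ≤ A ∧ 0 ≤ B ∧ ∀ x : ℂ × ZMod N, -H ≤ x.1.im → x.1.im ≤ 0 →
      ‖dilogInv b x‖ ≤ A * Real.exp (B * |x.1.re|) := by
  have hκ := two_pi_div_pos N
  set κ : ℝ := 2 * Real.pi / N with hκdef
  set c := b.re with hc
  set s := b.im with hs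
  have hre' : b⁻¹.re = c := re_eq_of_dual hb (Or.inr ⟨rfl, rfl⟩)
  have him' : b⁻¹.im = -s := by rw [Complex.inv_eq_conj hb, Complex.conj_im]
  set p := ‖bq N b‖ with hp
  have hp0 : 0 < p := norm_pos_iff.2 (bq_ne_zero N b)
  have hp1 : p < 1 := norm_bq_lt_one hre him
  have hp' : ‖(bq N b⁻¹)⁻¹‖ = p := by rw [← conj_bq hb, RCLike.norm_conj]
  rcases lt_or_ge H 0 with hH | hH
  · exact ⟨0, 0, le_rfl, le_rfl, fun x h1 h2 => by linarith⟩
  set E := Real.exp (κ * (s * H)) with hE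
  have hE0 : 0 < E := Real.exp_pos _
  have n1 : ∀ x y : ℝ, ∀ m : ZMod N, -H ≤ y → y ≤ 0 →
      ‖(bq N b)⁻¹ * yGen b 1 ((x : ℂ) + y * Complex.I, m)‖ ≤ p⁻¹ * E * Real.exp (κ * c * x) := by
    intro x y m h1 h2
    rw [norm_mul, norm_inv, norm_yGen, ← hp, mul_assoc, hE, ← Real.exp_add]
    gcongr
    simp only [Complex.add_re, Complex.ofReal_re, Complex.mul_re, Complex.I_re, Complex.ofReal_im,
      Complex.I_im, Complex.add_im, Complex.mul_im]
    have : 0 ≤ κ * (s * (H + y)) := by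
      have : 0 ≤ H + y := by linarith
      positivity
    nlinarith
  have n2 : ∀ x y : ℝ, ∀ m : ZMod N,
      ‖(bq N b⁻¹)⁻¹ * yGen b⁻¹ (-1) ((x : ℂ) + y * Complex.I, m)‖
        = p * Real.exp (κ * (c * x + s * y)) := by
    intro x y m
    rw [norm_mul, hp', norm_yGen, hre', him']
    congr 2
    simp only [Complex.add_re, Complex.ofReal_re, Complex.mul_re, Complex.I_re, Complex.ofReal_im,
      Complex.I_im, Complex.add_im, Complex.mul_im]
    ring
  have n2u : ∀ x y : ℝ, ∀ m : ZMod N, y ≤ 0 →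
      ‖(bq N b⁻¹)⁻¹ * yGen b⁻¹ (-1) ((x : ℂ) + y * Complex.I, m)‖ ≤ p * Real.exp (κ * c * x) := by
    intro x y m h2
    rw [n2]
    refine mul_le_mul_of_nonneg_left (Real.exp_le_exp.2 ?_) hp0.le
    have : 0 ≤ κ * (s * -y) := by
      have : 0 ≤ -y := by linarith
      positivity
    nlinarith
  have n2l : ∀ x y : ℝ, ∀ m : ZMod N, -H ≤ y →
      p * E⁻¹ * Real.exp (κ * c * x)
        ≤ ‖(bq N b⁻¹)⁻¹ * yGen b⁻¹ (-1) ((x : ℂ) + y * Complex.I, m)‖ := by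
    intro x y m h1
    rw [n2, mul_assoc, hE, ← Real.exp_neg, ← Real.exp_add]
    gcongr
    have : 0 ≤ κ * (s * (H + y)) := by
      have : 0 ≤ H + y := by linarith
      positivity
    nlinarith
  set ω := 2 * s with hω
  have hω0 : 0 < ω := by positivity
  -- `L` is the threshold for `exp (κ * c * x)`: above it the dual exponential has modulus at least
  -- 2, below `L⁻¹` the other one has modulus at most `1 / 2`. `X` is the corresponding abscissa.
  set L := max (2 * (p⁻¹ * E)) 1 with hL
  have hL1 : 1 ≤ L := le_max_right _ _
  have hLE : 2 * (p⁻¹ * E) ≤ L := le_max_left _ _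
  set X := Real.log L / (κ * c) with hX
  have hκc : 0 < κ * c := by positivity
  have hX0 : 0 ≤ X := div_nonneg (Real.log_nonneg hL1) hκc.le
  have hXL : Real.exp (κ * c * X) = L := by
    rw [hX, mul_div_cancel₀ _ hκc.ne', Real.exp_log (by linarith)]
  have hcomp : ∀ m : ZMod N, ∃ C, ∀ z : ℂ, |z.re| ≤ X + ω → -H ≤ z.im → z.im ≤ 0 →
      ‖dilogInv b (z, m)‖ ≤ C := by
    intro m
    have hK : IsCompact (Set.Icc (-(X + ω)) (X + ω) ×ℂ Set.Icc (-H) 0) :=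
      isCompact_Icc.reProdIm isCompact_Icc
    obtain ⟨C, hC⟩ := hK.exists_bound_of_continuousOn (f := fun z => dilogInv b (z, m))
      (fun z hz => (analyticAt_dilogInv hb hre him m
        (lt_of_le_of_lt hz.2.2 hre)).continuousAt.continuousWithinAt)
    exact ⟨C, fun z h1 h2 h3 => hC z ⟨abs_le.1 h1, h2, h3⟩⟩
  choose C hC using hcomp
  set C0 := ∑ m, |C m| with hC0
  set M := 2 * (1 + p⁻¹ * E) / (p * E⁻¹) + 2 * (1 + p * Real.exp (κ * c * ω)) with hM
  have hpE : 0 < p⁻¹ * E := by positivity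
  have hpE' : 0 < p * E⁻¹ := by positivity
  have hpω : 0 < p * Real.exp (κ * c * ω) := by positivity
  have hM0 : 0 < 2 * (1 + p⁻¹ * E) / (p * E⁻¹) := by positivity
  have hMr : 2 * (1 + p⁻¹ * E) ≤ M * (p * E⁻¹) := by
    rw [← div_le_iff₀ hpE']
    linarith
  have hMl : 2 * (1 + p * Real.exp (κ * c * ω)) ≤ M := by linarith
  have hM1 : 1 ≤ M := by linarith
  have e' : ∀ x y : ℝ, (x : ℂ) + y * Complex.I + ((2 * b.im : ℝ) : ℂ)
      = ((x + ω : ℝ) : ℂ) + y * Complex.I := fun x y => by push_cast [hω]; ring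
  have eN : ∀ x y : ℝ, ∀ m : ZMod N, y ≤ 0 →
      ‖1 - (bq N b)⁻¹ * yGen b 1 ((x : ℂ) + y * Complex.I, m)‖
          * ‖dilogInv b ((x : ℂ) + y * Complex.I, m)‖
        = ‖1 - (bq N b⁻¹)⁻¹ * yGen b⁻¹ (-1) (((x + ω : ℝ) : ℂ) + y * Complex.I, m + 2)‖
          * ‖dilogInv b (((x + ω : ℝ) : ℂ) + y * Complex.I, m + 2)‖ := by
    intro x y m hy
    have e := dilogInv_real_shift hb hre him m (z := (x : ℂ) + y * Complex.I) (by simp; linarith)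
    rw [e'] at e
    rw [← norm_mul, ← norm_mul, e]
  -- The real period fixes the height but shifts the residue by 2, so all heights and residues are
  -- iterated together.
  let σ : (Set.Icc (-H) 0 × ZMod N) ≃ (Set.Icc (-H) 0 × ZMod N) :=
    (Equiv.refl _).prodCongr (Equiv.addRight 2)
  obtain ⟨A, B, hA, hB, h⟩ : ∃ A B : ℝ, 0 ≤ A ∧ 0 ≤ B ∧ ∀ (x : ℝ) (i : Set.Icc (-H) 0 × ZMod N),
      ‖dilogInv b ((x : ℂ) + (i.1 : ℝ) * Complex.I, i.2)‖ ≤ A * Real.exp (B * |x|) := by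
    refine exp_bound_of_step
      (fun x (i : Set.Icc (-H) 0 × ZMod N) => ‖dilogInv b ((x : ℂ) + (i.1 : ℝ) * Complex.I, i.2)‖)
      σ hω0 hM1 hX0 (C := C0) (Finset.sum_nonneg fun _ _ => abs_nonneg _) ?_ ?_ ?_
    · rintro x ⟨⟨y, hy1, hy2⟩, m⟩ hx
      refine (hC m _ (by simpa using hx) (by simpa using hy1) (by simpa using hy2)).trans ?_
      exact (le_abs_self _).trans (Finset.single_le_sum (f := fun m => |C m|)
        (fun _ _ => abs_nonneg _) (Finset.mem_univ m))
    · rintro x ⟨⟨y, hy1, hy2⟩, m⟩ hx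
      have hLt : L ≤ Real.exp (κ * c * x) := by rw [← hXL]; gcongr
      have hv : p * E⁻¹ * Real.exp (κ * c * x)
          ≤ ‖(bq N b⁻¹)⁻¹ * yGen b⁻¹ (-1) (((x + ω : ℝ) : ℂ) + y * Complex.I, m + 2)‖ := by
        refine le_trans ?_ (n2l (x + ω) y (m + 2) hy1)
        gcongr
        linarith
      refine le_mul_of_norm_one_sub_right (n1 x y m hy1 hy2) hv ?_ (hL1.trans hLt) (norm_nonneg _)
        (norm_nonneg _) (eN x y m hy2) hMr
      have hpEi : p * E⁻¹ * (p⁻¹ * E) = 1 := by field_simp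
      calc (2 : ℝ) = p * E⁻¹ * (2 * (p⁻¹ * E)) := by linear_combination (-2) * hpEi
        _ ≤ p * E⁻¹ * Real.exp (κ * c * x) := by gcongr; linarith
    · rintro x ⟨⟨y, hy1, hy2⟩, m⟩ hx
      have hLt : Real.exp (κ * c * x) ≤ L⁻¹ := by
        rw [← hXL, ← Real.exp_neg]; refine Real.exp_le_exp.2 ?_; nlinarith
      have hL0 : 0 < L := by linarith
      refine le_mul_of_norm_one_sub_left ((n1 x y m hy1 hy2).trans ?_)
        ((n2u (x + ω) y (m + 2) hy2).trans ?_) (norm_nonneg _) (norm_nonneg _) (eN x y m hy2) hMl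
      · calc p⁻¹ * E * Real.exp (κ * c * x) ≤ (L / 2) * L⁻¹ := by gcongr; linarith
          _ = 1 / 2 := by field_simp
      · gcongr
        linarith
  refine ⟨A, B, hA, hB, fun x h1 h2 => ?_⟩
  have := h x.1.re (⟨x.1.im, h1, h2⟩, x.2)
  simpa only [Complex.re_add_im] using this

end Growth

/-! ### Multiplication by a unimodular function -/

section Multiplication

variable {α : Type*} [MeasurableSpace α] {μ : Measure α}

theorem norm_mul_ae_eq {u : α → ℂ} (hu1 : ∀ᵐ x ∂μ, ‖u x‖ = 1) (f : α → ℂ) :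
    ∀ᵐ x ∂μ, ‖u x * f x‖ = ‖f x‖ := by
  filter_upwards [hu1] with x hx
  rw [norm_mul, hx, one_mul]

theorem memLp_unimodular_mul {u : α → ℂ} (hu : AEStronglyMeasurable u μ)
    (hu1 : ∀ᵐ x ∂μ, ‖u x‖ = 1) (f : Lp ℂ 2 μ) : MemLp (fun x => u x * f x) 2 μ :=
  (Lp.memLp f).congr_norm (hu.mul (Lp.aestronglyMeasurable f))
    ((norm_mul_ae_eq hu1 f).mono fun _ h => h.symm)

theorem exists_unimodular_mul {u : α → ℂ} (hu : AEStronglyMeasurable u μ)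
    (hu1 : ∀ᵐ x ∂μ, ‖u x‖ = 1) :
    ∃ D : Lp ℂ 2 μ ≃ₗᵢ[ℂ] Lp ℂ 2 μ, ∀ f : Lp ℂ 2 μ, D f =ᵐ[μ] fun x => u x * f x := by
  let T : (v : α → ℂ) → AEStronglyMeasurable v μ → (∀ᵐ x ∂μ, ‖v x‖ = 1) →
      (Lp ℂ 2 μ →ₗ[ℂ] Lp ℂ 2 μ) := fun v hv hv1 =>
    { toFun := fun f => (memLp_unimodular_mul hv hv1 f).toLp _
      map_add' := fun f g => by
        refine Lp.ext ?_
        filter_upwards [(memLp_unimodular_mul hv hv1 (f + g)).coeFn_toLp,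
          (memLp_unimodular_mul hv hv1 f).coeFn_toLp, (memLp_unimodular_mul hv hv1 g).coeFn_toLp,
          Lp.coeFn_add f g, Lp.coeFn_add ((memLp_unimodular_mul hv hv1 f).toLp _)
            ((memLp_unimodular_mul hv hv1 g).toLp _)] with x h1 h2 h3 h4 h5
        rw [h1, h5, Pi.add_apply, h2, h3, h4, Pi.add_apply, mul_add]
      map_smul' := fun c f => by
        refine Lp.ext ?_
        filter_upwards [(memLp_unimodular_mul hv hv1 (c • f)).coeFn_toLp,
          (memLp_unimodular_mul hv hv1 f).coeFn_toLp, Lp.coeFn_smul c f,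
          Lp.coeFn_smul c ((memLp_unimodular_mul hv hv1 f).toLp _)] with x h1 h2 h3 h4
        rw [RingHom.id_apply, h1, h4, Pi.smul_apply, h2, h3, Pi.smul_apply, smul_eq_mul,
          smul_eq_mul, mul_left_comm] }
  have hT : ∀ v hv hv1 f, T v hv hv1 f =ᵐ[μ] fun x => v x * f x := fun v hv hv1 f =>
    (memLp_unimodular_mul hv hv1 f).coeFn_toLp
  have hi : AEStronglyMeasurable (fun x => (u x)⁻¹) μ := hu.inv₀
  have hi1 : ∀ᵐ x ∂μ, ‖(u x)⁻¹‖ = 1 := by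
    filter_upwards [hu1] with x hx
    rw [norm_inv, hx, inv_one]
  refine ⟨⟨LinearEquiv.ofLinearMap (T u hu hu1) (T _ hi hi1) ?_ ?_, fun f => ?_⟩, hT u hu hu1⟩
  · refine LinearMap.ext fun f => Lp.ext ?_
    filter_upwards [hT u hu hu1 (T _ hi hi1 f), hT _ hi hi1 f, hu1] with x h1 h2 h3
    have : u x ≠ 0 := fun h => by simp [h] at h3
    rw [LinearMap.comp_apply, h1, h2, mul_inv_cancel_left₀ this, LinearMap.id_apply]
  · refine LinearMap.ext fun f => Lp.ext ?_
    filter_upwards [hT _ hi hi1 (T u hu hu1 f), hT u hu hu1 f, hu1] with x h1 h2 h3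
    have : u x ≠ 0 := fun h => by simp [h] at h3
    rw [LinearMap.comp_apply, h1, h2, inv_mul_cancel_left₀ this, LinearMap.id_apply]
  · change ‖T u hu hu1 f‖ = ‖f‖
    have h : eLpNorm (T u hu hu1 f) 2 μ = eLpNorm f 2 μ := eLpNorm_congr_norm_ae (by
      filter_upwards [hT u hu hu1 f, norm_mul_ae_eq hu1 f] with x h1 h2
      rw [h1, h2])
    rw [Lp.norm_def, Lp.norm_def, h]

end Multiplication

/-! ### The dilogarithm as a multiplication operator -/

section DilogMul

open Topology

variable {N : ℕ} [NeZero N] {b : ℂ}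

/-- Isolated zeros form a null set on the line, and $x\mapsto x_1-x_2$ pulls null sets back to null
sets. -/
theorem ae_ne_zero_of_eventually {f : ℂ × ZMod N → ℂ}
    (hf : ∀ m z, ∀ᶠ w in 𝓝[≠] z, f (w, m) ≠ 0) :
    ∀ᵐ x ∂(measure2 N), f ((x.2.1 : ℂ) - x.1.1, x.2.2 - x.1.2) ≠ 0 := by
  have h1 : ∀ᵐ x : ℝ, ∀ m : ZMod N, f ((x : ℂ), m) ≠ 0 := by
    rw [ae_all_iff]
    intro m
    have hmem : {x : ℝ | f ((x : ℂ), m) ≠ 0} ∈ Filter.codiscreteWithin (Set.univ : Set ℝ) := by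
      rw [mem_codiscreteWithin]
      intro x _
      rw [Filter.disjoint_principal_right]
      have ht : Filter.Tendsto (fun x : ℝ => (x : ℂ)) (𝓝[≠] x) (𝓝[≠] (x : ℂ)) :=
        tendsto_nhdsWithin_iff.2 ⟨(Complex.continuous_ofReal.tendsto x).mono_left
          nhdsWithin_le_nhds, by
          filter_upwards [self_mem_nhdsWithin] with u hu
          simpa using hu⟩
      filter_upwards [ht.eventually (hf m x)] with u hu
      simpa using hu
    have := ae_restrict_le_codiscreteWithin (μ := (volume : Measure ℝ)) MeasurableSet.univ hmem
    rwa [Measure.restrict_univ] at this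
  have h2 : ∀ᵐ v ∂(measure1 N), ∀ m : ZMod N, f ((v.1 : ℂ), m) ≠ 0 :=
    Measure.quasiMeasurePreserving_fst.ae h1
  have h3 := (Measure.quasiMeasurePreserving_snd.comp
    (measurePreserving_sub_snd (N := N)).quasiMeasurePreserving).ae h2
  filter_upwards [h3] with x hx
  simpa using hx (x.2.2 - x.1.2)

theorem conj_dilogNum (hb : ‖b‖ = 1) (hre : 0 < b.re) (him : 0 < b.im) (x : ℂ × ZMod N) :
    starRingEnd ℂ (dilogNum b x) = dilogDen b (starRingEnd ℂ x.1, x.2) := by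
  rw [dilogNum, conj_qprod (norm_bq_lt_one hre him), conj_bq hb, map_neg, conj_yGen hb, dilogDen]

/-- Conjugation exchanges numerator and denominator, so their quotient is unimodular on the real
line where they do not vanish. -/
theorem norm_dilogNum_eq (hb : ‖b‖ = 1) (hre : 0 < b.re) (him : 0 < b.im) (x : ℝ) (m : ZMod N) :
    ‖dilogNum b ((x : ℂ), m)‖ = ‖dilogDen b ((x : ℂ), m)‖ := by
  have h := conj_dilogNum hb hre him ((x : ℂ), m)
  rw [Complex.conj_ofReal] at h
  rw [← h, RCLike.norm_conj]

theorem qdilog_eq (x : (ℝ × ZMod N) × (ℝ × ZMod N)) :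
    qdilog N b (-(yv b ((x.2.1 : ℂ), x.2.2) * (yv b ((x.1.1 : ℂ), x.1.2))⁻¹))
      (-(yvt b ((x.2.1 : ℂ), x.2.2) * (yvt b ((x.1.1 : ℂ), x.1.2))⁻¹))
    = (dilogNum b ((x.2.1 : ℂ) - x.1.1, x.2.2 - x.1.2)
        / dilogDen b ((x.2.1 : ℂ) - x.1.1, x.2.2 - x.1.2))⁻¹ := by
  rw [yv_eq, yv_eq, yvt_eq, yvt_eq, ← yGen_sub b 1 ((x.2.1 : ℂ), x.2.2) ((x.1.1 : ℂ), x.1.2),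
    ← yGen_sub b⁻¹ (-1) ((x.2.1 : ℂ), x.2.2) ((x.1.1 : ℂ), x.1.2)]
  rfl

theorem measurable_of_differentiable_slices {f : ℂ × ZMod N → ℂ}
    (hf : ∀ m, Differentiable ℂ fun z => f (z, m)) : Measurable f :=
  measurable_from_prod_countable_left fun m => (hf m).continuous.measurable

theorem existsUnique_isDilogMul (hb : ‖b‖ = 1) (hre : 0 < b.re) (him : 0 < b.im) :
    ∃! D : H2 N ≃ₗᵢ[ℂ] H2 N, IsDilogMul b D := by
  have hn := measurable_of_differentiable_slices (N := N) (differentiable_dilogNum hre him)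
  have hd := measurable_of_differentiable_slices (N := N) (differentiable_dilogDen hb hre him)
  have hsub : Measurable fun x : (ℝ × ZMod N) × (ℝ × ZMod N) =>
      (((x.2.1 : ℂ) - x.1.1, x.2.2 - x.1.2) : ℂ × ZMod N) := by fun_prop
  obtain ⟨D, hD⟩ := exists_unimodular_mul (μ := measure2 N)
    (u := fun x => qdilog N b (-(yv b ((x.2.1 : ℂ), x.2.2) * (yv b ((x.1.1 : ℂ), x.1.2))⁻¹))
      (-(yvt b ((x.2.1 : ℂ), x.2.2) * (yvt b ((x.1.1 : ℂ), x.1.2))⁻¹)))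
    (by
      simp only [qdilog_eq]
      exact ((hn.comp hsub).div (hd.comp hsub)).inv.aestronglyMeasurable)
    (by
      filter_upwards [ae_ne_zero_of_eventually (eventually_dilogDen_ne_zero hb hre him)] with x hx
      rw [qdilog_eq, norm_inv, norm_div]
      have h := norm_dilogNum_eq hb hre him (x.2.1 - x.1.1) (x.2.2 - x.1.2)
      rw [Complex.ofReal_sub] at h
      rw [h, div_self (norm_ne_zero_iff.2 hx), inv_one])
  exact ⟨D, hD, fun D' hD' => LinearIsometryEquiv.ext fun f =>
    Lp.ext ((hD' f).trans (hD f).symm)⟩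

theorem IsDilogMul.symm_apply (hb : ‖b‖ = 1) (hre : 0 < b.re) (him : 0 < b.im)
    {D : H2 N ≃ₗᵢ[ℂ] H2 N} (hD : IsDilogMul b D) (f : H2 N) :
    D.symm f =ᵐ[measure2 N]
      fun x => dilogInv b ((x.2.1 : ℂ) - x.1.1, x.2.2 - x.1.2) * f x := by
  have h := hD (D.symm f)
  rw [LinearIsometryEquiv.apply_symm_apply] at h
  filter_upwards [h, ae_ne_zero_of_eventually (eventually_dilogDen_ne_zero hb hre him),
    ae_ne_zero_of_eventually (eventually_dilogNum_ne_zero hb hre him)] with x h1 h2 h3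
  rw [h1, qdilog_eq, dilogInv_eq hb hre him _ h2, mul_inv_cancel_left₀ (div_ne_zero h3 h2)]

end DilogMul

/-! ### Contour shifts against the inverse dilogarithm -/

section Pairing

variable {N : ℕ} [NeZero N] {b : ℂ}

/-- The integral of `G` against the inverse dilogarithm of `x₁ - x₂`, shifted `j` times. -/
def dilogPair (b β : ℂ) (ε : ℤ) (j : ℕ) (G : Fun2 N) : ℂ :=
  ∫ x, dilogInv b ((x.2.1 : ℂ) - x.1.1 - (j : ℂ) * (Complex.I * β), x.2.2 - x.1.2 + (j : ZMod N) * (ε : ZMod N))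
    * restrict G x ∂(measure2 N)

/-- The exponential growth of the dilogarithm has some rate `B`, and `G` decreases at rate `B + 1`.
This bound justifies all contour shifts and Fubini exchanges below. -/
theorem IsRapid.dilog_bound (hb : ‖b‖ = 1) (hre : 0 < b.re) (him : 0 < b.im) {G : Fun2 N}
    (hG : IsRapid G) (H S : ℝ) (w : ℂ) :
    ∃ C : ℝ, 0 ≤ C ∧ ∀ (x : (ℂ × ZMod N) × (ℂ × ZMod N)) (m : ZMod N), |x.1.1.im| ≤ S →
      |x.2.1.im| ≤ S → -H ≤ (x.2.1 - x.1.1 - w).im → (x.2.1 - x.1.1 - w).im ≤ 0 →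
      ‖dilogInv b (x.2.1 - x.1.1 - w, m) * G x‖
        ≤ C * (Real.exp (-|x.1.1.re|) * Real.exp (-|x.2.1.re|)) := by
  obtain ⟨A, B, hA, hB, hΦ⟩ := exists_dilogInv_bound (N := N) hb hre him H
  obtain ⟨C, hC0, hC⟩ := hG.bound (B + 1) S
  refine ⟨A * C * Real.exp (B * |w.re|), by positivity, fun x m h2 h1 h3 h4 => ?_⟩
  have hre' : |(x.2.1 - x.1.1 - w).re| ≤ |x.1.1.re| + |x.2.1.re| + |w.re| := by
    simp only [Complex.sub_re]
    have e1 := abs_sub (x.2.1.re - x.1.1.re) w.re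
    have e2 := abs_sub x.2.1.re x.1.1.re
    linarith
  rw [norm_mul]
  calc ‖dilogInv b (x.2.1 - x.1.1 - w, m)‖ * ‖G x‖
      ≤ (A * Real.exp (B * (|x.1.1.re| + |x.2.1.re| + |w.re|)))
        * (C * Real.exp (-((B + 1) * (|x.1.1.re| + |x.2.1.re|)))) := by
        refine mul_le_mul ((hΦ (x.2.1 - x.1.1 - w, m) h3 h4).trans ?_) (hC x h2 h1) (norm_nonneg _)
          (by positivity)
        gcongr
    _ = A * C * (Real.exp (B * (|x.1.1.re| + |x.2.1.re| + |w.re|))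
        * Real.exp (-((B + 1) * (|x.1.1.re| + |x.2.1.re|)))) := by ring
    _ = A * C * Real.exp (B * |w.re|) * (Real.exp (-|x.1.1.re|) * Real.exp (-|x.2.1.re|)) := by
        rw [mul_assoc (A * C), ← Real.exp_add, ← Real.exp_add, ← Real.exp_add]
        congr 2
        ring

theorem natCast_mul_im {β : ℂ} (hβ : β.re = b.re) (j : ℕ) :
    ((j : ℂ) * (Complex.I * β)).im = j * b.re := by
  simp [hβ]

theorem isDec_dilogPair (hb : ‖b‖ = 1) (hre : 0 < b.re) (him : 0 < b.im) {β : ℂ}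
    (hβ : β.re = b.re) (ε : ℤ) (j : ℕ) {G : Fun2 N} (hG : IsRapid G) :
    IsDec fun x : (ℝ × ZMod N) × (ℝ × ZMod N) =>
      dilogInv b ((x.2.1 : ℂ) - x.1.1 - (j : ℂ) * (Complex.I * β), x.2.2 - x.1.2 + (j : ZMod N) * (ε : ZMod N))
        * restrict G x := by
  have hj : 0 ≤ (j : ℝ) * b.re := by positivity
  refine ⟨fun m₂ m₁ => ?_, ?_⟩
  · refine Continuous.mul ?_ (hG.isDec.cont m₂ m₁)
    rw [continuous_iff_continuousAt]
    intro p
    have h := (analyticAt_dilogInv hb hre him (m₁ - m₂ + (j : ZMod N) * (ε : ZMod N))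
      (z := (p.2 : ℂ) - p.1 - (j : ℂ) * (Complex.I * β)) (by
        rw [Complex.sub_im, natCast_mul_im hβ]; simp; linarith)).continuousAt
    exact ContinuousAt.comp (f := fun p : ℝ × ℝ => (p.2 : ℂ) - p.1 - (j : ℂ) * (Complex.I * β)) h
      (by fun_prop)
  · obtain ⟨C, -, hC⟩ := hG.dilog_bound hb hre him (j * b.re) 0 (j * (Complex.I * β))
    refine ⟨C, fun x => ?_⟩
    have := hC (((x.1.1 : ℂ), x.1.2), ((x.2.1 : ℂ), x.2.2)) (x.2.2 - x.1.2 + (j : ZMod N) * (ε : ZMod N))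
      (by simp) (by simp) (by rw [Complex.sub_im, natCast_mul_im hβ]; simp)
      (by rw [Complex.sub_im, natCast_mul_im hβ]; simpa using hj)
    simpa [restrict] using this

/-- Moving the contour of $x_2$ up by $i\beta$ lowers $x_1-x_2$ by $i\beta$, away from the poles;
the residue $m_2$ is reindexed by $\varepsilon$ at the same time. -/
theorem dilogPair_shift_fst (hb : ‖b‖ = 1) (hre : 0 < b.re) (him : 0 < b.im) {β : ℂ}
    (hβ : β.re = b.re) (ε : ℤ) (j : ℕ) {G : Fun2 N} (hG : IsRapid G) :
    dilogPair b β ε j G = dilogPair b β ε (j + 1) (weyl2 N β ε 1 0 0 0 G) := by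
  have hj : 0 ≤ (j : ℝ) * b.re := by positivity
  rw [dilogPair, (isDec_dilogPair hb hre him hβ ε j hG).integral_eq_swap, dilogPair,
    (isDec_dilogPair hb hre him hβ ε (j + 1) (hG.weyl2 β ε 1 0 0 0)).integral_eq_swap,
    ← Equiv.sum_comp (Equiv.addRight (ε : ZMod N)) (fun m₂ => ∑ m₁, ∫ x₁ : ℝ, ∫ x₂ : ℝ,
    dilogInv b ((x₁ : ℂ) - x₂ - ((j + 1 : ℕ) : ℂ) * (Complex.I * β),
      m₁ - m₂ + ((j + 1 : ℕ) : ZMod N) * (ε : ZMod N))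
      * restrict (weyl2 N β ε 1 0 0 0 G) ((x₂, m₂), (x₁, m₁)))]
  refine Finset.sum_congr rfl fun m₂ _ => Finset.sum_congr rfl fun m₁ _ => ?_
  congr 1
  funext x₁
  -- The argument of the dilogarithm starts at height `-j * b.re` and is lowered by up to `b.re`
  -- more; `G` is evaluated at heights up to `b.re`.
  obtain ⟨C, hC0, hC⟩ := hG.dilog_bound hb hre him ((j + 1) * b.re) b.re (j * (Complex.I * β))
  have him' : (Complex.I * β).im = b.re := by simp [hβ]
  have h := integral_eq_integral_add
    (fun z => dilogInv b ((x₁ : ℂ) - z - (j : ℂ) * (Complex.I * β), m₁ - m₂ + (j : ZMod N) * (ε : ZMod N))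
      * G ((z, m₂), ((x₁ : ℂ), m₁))) (Complex.I * β) C ?_ ?_
  · simp only [restrict]
    refine h.trans (integral_congr_ae (Filter.Eventually.of_forall fun x₂ => ?_))
    simp only [weyl2_apply, Equiv.coe_addRight]
    have e1 : (x₁ : ℂ) - ((x₂ : ℂ) + Complex.I * β) - (j : ℂ) * (Complex.I * β)
        = x₁ - x₂ - ((j + 1 : ℕ) : ℂ) * (Complex.I * β) := by push_cast; ring
    have e2 : m₁ - m₂ + (j : ZMod N) * (ε : ZMod N)
        = m₁ - (m₂ + (ε : ZMod N)) + ((j + 1 : ℕ) : ZMod N) * (ε : ZMod N) := by push_cast; ring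
    rw [e1, e2]
    simp
  · intro z hz
    rw [him', Set.uIcc_of_le hre.le] at hz
    refine DifferentiableAt.differentiableWithinAt (DifferentiableAt.mul ?_
      (hG.differentiable_fst m₂ ((x₁ : ℂ), m₁) z))
    have ha := (analyticAt_dilogInv hb hre him (m₁ - m₂ + (j : ZMod N) * (ε : ZMod N))
      (z := (x₁ : ℂ) - z - (j : ℂ) * (Complex.I * β)) (by
        rw [Complex.sub_im, natCast_mul_im hβ]
        have := hz.1
        simp
        linarith)).differentiableAt
    exact DifferentiableAt.comp (f := fun z : ℂ => (x₁ : ℂ) - z - (j : ℂ) * (Complex.I * β)) z ha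
      (by fun_prop)
  · intro z hz
    rw [him', Set.uIcc_of_le hre.le] at hz
    have h1 := hz.1
    have h2 := hz.2
    refine (hC ((z, m₂), ((x₁ : ℂ), m₁)) (m₁ - m₂ + (j : ZMod N) * (ε : ZMod N)) ?_ ?_ ?_ ?_).trans ?_
    · rw [abs_of_nonneg h1]; exact h2
    · simpa using hre.le
    · rw [Complex.sub_im, natCast_mul_im hβ]; simp; linarith
    · rw [Complex.sub_im, natCast_mul_im hβ]; simp; linarith
    · gcongr
      exact mul_le_of_le_one_right (Real.exp_nonneg _) (by simp)

/-- The other way to lower $x_1-x_2$: the contour of $x_1$ moves down. -/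
theorem dilogPair_shift_snd (hb : ‖b‖ = 1) (hre : 0 < b.re) (him : 0 < b.im) {β : ℂ}
    (hβ : β.re = b.re) (ε : ℤ) (j : ℕ) {G : Fun2 N} (hG : IsRapid G) :
    dilogPair b β ε j G = dilogPair b β ε (j + 1) (weyl2 N β ε 0 0 (-1) 0 G) := by
  have hj : 0 ≤ (j : ℝ) * b.re := by positivity
  rw [dilogPair, (isDec_dilogPair hb hre him hβ ε j hG).integral_eq, dilogPair,
    (isDec_dilogPair hb hre him hβ ε (j + 1) (hG.weyl2 β ε 0 0 (-1) 0)).integral_eq]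
  refine Finset.sum_congr rfl fun m₂ _ => ?_
  rw [← Equiv.sum_comp (Equiv.subRight (ε : ZMod N)) (fun m₁ => ∫ x₂ : ℝ, ∫ x₁ : ℝ,
    dilogInv b ((x₁ : ℂ) - x₂ - ((j + 1 : ℕ) : ℂ) * (Complex.I * β),
      m₁ - m₂ + ((j + 1 : ℕ) : ZMod N) * (ε : ZMod N))
      * restrict (weyl2 N β ε 0 0 (-1) 0 G) ((x₂, m₂), (x₁, m₁)))]
  refine Finset.sum_congr rfl fun m₁ _ => ?_
  congr 1
  funext x₂
  obtain ⟨C, hC0, hC⟩ := hG.dilog_bound hb hre him ((j + 1) * b.re) b.re (j * (Complex.I * β))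
  have him' : (-(Complex.I * β)).im = -b.re := by simp [hβ]
  have hle : -b.re ≤ 0 := by linarith
  have h := integral_eq_integral_add
    (fun z => dilogInv b (z - (x₂ : ℂ) - (j : ℂ) * (Complex.I * β), m₁ - m₂ + (j : ZMod N) * (ε : ZMod N))
      * G (((x₂ : ℂ), m₂), (z, m₁))) (-(Complex.I * β)) C ?_ ?_
  · simp only [restrict]
    refine h.trans (integral_congr_ae (Filter.Eventually.of_forall fun x₁ => ?_))
    simp only [weyl2_apply, Equiv.subRight_apply]
    have e1 : ((x₁ : ℂ) + -(Complex.I * β)) - (x₂ : ℂ) - (j : ℂ) * (Complex.I * β)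
        = x₁ - x₂ - ((j + 1 : ℕ) : ℂ) * (Complex.I * β) := by push_cast; ring
    have e2 : m₁ - m₂ + (j : ZMod N) * (ε : ZMod N)
        = m₁ - (ε : ZMod N) - m₂ + ((j + 1 : ℕ) : ZMod N) * (ε : ZMod N) := by push_cast; ring
    rw [e1, e2]
    simp
  · intro z hz
    rw [him', Set.uIcc_of_ge hle] at hz
    refine DifferentiableAt.differentiableWithinAt (DifferentiableAt.mul ?_
      (hG.differentiable_snd ((x₂ : ℂ), m₂) m₁ z))
    have ha := (analyticAt_dilogInv hb hre him (m₁ - m₂ + (j : ZMod N) * (ε : ZMod N))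
      (z := z - (x₂ : ℂ) - (j : ℂ) * (Complex.I * β)) (by
        rw [Complex.sub_im, natCast_mul_im hβ]
        have := hz.2
        simp
        linarith)).differentiableAt
    exact DifferentiableAt.comp (f := fun z : ℂ => z - (x₂ : ℂ) - (j : ℂ) * (Complex.I * β)) z ha
      (by fun_prop)
  · intro z hz
    rw [him', Set.uIcc_of_ge hle] at hz
    have h1 := hz.1
    have h2 := hz.2
    refine (hC (((x₂ : ℂ), m₂), (z, m₁)) (m₁ - m₂ + (j : ZMod N) * (ε : ZMod N)) ?_ ?_ ?_ ?_).trans ?_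
    · simpa using hre.le
    · rw [abs_of_nonpos h2]; linarith
    · rw [Complex.sub_im, natCast_mul_im hβ]; simp; linarith
    · rw [Complex.sub_im, natCast_mul_im hβ]; simp; linarith
    · gcongr
      exact mul_le_of_le_one_left (Real.exp_nonneg _) (by simp)

/-- The products `∏_{l < j} (1 - q^{-1-2l} Z)`. -/
def qfac (q : ℂ) (Z : Module.End ℂ (Fun2 N)) : ℕ → Module.End ℂ (Fun2 N)
  | 0 => 1
  | j + 1 => qfac q Z j * (1 - q ^ (-(1 + 2 * j) : ℤ) • Z)

theorem qfac_succ_apply (q : ℂ) (Z : Module.End ℂ (Fun2 N)) (j : ℕ) (f : Fun2 N) :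
    qfac q Z (j + 1) f = qfac q Z j (f + (-q ^ (-(1 + 2 * j) : ℤ)) • Z f) := by
  rw [qfac, Module.End.mul_apply]
  congr 1
  rw [LinearMap.sub_apply, LinearMap.smul_apply, Module.End.one_apply, neg_smul, sub_eq_add_neg]

/-- The difference equation at $x_1-x_2-ij\beta$, where $y$ equals $\mathbf q^{-2j}y_1y_2^{-1}$;
this is the origin of the exponents $-(1+2j)$ in `qfac`. -/
theorem dilogPair_succ (hb : ‖b‖ = 1) (hre : 0 < b.re) (him : 0 < b.im) {β : ℂ} {ε : ℤ}
    (hβ : (β = b ∧ ε = 1) ∨ (β = b⁻¹ ∧ ε = -1)) (j : ℕ) (G : Fun2 N) :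
    dilogPair b β ε (j + 1) G = dilogPair b β ε j
      (G + (-bq N β ^ (-(1 + 2 * j) : ℤ)) • weyl2 N β ε 0 (-1) 0 1 G) := by
  have hβr := re_eq_of_dual hb hβ
  have hε : ε * ε = 1 := by rcases hβ with ⟨_, rfl⟩ | ⟨_, rfl⟩ <;> norm_num
  have hj : 0 ≤ (j : ℝ) * b.re := by positivity
  rw [dilogPair, dilogPair]
  congr 1
  funext x
  have h := dilogInv_shift hb hre him hβ (x.2.2 - x.1.2 + (j : ZMod N) * (ε : ZMod N))
    (z := (x.2.1 : ℂ) - x.1.1 - (j : ℂ) * (Complex.I * β)) (by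
      rw [Complex.sub_im, natCast_mul_im hβr]; simp; linarith)
  have e1 : (x.2.1 : ℂ) - x.1.1 - (j : ℂ) * (Complex.I * β) - Complex.I * β
      = (x.2.1 : ℂ) - x.1.1 - ((j + 1 : ℕ) : ℂ) * (Complex.I * β) := by push_cast; ring
  have e2 : x.2.2 - x.1.2 + (j : ZMod N) * (ε : ZMod N) + (ε : ZMod N)
      = x.2.2 - x.1.2 + ((j + 1 : ℕ) : ZMod N) * (ε : ZMod N) := by push_cast; ring
  have e3 : (x.2.1 : ℂ) - x.1.1 - (j : ℂ) * (Complex.I * β)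
      = (x.2.1 : ℂ) - x.1.1 + ((-j : ℤ) : ℂ) * (Complex.I * β) := by push_cast; ring
  have e4 : x.2.2 - x.1.2 + (j : ZMod N) * (ε : ZMod N)
      = x.2.2 - x.1.2 - ((ε * (-j) : ℤ) : ZMod N) := by push_cast; ring
  have hy : yGen β ε ((x.2.1 : ℂ) - x.1.1 - (j : ℂ) * (Complex.I * β), x.2.2 - x.1.2 + (j : ZMod N) * (ε : ZMod N))
      = bq N β ^ (2 * (-j) : ℤ) * (yGen β ε ((x.2.1 : ℂ), x.2.2)
        * (yGen β ε ((x.1.1 : ℂ), x.1.2))⁻¹) := by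
    rw [e3, e4, yGen_shift β hε (-j) ((x.2.1 : ℂ) - x.1.1, x.2.2 - x.1.2),
      yGen_sub β ε ((x.2.1 : ℂ), x.2.2) ((x.1.1 : ℂ), x.1.2)]
  rw [e1, e2, hy] at h
  have hq : bq N β ^ (-(1 + 2 * j) : ℤ) = (bq N β)⁻¹ * bq N β ^ (2 * (-j) : ℤ) := by
    rw [← zpow_neg_one, ← zpow_add₀ (bq_ne_zero N β)]
    congr 1
    ring
  rw [h]
  simp only [restrict, Pi.add_apply, Pi.smul_apply, weyl2_apply, smul_eq_mul, hq]
  simp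
  ring

theorem dilogPair_eq_qfac (hb : ‖b‖ = 1) (hre : 0 < b.re) (him : 0 < b.im) {β : ℂ} {ε : ℤ}
    (hβ : (β = b ∧ ε = 1) ∨ (β = b⁻¹ ∧ ε = -1)) (j : ℕ) (G : Fun2 N) :
    dilogPair b β ε j G
      = dilogPair b β ε 0 (qfac (bq N β) (weyl2 N β ε 0 (-1) 0 1) j G) := by
  induction j generalizing G with
  | zero => rfl
  | succ j ih => rw [dilogPair_succ hb hre him hβ, ih, qfac_succ_apply]

theorem weyl2_mul_left (β : ℂ) (ε k₂ k₁ : ℤ) (g f : Fun2 N) :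
    weyl2 N β ε 0 k₂ 0 k₁ (fun x => g x * f x) = fun x => g x * weyl2 N β ε 0 k₂ 0 k₁ f x := by
  funext x
  simp only [weyl2_apply]
  simp
  ring

theorem qfac_mul_left (q β : ℂ) (ε k₂ k₁ : ℤ) (j : ℕ) (g f : Fun2 N) :
    qfac q (weyl2 N β ε 0 k₂ 0 k₁) j (fun x => g x * f x)
      = fun x => g x * qfac q (weyl2 N β ε 0 k₂ 0 k₁) j f x := by
  induction j generalizing f with
  | zero => rfl
  | succ j ih =>
    rw [qfac_succ_apply, qfac_succ_apply, weyl2_mul_left, ← ih]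
    congr 1
    funext x
    simp only [Pi.add_apply, Pi.smul_apply, smul_eq_mul]
    ring

theorem isRapid_qfac {q : ℂ} {Z : Module.End ℂ (Fun2 N)} (hZ : ∀ f, IsRapid f → IsRapid (Z f))
    (j : ℕ) {f : Fun2 N} (hf : IsRapid f) : IsRapid (qfac q Z j f) := by
  induction j generalizing f with
  | zero => exact hf
  | succ j ih =>
    rw [qfac_succ_apply]
    exact ih (hf.add ((hZ f hf).smul _))

theorem inner_dilogMul_symm (hb : ‖b‖ = 1) (hre : 0 < b.re) (him : 0 < b.im)
    {D : H2 N ≃ₗᵢ[ℂ] H2 N} (hD : IsDilogMul b D) (β : ℂ) (ε : ℤ) {h f : Fun2 N} (hh : IsRapid h)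
    (hf : IsRapid f) :
    inner ℂ (toH2 h) (D.symm (toH2 f)) = dilogPair b β ε 0 (fun x => starFun h x * f x) := by
  rw [L2.inner_def, dilogPair]
  refine integral_congr_ae ?_
  filter_upwards [coeFn_toH2 hh, coeFn_toH2 hf, hD.symm_apply hb hre him (toH2 f)] with x h1 h2 h3
  rw [h3, h1, h2, RCLike.inner_apply, restrict_starFun_mul]
  simp
  ring

/-- Moving a Weyl operator across the pairing produces a complex translation. -/
theorem starFun_weyl2_mul {β : ℂ} (hβ : ‖β‖ = 1) {ε : ℤ} (hε : ε * ε = 1) (a₂ k₂ a₁ k₁ : ℤ)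
    (h f : Fun2 N) :
    (fun x => starFun (weyl2 N β⁻¹ (-ε) a₂ k₂ a₁ k₁ h) x * f x)
      = weyl2 N β ε (-a₂) 0 (-a₁) 0
        (fun x => starFun h x * weyl2 N β ε a₂ k₂ a₁ k₁ f x) := by
  have hβ0 := ne_zero_of_norm_one hβ
  have hq := bq_ne_zero N β
  funext x
  have hc : (bq N β)⁻¹ = starRingEnd ℂ (bq N β⁻¹) := by
    rw [conj_bq (by rw [norm_inv, hβ, inv_one]), inv_inv]
  have hy : ∀ v : ℂ × ZMod N, starRingEnd ℂ (yGen β⁻¹ (-ε) (starRingEnd ℂ v.1, v.2)) = yGen β ε v := by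
    intro v
    rw [conj_yGen (by rw [norm_inv, hβ, inv_one]), inv_inv, neg_neg, Complex.conj_conj]
  have es : ∀ (z : ℂ) (a : ℤ), starRingEnd ℂ (z + ((-a : ℤ) : ℂ) * (Complex.I * β))
      = starRingEnd ℂ z + a * (Complex.I * β⁻¹) := by
    intro z a
    rw [Complex.inv_eq_conj hβ]
    simp
  have em : ∀ (m : ZMod N) (a : ℤ), m - ((-ε * a : ℤ) : ZMod N) = m - ((ε * -a : ℤ) : ZMod N) :=
    fun m a => by push_cast; ring
  have ez : ∀ (z : ℂ) (a : ℤ), z + ((-a : ℤ) : ℂ) * (Complex.I * β) + a * (Complex.I * β) = z :=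
    fun z a => by push_cast; ring
  have en : ∀ (m : ZMod N) (a : ℤ), m - ((ε * -a : ℤ) : ZMod N) - ((ε * a : ℤ) : ZMod N) = m :=
    fun m a => by push_cast; ring
  simp only [starFun, weyl2_apply, map_mul, map_zpow₀, hy, ← hc, es, em, yGen_shift β hε, ez, en,
    mul_zero, add_zero, zpow_zero, one_mul]
  rw [mul_zpow, mul_zpow, ← zpow_mul, ← zpow_mul, inv_zpow]
  have hexp : (bq N β ^ (a₂ * k₂ + a₁ * k₁))⁻¹ = bq N β ^ (a₂ * k₂ + a₁ * k₁)
      * (bq N β ^ (2 * -a₂ * k₂) * bq N β ^ (2 * -a₁ * k₁)) := by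
    rw [← zpow_neg, ← zpow_add₀ hq, ← zpow_add₀ hq]
    congr 1
    ring
  rw [hexp]
  ring

theorem weyl2_weyl2_zero (β : ℂ) {ε : ℤ} (hε : ε * ε = 1) (a₂ a₁ a₂' a₁' : ℤ) (f : Fun2 N) :
    weyl2 N β ε a₂ 0 a₁ 0 (weyl2 N β ε a₂' 0 a₁' 0 f)
      = weyl2 N β ε (a₂ + a₂') 0 (a₁ + a₁') 0 f := by
  rw [← Module.End.mul_apply, weyl2_mul β hε]
  simp

/-- The translations for which the contour may be moved, and the number of resulting shifts. -/
theorem dilogPair_weyl2 (hb : ‖b‖ = 1) (hre : 0 < b.re) (him : 0 < b.im) {β : ℂ} {ε : ℤ}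
    (hβ : (β = b ∧ ε = 1) ∨ (β = b⁻¹ ∧ ε = -1)) {a₂ a₁ : ℤ} {j : ℕ}
    (ha : (a₂ = 1 ∧ a₁ = 1 ∧ j = 0) ∨ (a₂ = -1 ∧ a₁ = -1 ∧ j = 0) ∨ (a₂ = 1 ∧ a₁ = 0 ∧ j = 1) ∨
      (a₂ = 0 ∧ a₁ = -1 ∧ j = 1) ∨ (a₂ = 1 ∧ a₁ = -1 ∧ j = 2)) {G : Fun2 N} (hG : IsRapid G) :
    dilogPair b β ε 0 (weyl2 N β ε (-a₂) 0 (-a₁) 0 G) = dilogPair b β ε j G := by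
  have hβr := re_eq_of_dual hb hβ
  have hε : ε * ε = 1 := by rcases hβ with ⟨_, rfl⟩ | ⟨_, rfl⟩ <;> norm_num
  have s2 := fun j {F : Fun2 N} (hF : IsRapid F) => dilogPair_shift_fst hb hre him hβr ε j hF
  have s1 := fun j {F : Fun2 N} (hF : IsRapid F) => dilogPair_shift_snd hb hre him hβr ε j hF
  have r := fun a₂ a₁ => hG.weyl2 β ε a₂ 0 a₁ 0
  have z : weyl2 N β ε 0 0 0 0 G = G := by rw [weyl2_zero]; rfl
  rcases ha with ⟨rfl, rfl, rfl⟩ | ⟨rfl, rfl, rfl⟩ | ⟨rfl, rfl, rfl⟩ | ⟨rfl, rfl, rfl⟩ |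
    ⟨rfl, rfl, rfl⟩
  -- When $x_1$ and $x_2$ move together the argument of the dilogarithm is unchanged, but not during
  -- the motion. Both sides are therefore lowered to level 1, so that no contour is raised towards
  -- the poles.
  · rw [s2 0 (r _ _), s1 0 hG, weyl2_weyl2_zero β hε]
    norm_num
  · rw [s1 0 (r _ _), s2 0 hG, weyl2_weyl2_zero β hε]
    norm_num
  · rw [s2 0 (r _ _), weyl2_weyl2_zero β hε]
    norm_num [z]
  · rw [s1 0 (r _ _), weyl2_weyl2_zero β hε]
    norm_num [z]
  · rw [s2 0 (r _ _), s1 _ ((r _ _).weyl2 _ _ _ _ _ _), weyl2_weyl2_zero β hε,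
      weyl2_weyl2_zero β hε]
    norm_num [z]

/-- Weak form of the commutation of Weyl operators with $\varphi^{-1}$: the Weyl operator becomes a
translation of the integrand, the translation becomes `j` lowerings, and each lowering gives a
factor of `qfac`. These factors are multiplications, so they pass the conjugated test function. -/
theorem inner_weyl2_dilogMul_symm (hb : ‖b‖ = 1) (hre : 0 < b.re) (him : 0 < b.im)
    {D : H2 N ≃ₗᵢ[ℂ] H2 N} (hD : IsDilogMul b D) {β : ℂ} {ε : ℤ}
    (hβ : (β = b ∧ ε = 1) ∨ (β = b⁻¹ ∧ ε = -1)) {a₂ a₁ : ℤ} {j : ℕ} (k₂ k₁ : ℤ)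
    (ha : (a₂ = 1 ∧ a₁ = 1 ∧ j = 0) ∨ (a₂ = -1 ∧ a₁ = -1 ∧ j = 0) ∨ (a₂ = 1 ∧ a₁ = 0 ∧ j = 1) ∨
      (a₂ = 0 ∧ a₁ = -1 ∧ j = 1) ∨ (a₂ = 1 ∧ a₁ = -1 ∧ j = 2)) {h f : Fun2 N} (hh : IsRapid h)
    (hf : IsRapid f) :
    inner ℂ (toH2 (weyl2 N β⁻¹ (-ε) a₂ k₂ a₁ k₁ h)) (D.symm (toH2 f))
      = inner ℂ (toH2 h) (D.symm (toH2 (qfac (bq N β) (weyl2 N β ε 0 (-1) 0 1) j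
        (weyl2 N β ε a₂ k₂ a₁ k₁ f)))) := by
  have hε : ε * ε = 1 := by rcases hβ with ⟨_, rfl⟩ | ⟨_, rfl⟩ <;> norm_num
  have hβn : ‖β‖ = 1 := by rcases hβ with ⟨rfl, _⟩ | ⟨rfl, _⟩ <;> simp [hb]
  have hE := hf.weyl2 β ε a₂ k₂ a₁ k₁
  rw [inner_dilogMul_symm hb hre him hD β ε (hh.weyl2 _ _ _ _ _ _) hf,
    inner_dilogMul_symm hb hre him hD β ε hh
      (isRapid_qfac (fun g hg => hg.weyl2 β ε 0 (-1) 0 1) j hE),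
    starFun_weyl2_mul hβn hε, dilogPair_weyl2 hb hre him hβ ha (hh.starFun.mul hE),
    dilogPair_eq_qfac hb hre him hβ, qfac_mul_left]

end Pairing

/-! ### Conjugation of the Weyl operators -/

section Conjugation

variable {N : ℕ} [NeZero N] {b : ℂ}

/-- Translations of $\mu_1$ commute with the substitution, while $y(\mu_1-\mu_2)=y_1y_2^{-1}$ brings
in $e^{-k\mathbf Y_2}$. -/
theorem shear_weyl2 (β : ℂ) (ε a k : ℤ) (f : Fun2 N) :
    shear (weyl2 N β ε 0 0 a k f) = weyl2 N β ε 0 (-k) a k (shear f) := by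
  funext x
  have e1 : x.2.1 - x.1.1 + a * (Complex.I * β) = x.2.1 + a * (Complex.I * β) - x.1.1 := by ring
  have e2 : x.2.2 - x.1.2 - ((ε * a : ℤ) : ZMod N) = x.2.2 - ((ε * a : ℤ) : ZMod N) - x.1.2 := by
    ring
  simp only [shear, weyl2_apply, yGen_sub β ε x.2 x.1, e1, e2, mul_zpow]
  simp
  exact Or.inl (Or.inl (mul_comm _ _))

theorem neg_one_zpow_mul_self (k : ℤ) : (-1 : ℂ) ^ k * (-1) ^ k = 1 := by
  rw [← mul_zpow]
  simp

theorem weilInv_weyl2 {f : Fun2 N} (hf : IsRapid f) (β : ℂ) {ε : ℤ} (hε : ε * ε = 1)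
    (a₂ k₂ a₁ k₁ : ℤ) :
    weilInv (weyl2 N β ε a₂ k₂ a₁ k₁ f)
      = ((-1 : ℂ) ^ k₂) • weyl2 N β ε (a₂ + k₂) k₂ a₁ k₁ (weilInv f) := by
  have h : weilOp (((-1 : ℂ) ^ k₂) • weyl2 N β ε (a₂ + k₂) k₂ a₁ k₁ (weilInv f))
      = weyl2 N β ε a₂ k₂ a₁ k₁ f := by
    rw [weilOp_smul, weilOp_weyl2 hf.weilInv β hε, weilOp_weilInv hf, smul_smul,
      neg_one_zpow_mul_self, one_smul, add_sub_cancel_right]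
  rw [← h, weilInv_weilOp ((hf.weilInv.weyl2 _ _ _ _ _ _).smul _)]

theorem weilOp_qfac {q : ℂ} {Z Z' : Module.End ℂ (Fun2 N)}
    (hZ : ∀ f, IsRapid f → IsRapid (Z f)) (h : ∀ f, IsRapid f → weilOp (Z f) = Z' (weilOp f))
    (j : ℕ) {f : Fun2 N} (hf : IsRapid f) : weilOp (qfac q Z j f) = qfac q Z' j (weilOp f) := by
  induction j generalizing f with
  | zero => rfl
  | succ j ih =>
    rw [qfac_succ_apply, qfac_succ_apply, ih (hf.add ((hZ f hf).smul _)),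
      weilOp_add hf ((hZ f hf).smul _), weilOp_smul, h f hf]

/-- The conjugate of `e^{a𝐔₁ + k𝐘₁}`, the number `j` of contour shifts being `-a - k`. -/
def termOp (N : ℕ) [NeZero N] (β : ℂ) (ε : ℤ) (j : ℕ) (a k : ℤ) : Module.End ℂ (Fun2 N) :=
  qfac (bq N β) (-(weyl2 N β ε 1 (-1) 0 1)) j * weyl2 N β ε 0 (-k) a k

theorem IsRapid.termOp {f : Fun2 N} (hf : IsRapid f) (β : ℂ) (ε : ℤ) (j : ℕ) (a k : ℤ) :
    IsRapid (termOp N β ε j a k f) := by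
  refine isRapid_qfac (fun g hg => ?_) j (hf.weyl2 _ _ _ _ _ _)
  rw [LinearMap.neg_apply, ← neg_one_smul ℂ]
  exact (hg.weyl2 _ _ _ _ _ _).smul _

/-- With $W=e^{\mathbf U_2-\mathbf Y_2+\mathbf Y_1}$ the five groups are monomials preceded by $1$,
$1$, $1+\mathbf q^{-1}W$, $1+\mathbf q^{-1}W$ and $(1+\mathbf q^{-1}W)(1+\mathbf q^{-3}W)$; the
coefficient $\mathbf q+\mathbf q^{-1}$ is the middle term of the last product. -/
theorem casimirGen_eq_termOp (β : ℂ) {ε : ℤ} (hε : ε * ε = 1) (c₁ c₂ : ℂ) :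
    casimirGen N β ε c₁ c₂ = termOp N β ε 0 (-1) 1 + termOp N β ε 0 1 (-1)
      + c₁ • termOp N β ε 1 0 (-1) + c₂ • termOp N β ε 1 (-1) 0 + termOp N β ε 2 (-1) (-1) := by
  have hq := bq_ne_zero N β
  simp only [casimirGen, termOp, qfac, one_mul, mul_neg, smul_neg, sub_neg_eq_add, add_mul, mul_add,
    mul_one, smul_mul_assoc, mul_smul_comm, weyl2_mul β hε, smul_smul, neg_neg]
  norm_num
  have h1 : (bq N β)⁻¹ * bq N β = 1 := inv_mul_cancel₀ hq
  have h2 : (bq N β)⁻¹ * bq N β ^ 2 = bq N β := by field_simp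
  have h3 : (bq N β ^ 3)⁻¹ * bq N β ^ 2 = (bq N β)⁻¹ := by field_simp
  have h4 : (bq N β ^ 3)⁻¹ * ((bq N β)⁻¹ * bq N β ^ 4) = 1 := by field_simp
  simp only [smul_smul, h1, h2, h3, h4, mul_one]
  module

/-- Carries the operator found next to the dilogarithm back through $\mathcal V_2$. The factor
$y_1y_2^{-1}$ becomes $-e^{\mathbf U_2-\mathbf Y_2+\mathbf Y_1}$, and the sign $(-1)^k$ cancels the
one produced by the monomial. -/
theorem weilOp_termOp {f : Fun2 N} (hf : IsRapid f) (β : ℂ) {ε : ℤ} (hε : ε * ε = 1) (j : ℕ)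
    (a k : ℤ) :
    weilOp (((-1 : ℂ) ^ k) • qfac (bq N β) (weyl2 N β ε 0 (-1) 0 1) j
      (weyl2 N β ε (-k) (-k) a k f)) = termOp N β ε j a k (weilOp f) := by
  rw [weilOp_smul, weilOp_qfac (Z' := -(weyl2 N β ε 1 (-1) 0 1))
    (fun g hg => hg.weyl2 _ _ _ _ _ _) (fun g hg => ?_) j (hf.weyl2 _ _ _ _ _ _),
    weilOp_weyl2 hf β hε, ← map_smul, smul_smul, termOp, Module.End.mul_apply, sub_self]
  · congr 1
    rw [zpow_neg, mul_inv_cancel₀ (zpow_ne_zero _ (by norm_num)), one_smul]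
  · rw [weilOp_weyl2 hg β hε]
    norm_num

/-- $\mathcal S_2$ and $\mathcal V_2$ are moved onto the test functions, where they act by formulas
on entire functions. Only the dilogarithm, which does not preserve entire functions, stays inside
the pairing. -/
theorem inner_toH2_conj {S t D : H2 N ≃ₗᵢ[ℂ] H2 N} (hS : IsShift2 S)
    (ht : ∀ f, t f = weilUnitary N (D ((weilUnitary N).symm f))) {h w : Fun2 N} (hh : IsRapid h)
    (hw : IsRapid w) :
    inner ℂ (toH2 h) (S.symm (t.symm (toH2 w)))
      = inner ℂ (toH2 (weilInv (shear h))) (D.symm (toH2 (weilInv w))) := by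
  have hV : ∀ {f : Fun2 N}, IsRapid f → weilUnitary N (toH2 (weilInv f)) = toH2 f := fun hf => by
    rw [weilUnitary_toH2 hf.weilInv, weilOp_weilInv hf]
  have htw : t.symm (toH2 w) = weilUnitary N (D.symm (toH2 (weilInv w))) := by
    rw [LinearIsometryEquiv.symm_apply_eq, ht, LinearIsometryEquiv.symm_apply_apply,
      LinearIsometryEquiv.apply_symm_apply, hV hw]
  rw [← LinearIsometryEquiv.inner_map_eq_flip, hS.apply_toH2 hh, htw, ← hV hh.shear,
    LinearIsometryEquiv.inner_map_map]

/-- The adjoint relation behind the conjugation of a single term of `Q'₁`. -/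
theorem inner_weyl2_conj (hb : ‖b‖ = 1) (hre : 0 < b.re) (him : 0 < b.im)
    {S t D : H2 N ≃ₗᵢ[ℂ] H2 N} (hS : IsShift2 S) (hD : IsDilogMul b D)
    (ht : ∀ f, t f = weilUnitary N (D ((weilUnitary N).symm f))) {β : ℂ} {ε : ℤ}
    (hβ : (β = b ∧ ε = 1) ∨ (β = b⁻¹ ∧ ε = -1)) {j : ℕ} {a k : ℤ}
    (hak : (-k = 1 ∧ a = 1 ∧ j = 0) ∨ (-k = -1 ∧ a = -1 ∧ j = 0) ∨ (-k = 1 ∧ a = 0 ∧ j = 1) ∨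
      (-k = 0 ∧ a = -1 ∧ j = 1) ∨ (-k = 1 ∧ a = -1 ∧ j = 2)) {h w : Fun2 N} (hh : IsRapid h)
    (hw : IsRapid w) :
    inner ℂ (toH2 (weyl2 N β⁻¹ (-ε) 0 0 a k h)) (S.symm (t.symm (toH2 w)))
      = inner ℂ (toH2 h) (S.symm (t.symm (toH2 (termOp N β ε j a k w)))) := by
  have hε : ε * ε = 1 := by rcases hβ with ⟨_, rfl⟩ | ⟨_, rfl⟩ <;> norm_num
  have hε' : -ε * -ε = 1 := by rw [neg_mul_neg, hε]
  have hG := hh.shear.weilInv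
  have hP := isRapid_qfac (q := bq N β) (fun g hg => hg.weyl2 β ε 0 (-1) 0 1) j
    (hw.weilInv.weyl2 β ε (-k) (-k) a k)
  have hR : weilInv (termOp N β ε j a k w) = ((-1 : ℂ) ^ k) •
      qfac (bq N β) (weyl2 N β ε 0 (-1) 0 1) j (weyl2 N β ε (-k) (-k) a k (weilInv w)) := by
    have h := weilOp_termOp hw.weilInv β hε j a k
    rw [weilOp_weilInv hw] at h
    rw [← h, weilInv_weilOp (hP.smul _)]
  rw [inner_toH2_conj hS ht (hh.weyl2 _ _ _ _ _ _) hw, inner_toH2_conj hS ht hh (hw.termOp _ _ _ _ _),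
    shear_weyl2, weilInv_weyl2 hh.shear _ hε', zero_add, toH2_smul (hG.weyl2 _ _ _ _ _ _),
    inner_smul_left, inner_weyl2_dilogMul_symm hb hre him hD hβ (-k) k hak hG hw.weilInv, hR,
    toH2_smul hP, map_smul, inner_smul_right]
  congr 1
  rw [map_zpow₀, map_neg, map_one, zpow_neg, inv_eq_of_mul_eq_one_left (neg_one_zpow_mul_self k)]

/-- `Q'₁` for the parameters `(β, ε)`, acting on the second tensor factor. -/
def factorGen (N : ℕ) [NeZero N] (β : ℂ) (ε : ℤ) (c₁ c₂ : ℂ) : Module.End ℂ (Fun2 N) :=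
  weyl2 N β ε 0 0 (-1) 1 + weyl2 N β ε 0 0 1 (-1) + c₁ • weyl2 N β ε 0 0 0 (-1)
    + c₂ • weyl2 N β ε 0 0 (-1) 0 + weyl2 N β ε 0 0 (-1) (-1)

theorem onSnd_Q1' (l₁ l₂ : ℂ) :
    onSnd (Q1' N b l₁ l₂) = factorGen N b 1 (casimirValue l₁) (casimirValue l₂) := by
  simp only [Q1', bu_eq_weyl, onSnd_add, onSnd_smul, onSnd_weyl, factorGen]

theorem onSnd_Q1'T (l₁ l₂ : ℂ) :
    onSnd (Q1'T N b l₁ l₂) = factorGen N b⁻¹ (-1) (casimirValue (starRingEnd ℂ l₁))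
      (casimirValue (starRingEnd ℂ l₂)) := by
  simp only [Q1'T, but_eq_weyl, onSnd_add, onSnd_smul, onSnd_weyl, factorGen]

theorem toH2_combination {f₁ f₂ f₃ f₄ f₅ : Fun2 N} (h₁ : IsRapid f₁) (h₂ : IsRapid f₂)
    (h₃ : IsRapid f₃) (h₄ : IsRapid f₄) (h₅ : IsRapid f₅) (c₁ c₂ : ℂ) :
    toH2 (f₁ + f₂ + c₁ • f₃ + c₂ • f₄ + f₅)
      = toH2 f₁ + toH2 f₂ + c₁ • toH2 f₃ + c₂ • toH2 f₄ + toH2 f₅ := by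
  rw [toH2_add (((h₁.add h₂).add (h₃.smul _)).add (h₄.smul _)) h₅,
    toH2_add ((h₁.add h₂).add (h₃.smul _)) (h₄.smul _), toH2_add (h₁.add h₂) (h₃.smul _),
    toH2_add h₁ h₂, toH2_smul h₃, toH2_smul h₄]

theorem toH2_casimirGen {w : Fun2 N} (hw : IsRapid w) (β : ℂ) {ε : ℤ} (hε : ε * ε = 1)
    (c₁ c₂ : ℂ) :
    toH2 (casimirGen N β ε c₁ c₂ w) = toH2 (termOp N β ε 0 (-1) 1 w) + toH2 (termOp N β ε 0 1 (-1) w)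
      + c₁ • toH2 (termOp N β ε 1 0 (-1) w) + c₂ • toH2 (termOp N β ε 1 (-1) 0 w)
      + toH2 (termOp N β ε 2 (-1) (-1) w) := by
  rw [casimirGen_eq_termOp β hε]
  exact toH2_combination (hw.termOp _ _ _ _ _) (hw.termOp _ _ _ _ _) (hw.termOp _ _ _ _ _)
    (hw.termOp _ _ _ _ _) (hw.termOp _ _ _ _ _) c₁ c₂

theorem inner_factorGen_conj (hb : ‖b‖ = 1) (hre : 0 < b.re) (him : 0 < b.im)
    {S t D : H2 N ≃ₗᵢ[ℂ] H2 N} (hS : IsShift2 S) (hD : IsDilogMul b D)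
    (ht : ∀ f, t f = weilUnitary N (D ((weilUnitary N).symm f))) {β : ℂ} {ε : ℤ}
    (hβ : (β = b ∧ ε = 1) ∨ (β = b⁻¹ ∧ ε = -1)) (c₁ c₂ : ℂ) {h w : Fun2 N} (hh : IsRapid h)
    (hw : IsRapid w) :
    inner ℂ (toH2 (factorGen N β⁻¹ (-ε) (starRingEnd ℂ c₁) (starRingEnd ℂ c₂) h))
        (S.symm (t.symm (toH2 w)))
      = inner ℂ (toH2 h) (S.symm (t.symm (toH2 (casimirGen N β ε c₁ c₂ w)))) := by
  have hε : ε * ε = 1 := by rcases hβ with ⟨_, rfl⟩ | ⟨_, rfl⟩ <;> norm_num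
  have e : toH2 (factorGen N β⁻¹ (-ε) (starRingEnd ℂ c₁) (starRingEnd ℂ c₂) h) = _ :=
    toH2_combination (hh.weyl2 _ _ _ _ _ _) (hh.weyl2 _ _ _ _ _ _) (hh.weyl2 _ _ _ _ _ _)
      (hh.weyl2 _ _ _ _ _ _) (hh.weyl2 _ _ _ _ _ _) _ _
  rw [e, toH2_casimirGen hw β hε]
  simp only [map_add, map_smul, inner_add_left, inner_add_right, inner_smul_left, inner_smul_right,
    Complex.conj_conj]
  rw [inner_weyl2_conj (j := 0) hb hre him hS hD ht hβ (by norm_num) hh hw,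
    inner_weyl2_conj (j := 0) hb hre him hS hD ht hβ (by norm_num) hh hw,
    inner_weyl2_conj (j := 1) hb hre him hS hD ht hβ (by norm_num) hh hw,
    inner_weyl2_conj (j := 1) hb hre him hS hD ht hβ (by norm_num) hh hw,
    inner_weyl2_conj (j := 2) hb hre him hS hD ht hβ (by norm_num) hh hw]

theorem conj_casimirValue (l : ℂ) :
    starRingEnd ℂ (casimirValue l) = casimirValue (starRingEnd ℂ l) := by
  simp [casimirValue]

/-- An operator relation on `𝒲₂` passes to the closure of the graph. -/
theorem adjointActs_of_closureActs {A B : Module.End ℂ (Fun2 N)} (U : H2 N ≃ₗᵢ[ℂ] H2 N)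
    (h : ∀ w ∈ W2 N, ∀ w' ∈ W2 N,
      inner ℂ (toH2 (B w')) (U (toH2 w)) = inner ℂ (toH2 w') (U (toH2 (A w)))) {F G : H2 N}
    (hFG : ClosureActs A F G) : AdjointActs B (U F) (U G) := by
  intro w' hw'
  have hU := U.continuous
  have hcl : IsClosed {p : H2 N × H2 N |
      inner ℂ (toH2 (B w')) (U p.1) = inner ℂ (toH2 w') (U p.2)} :=
    isClosed_eq (by fun_prop) (by fun_prop)
  refine closure_minimal ?_ hcl hFG
  rintro _ ⟨w, hw, rfl⟩
  exact h w hw w' hw'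

theorem bq_sub_inv_ne_zero {β : ℂ} (h : ‖bq N β‖ ≠ 1) : bq N β - (bq N β)⁻¹ ≠ 0 := by
  intro h0
  have h1 : bq N β * bq N β = 1 := by
    have := bq_ne_zero N β
    calc bq N β * bq N β = bq N β * (bq N β)⁻¹ := by rw [← sub_eq_zero.1 h0]
      _ = 1 := mul_inv_cancel₀ this
  have h2 := congrArg norm h1
  rw [norm_mul, norm_one] at h2
  exact h ((mul_self_eq_one_iff.1 h2).resolve_right (by linarith [norm_nonneg (bq N β)]))

end Conjugation

end QTorus

end

/-! ### The conjugation lemma -/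

theorem mainTheorem5 (N : ℕ) [NeZero N] (b : ℂ) (hb : ‖b‖ = 1) (hre : 0 < b.re) (him : 0 < b.im)
    (l₁ l₂ : ℂ) (hl₁ : l₁ ≠ 0) (hl₂ : l₂ ≠ 0) :
    (∃! S : QTorus.H2 N ≃ₗᵢ[ℂ] QTorus.H2 N, QTorus.IsShift2 S) ∧
    (∃! V : QTorus.H2 N ≃ₗᵢ[ℂ] QTorus.H2 N, QTorus.IsWeil2 V) ∧
    (∃! D : QTorus.H2 N ≃ₗᵢ[ℂ] QTorus.H2 N, QTorus.IsDilogMul b D) ∧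
    ∀ S t : QTorus.H2 N ≃ₗᵢ[ℂ] QTorus.H2 N, QTorus.IsShift2 S → QTorus.IsT21 b t →
      (∀ w ∈ QTorus.W2 N, ∃ G : QTorus.H2 N,
        QTorus.Q1'Acts N b l₁ l₂ (S.symm (t.symm (QTorus.toH2 w))) G ∧
        t (S G) = QTorus.toH2 (QTorus.Q21 N b l₁ l₂ w)) ∧
      (∀ F G : QTorus.H2 N, QTorus.ClosureActs (QTorus.Q21 N b l₁ l₂) F G →
        QTorus.AdjointActs (QTorus.onSnd (QTorus.Q1'T N b l₁ l₂))
          (S.symm (t.symm F)) (S.symm (t.symm G))) ∧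
      (∀ F G : QTorus.H2 N, QTorus.ClosureActs (QTorus.onSnd (QTorus.Q1' N b l₁ l₂)) F G →
        QTorus.AdjointActs (QTorus.Q21T N b l₁ l₂) (t (S F)) (t (S G))) := by
  refine ⟨QTorus.existsUnique_isShift2, QTorus.existsUnique_isWeil2,
    QTorus.existsUnique_isDilogMul hb hre him, fun S t hS hT => ?_⟩
  obtain ⟨V, D, hV, hD, ht⟩ := hT
  obtain rfl := hV.eq_weilUnitary
  have hq := QTorus.norm_bq_lt_one (N := N) hre him
  have hq' := QTorus.norm_bq_inv_lt_one (N := N) hb hre him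
  have hQ := QTorus.Q21_eq b l₁ l₂ (QTorus.bq_sub_inv_ne_zero hq.ne)
  have hQT := QTorus.Q21T_eq b l₁ l₂ (QTorus.bq_sub_inv_ne_zero (N := N) (fun h => by
    rw [norm_inv, h, inv_one] at hq'
    exact lt_irrefl _ hq'))
  have hβ : (b = b ∧ (1 : ℤ) = 1) ∨ (b = b⁻¹ ∧ (1 : ℤ) = -1) := Or.inl ⟨rfl, rfl⟩
  have hβ' : (b⁻¹ = b ∧ (-1 : ℤ) = 1) ∨ (b⁻¹ = b⁻¹ ∧ (-1 : ℤ) = -1) := Or.inr ⟨rfl, rfl⟩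
  refine ⟨fun w hw => ?_, fun F G hFG => ?_, fun F G hFG => ?_⟩
  · have hwr := QTorus.isRapid_of_mem_W2 hw
    have hE : ∀ {j : ℕ} {a k : ℤ}, ((-k = 1 ∧ a = 1 ∧ j = 0) ∨ (-k = -1 ∧ a = -1 ∧ j = 0) ∨
        (-k = 1 ∧ a = 0 ∧ j = 1) ∨ (-k = 0 ∧ a = -1 ∧ j = 1) ∨ (-k = 1 ∧ a = -1 ∧ j = 2)) →
        QTorus.ExpActs N b a k (S.symm (t.symm (QTorus.toH2 w)))
          (S.symm (t.symm (QTorus.toH2 (QTorus.termOp N b 1 j a k w)))) := by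
      intro j a k hak w' hw'
      rw [QTorus.but_eq_weyl, QTorus.onSnd_weyl]
      exact QTorus.inner_weyl2_conj hb hre him hS hD ht hβ hak (QTorus.isRapid_of_mem_W2 hw') hwr
    -- The five components of the image are the transported `termOp` vectors, with `j = -a - k`
    -- equal to 0, 0, 1, 1, 2.
    refine ⟨S.symm (t.symm (QTorus.toH2 (QTorus.Q21 N b l₁ l₂ w))), ⟨_, _, _, _, _,
      hE (j := 0) (by norm_num), hE (j := 0) (by norm_num), hE (j := 1) (by norm_num),
      hE (j := 1) (by norm_num), hE (j := 2) (by norm_num), ?_⟩, by simp⟩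
    rw [hQ, QTorus.toH2_casimirGen hwr b (by norm_num)]
    simp only [map_add, map_smul]
  · refine QTorus.adjointActs_of_closureActs (t.symm.trans S.symm) (fun w hw w' hw' => ?_) hFG
    rw [QTorus.onSnd_Q1'T, hQ, ← QTorus.conj_casimirValue, ← QTorus.conj_casimirValue]
    exact QTorus.inner_factorGen_conj hb hre him hS hD ht hβ _ _ (QTorus.isRapid_of_mem_W2 hw')
      (QTorus.isRapid_of_mem_W2 hw)
  · refine QTorus.adjointActs_of_closureActs (S.trans t) (fun w hw w' hw' => ?_) hFG
    -- The identity for the dual half relates $Q_1'$ on `w` to $\tilde Q_{21}$ on `w'`. Conjugating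
    -- it and moving the unitary to the other side gives the relation for $t_{21}\mathcal S_2$
    -- instead of its inverse.
    have h := QTorus.inner_factorGen_conj hb hre him hS hD ht hβ'
      (QTorus.casimirValue (starRingEnd ℂ l₁)) (QTorus.casimirValue (starRingEnd ℂ l₂))
      (QTorus.isRapid_of_mem_W2 hw) (QTorus.isRapid_of_mem_W2 hw')
    rw [inv_inv, neg_neg, QTorus.conj_casimirValue, QTorus.conj_casimirValue, Complex.conj_conj,
      Complex.conj_conj, ← QTorus.onSnd_Q1', ← hQT] at h
    have h' := congrArg (starRingEnd ℂ) h
    rw [inner_conj_symm, inner_conj_symm, LinearIsometryEquiv.inner_map_eq_flip,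
      LinearIsometryEquiv.inner_map_eq_flip, LinearIsometryEquiv.inner_map_eq_flip,
      LinearIsometryEquiv.inner_map_eq_flip] at h'
    exact h'.symm
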